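/- Let $n\ge 1$ and $g=n-1$, and let $B_{m}$ be the braid group on $m$ strands with standard generators $\sigma_1,\dots,\sigma_{m-1}$. *The Jones representation.* Call $q\in\mathbb C\setminus\{0\}$ $m$-regular if $q^l\ne 1$ for $2\le l\le m$. For $m$-regular $q$ and $d\ge 0$ let $\pi_q^{m,d}$ be the representation of $B_m$ attached to the two-row Young diagram $\lambda=(\lambda_1\ge\lambda_1-d)$ with $m$ boxes: it acts on the vector space with basis $v_t$, $t$ running through the standard tableaux of shape $\lambda$, by $\sigma_i\mapsto 1-(1+q^{-1})e_i$, where $$e_iv_t=a_{r}(q)\,v_t+\bigl(a_{r}(q)a_{-r}(q)\bigr)^{1/2}v_{s_it},\qquad a_r(q)=\frac{1-q^{r+1}}{(1+q)(1-q^r)},$$ $r$ is the axial distance (content of the box of $i$ minus content of the box of $i+1$, content being column minus row), $s_it$ is $t$ with $i,i+1$ exchanged, and $v_{s_it}=0$ if $s_it$ is not standard. (This is $q^{-1}$ times the Hecke algebra generator with eigenvalues $q,-1$.) *The extension.* Let $V^{m,0}$ be the complex vector space with basis the non-crossing pairings (arc diagrams) of $m$ points $1,\dots,m$ on a line. For $A\in\mathbb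 C\setminus\{0\}$ let $\eta_A$ be the representation of $B_m$ on $V^{m,0}$ with $\sigma_i\mapsto A+A^{-1}e_i$, where $e_i$ acts by stacking the $i$-th Temperley–Lieb generator, a closed circle being replaced by the factor $-A^2-A^{-2}$. Let $\hat\pi_A$ be the representation of $B_{m}$ on $V^{m,0}$ with $\sigma_i\mapsto A^{-1}\eta_A(\sigma_i)$. *The homological representation.* Let $\Sigma_g$ be the closed oriented surface of genus $g$, viewed as the double cover of the sphere branched over $2n=2g+2$ points, let $c_i$ ($1\le i\le 2n-1$) be the closed curve on $\Sigma_g$ lifting the segment between the $i$-th and the $(i+1)$-st branch point, and let $\Psi:B_{2n}\to M(g,0)$ be the Birman–Hilden homomorphism to the mapping class group, which maps $\sigma_i$ to the Dehn twist $t_{c_i}$. The curves are oriented so that, in $H_1(\Sigma_g,\mathbb C)$, $(t_{c_i})_*c_{i+1}=c_{i+1}+c_i$. Let $\omega\in\Lambda^2H_1(\Sigma_g,\mathbb C)$ be the bivector dual to the intersection pairing, and let $\rho_{\hom}^{g,l}$ be the representation of $B_{2n}$ on $\Lambda^lH_1(\Sigma_g,\mathbb C)/(\omega\wedge\Lambda^{l-2}H_1(\Sigma_g,\mathbb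 C))$ induced through $\Psi$ by the action on homology (with $\Lambda^0=\mathbb C$ and $\Lambda^{-1}=\Lambda^{-2}=0$). **Theorem.** The Jones representation $\pi_q^{2n,0}$ has a natural extension to $q=-1$, for which it is equivalent to $\rho_{\hom}^{g,g}$. Precisely: 1. For every braid, the matrix entries of $\hat\pi_A$ on $V^{2n,0}$ in the basis of arc diagrams are Laurent polynomials in $A$ with integer coefficients. 2. If $A\ne 0$ and $q=A^4$ is $2n$-regular, then $\hat\pi_A$ on $V^{2n,0}$ is equivalent to $\pi_q^{2n,0}$. 3. If $A^4=-1$, then $\hat\pi_A$ on $V^{2n,0}$ is equivalent to $\rho_{\hom}^{g,g}$. 4. For $A=\exp(-\pi i/4)$ there is such an equivalence that maps each arc diagram $D$ to the class of $$(-i)^{\sum_e (w(e)+v(e))}\bigwedge_e X_e\in\Lambda^gH_1(\Sigma_g,\mathbb C).$$ Here $e$ runs, in the order of the left end points, through the arcs of the diagram $\tilde D$ obtained from $D$ by deleting the arc ending in the last point $2n$ and connecting its other end point to $\infty$; $X_e=c_{e_0}+c_{e_0+1}+\dots+c_{e_1-1}$ for an arc $e$ with end points $e_0<e_1$; $w(e)$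 is the number of arcs lying strictly between the end points of $e$; and $v(e)$ is the number of points greater than $e_1$ that are connected to $\infty$ in $\tilde D$. -/

import Mathlib

namespace JonesHomology

/-! ### The braid group -/

/-- Artin's relations among the generators `σ_1, …, σ_{m-1}` (indexed from `0`). -/
def braidRels (m : ℕ) : Set (FreeGroup (Fin (m - 1))) :=
  {r | ∃ i j : Fin (m - 1), (i : ℕ) + 2 ≤ j ∧
      r = .of i * .of j * (.of j * .of i)⁻¹} ∪
  {r | ∃ i j : Fin (m - 1), (i : ℕ) + 1 = j ∧
      r = .of i * .of j * .of i * (.of j * .of i * .of j)⁻¹}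

/-- The braid group `B_m` on `m` strands. -/
abbrev Braid (m : ℕ) : Type := PresentedGroup (braidRels m)

/-- The standard generator `σ_{i+1}` of `B_m`, crossing the strands `i` and `i + 1`
(strands are numbered from `0`). -/
def Braid.σ {m : ℕ} (i : Fin (m - 1)) : Braid m := PresentedGroup.of i

/-- A homomorphism out of the braid group is given by elements satisfying Artin's relations. -/
def Braid.lift {m : ℕ} {G : Type*} [Group G] (s : Fin (m - 1) → G)
    (hcomm : ∀ i j : Fin (m - 1), (i : ℕ) + 2 ≤ j → s i * s j = s j * s i)
    (hbraid : ∀ i j : Fin (m - 1), (i : ℕ) + 1 = j → s i * s j * s i = s j * s i * s j) :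
    Braid m →* G :=
  PresentedGroup.toGroup (f := s) (by
    rintro r (⟨i, j, h, rfl⟩ | ⟨i, j, h, rfl⟩)
    · simp only [map_mul, map_inv, FreeGroup.lift_apply_of]
      rw [mul_inv_eq_one]; exact hcomm i j h
    · simp only [map_mul, map_inv, FreeGroup.lift_apply_of]
      rw [mul_inv_eq_one]; exact hbraid i j h)

theorem Braid.lift_σ {m : ℕ} {G : Type*} [Group G] (s : Fin (m - 1) → G)
    (hcomm : ∀ i j : Fin (m - 1), (i : ℕ) + 2 ≤ j → s i * s j = s j * s i)
    (hbraid : ∀ i j : Fin (m - 1), (i : ℕ) + 1 = j → s i * s j * s i = s j * s i * s j)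
    (i : Fin (m - 1)) : Braid.lift s hcomm hbraid (Braid.σ i) = s i :=
  PresentedGroup.toGroup.of _

/-- Every property of braids that holds for the generators and passes to products and inverses
holds for all braids. -/
theorem Braid.induction {m : ℕ} {C : Braid m → Prop} (one : C 1) (gen : ∀ i, C (Braid.σ i))
    (mul : ∀ x y, C x → C y → C (x * y)) (inv : ∀ x, C x → C x⁻¹) (b : Braid m) : C b :=
  PresentedGroup.generated_by _
    { carrier := {b | C b}, one_mem' := one, mul_mem' := fun {x y} => mul x y,
      inv_mem' := fun {x} => inv x } gen b

/-- The left one of the two neighbouring points exchanged by `σ_{i+1}`. -/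
def lo {m : ℕ} (i : Fin (m - 1)) : Fin m := ⟨i, by omega⟩

/-- The right one of the two neighbouring points exchanged by `σ_{i+1}`. -/
def hi {m : ℕ} (i : Fin (m - 1)) : Fin m := ⟨i + 1, by omega⟩

/-! ### The closed surface as a branched double cover of the sphere -/

/-- Relators of the orbifold fundamental group of the sphere with `2n` cone points of order two:
`x_j ^ 2` for the small loop `x_j` about the `j`-th cone point, and `x_0 x_1 ⋯ x_{2n-1}`. -/
def orbifoldRels (n : ℕ) : Set (FreeGroup (Fin (2 * n))) :=
  {r | ∃ j, r = .of j * .of j} ∪ {(List.ofFn fun j => FreeGroup.of j).prod}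

/-- The orbifold fundamental group of the sphere with `2n` cone points of order two. -/
abbrev OrbifoldGroup (n : ℕ) : Type := PresentedGroup (orbifoldRels n)

/-- The loop around the `j`-th cone point. -/
def OrbifoldGroup.x {n : ℕ} (j : Fin (2 * n)) : OrbifoldGroup n := PresentedGroup.of j

open OrbifoldGroup (x)

theorem x_mul_self {n : ℕ} (j : Fin (2 * n)) : x j * x j = 1 :=
  PresentedGroup.one_of_mem (x := FreeGroup.of j * FreeGroup.of j) (Or.inl ⟨j, rfl⟩)

theorem x_inv {n : ℕ} (j : Fin (2 * n)) : (x j)⁻¹ = x j :=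
  inv_eq_of_mul_eq_one_left (x_mul_self j)

theorem prod_x (n : ℕ) : (List.ofFn fun j : Fin (2 * n) => x j).prod = 1 := by
  have := PresentedGroup.one_of_mem (rels := orbifoldRels n) (Or.inr rfl)
  rw [map_list_prod, List.map_ofFn] at this
  exact this

/-- A homomorphism out of the orbifold group. -/
def OrbifoldGroup.lift {n : ℕ} {G : Type*} [Group G] (f : Fin (2 * n) → G)
    (hsq : ∀ j, f j * f j = 1) (hprod : (List.ofFn f).prod = 1) : OrbifoldGroup n →* G :=
  PresentedGroup.toGroup (f := f) (by
    rintro r (⟨j, rfl⟩ | rfl)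
    · rw [map_mul, FreeGroup.lift_apply_of]; exact hsq j
    · rw [map_list_prod, List.map_ofFn]
      have e : (FreeGroup.lift f) ∘ (fun j => FreeGroup.of j) = f := by
        funext j; exact FreeGroup.lift_apply_of
      rw [e]; exact hprod)

theorem OrbifoldGroup.lift_x {n : ℕ} {G : Type*} [Group G] (f : Fin (2 * n) → G)
    (hsq : ∀ j, f j * f j = 1) (hprod : (List.ofFn f).prod = 1) (j : Fin (2 * n)) :
    OrbifoldGroup.lift f hsq hprod (x j) = f j :=
  PresentedGroup.toGroup.of _

/-- The monodromy of the double cover branched over the `2n` points: each loop `x_j` exchanges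
the two sheets. -/
def sheet (n : ℕ) : OrbifoldGroup n →* Multiplicative (ZMod 2) :=
  OrbifoldGroup.lift (fun _ => .ofAdd 1) (fun _ => by decide) (by
    rw [List.ofFn_const, List.prod_replicate, pow_mul,
      show (Multiplicative.ofAdd (1 : ZMod 2)) ^ 2 = 1 by decide, one_pow])

theorem sheet_x {n : ℕ} (j : Fin (2 * n)) : sheet n (x j) = .ofAdd 1 :=
  OrbifoldGroup.lift_x ..

/-- The fundamental group of the closed oriented surface `Σ_g` of genus `g = n - 1`, the double
cover of the sphere branched over `2n = 2g + 2` points. -/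
abbrev SurfaceGroup (n : ℕ) : Subgroup (OrbifoldGroup n) := (sheet n).ker

/-! ### The braid group action -/

theorem prod_ofFn_congr {G : Type*} [Group G] {m : ℕ} (i : ℕ) (hi : i + 1 < m) (f g : Fin m → G)
    (h : ∀ k : Fin m, (k : ℕ) ≠ i → (k : ℕ) ≠ i + 1 → f k = g k)
    (h2 : f ⟨i, by omega⟩ * f ⟨i + 1, hi⟩ = g ⟨i, by omega⟩ * g ⟨i + 1, hi⟩) :
    (List.ofFn f).prod = (List.ofFn g).prod := by
  induction i generalizing m with
  | zero =>
    obtain ⟨m, rfl⟩ : ∃ k, m = k + 2 := ⟨m - 2, by omega⟩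
    simp only [List.ofFn_succ, List.prod_cons, ← mul_assoc]
    have e : (fun i : Fin m => f i.succ.succ) = fun i => g i.succ.succ := by
      funext k; exact h _ (by simp) (by simp)
    rw [e]
    congr 1
  | succ i ih =>
    obtain ⟨m, rfl⟩ : ∃ k, m = k + 1 := ⟨m - 1, by omega⟩
    rw [List.ofFn_succ, List.ofFn_succ, List.prod_cons, List.prod_cons,
      h 0 (by simp) (by simp)]
    congr 1
    exact ih (by omega) _ _ (fun k h1 h3 => h _ (by simpa using h1) (by simpa using h3)) h2

/-- Artin's action of `σ_{i+1}` on loops: `x_i ↦ x_i x_{i+1} x_i⁻¹`, `x_{i+1} ↦ x_i`, and the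
other loops are fixed. -/
def artinFun {n : ℕ} (i : Fin (2 * n - 1)) (k : Fin (2 * n)) : OrbifoldGroup n :=
  if (k : ℕ) = i then x (lo i) * x (hi i) * (x (lo i))⁻¹
  else if (k : ℕ) = i + 1 then x (lo i) else x k

/-- The inverse of Artin's action of `σ_{i+1}`. -/
def artinInvFun {n : ℕ} (i : Fin (2 * n - 1)) (k : Fin (2 * n)) : OrbifoldGroup n :=
  if (k : ℕ) = i then x (hi i)
  else if (k : ℕ) = i + 1 then (x (hi i))⁻¹ * x (lo i) * x (hi i) else x k

theorem conj_sq {G : Type*} [Group G] {a b : G} (hb : b * b = 1) :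
    a * b * a⁻¹ * (a * b * a⁻¹) = 1 := by
  rw [show a * b * a⁻¹ * (a * b * a⁻¹) = a * (b * b) * a⁻¹ by group, hb]; simp

/-- Artin's action of `σ_{i+1}` as an endomorphism of the orbifold group. -/
def artinHom {n : ℕ} (i : Fin (2 * n - 1)) : OrbifoldGroup n →* OrbifoldGroup n :=
  OrbifoldGroup.lift (artinFun i)
    (by
      intro k
      unfold artinFun
      split_ifs
      exacts [conj_sq (x_mul_self _), x_mul_self _, x_mul_self _])
    (by
      rw [← prod_x n]
      refine prod_ofFn_congr i (by omega) _ _ (fun k h1 h2 => by simp [artinFun, h1, h2]) ?_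
      simp [artinFun, lo, hi])

/-- The inverse of `artinHom`. -/
def artinInvHom {n : ℕ} (i : Fin (2 * n - 1)) : OrbifoldGroup n →* OrbifoldGroup n :=
  OrbifoldGroup.lift (artinInvFun i)
    (by
      intro k
      unfold artinInvFun
      split_ifs
      · exact x_mul_self _
      · have h := conj_sq (a := (x (hi i))⁻¹) (x_mul_self (lo i))
        rwa [inv_inv] at h
      · exact x_mul_self _)
    (by
      rw [← prod_x n]
      refine prod_ofFn_congr i (by omega) _ _ (fun k h1 h2 => by simp [artinInvFun, h1, h2]) ?_
      simp [artinInvFun, lo, hi, mul_assoc])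

theorem artinHom_x {n : ℕ} (i : Fin (2 * n - 1)) (k : Fin (2 * n)) :
    artinHom i (x k) = artinFun i k := OrbifoldGroup.lift_x ..

theorem artinInvHom_x {n : ℕ} (i : Fin (2 * n - 1)) (k : Fin (2 * n)) :
    artinInvHom i (x k) = artinInvFun i k := OrbifoldGroup.lift_x ..

/-- Artin's automorphism attached to `σ_{i+1}`. -/
def artinAut {n : ℕ} (i : Fin (2 * n - 1)) : MulAut (OrbifoldGroup n) :=
  MonoidHom.toMulEquiv (artinHom i) (artinInvHom i)
    (by
      apply PresentedGroup.ext
      intro k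
      change artinInvHom i (artinHom i (x k)) = x k
      rw [artinHom_x]
      unfold artinFun
      split_ifs with h1 h2
      · have : k = lo i := Fin.ext h1
        subst this
        simp [artinInvHom_x, artinInvFun, lo, hi, mul_assoc]
      · have : k = hi i := Fin.ext h2
        subst this
        simp [artinInvHom_x, artinInvFun, lo, hi]
      · simp [artinInvHom_x, artinInvFun, h1, h2])
    (by
      apply PresentedGroup.ext
      intro k
      change artinHom i (artinInvHom i (x k)) = x k
      rw [artinInvHom_x]
      unfold artinInvFun
      split_ifs with h1 h2
      · have : k = lo i := Fin.ext h1
        subst this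
        simp [artinHom_x, artinFun, lo, hi]
      · have : k = hi i := Fin.ext h2
        subst this
        simp [artinHom_x, artinFun, lo, hi, mul_assoc]
      · simp [artinHom_x, artinFun, h1, h2])

theorem artinAut_x {n : ℕ} (i : Fin (2 * n - 1)) (k : Fin (2 * n)) :
    artinAut i (x k) = artinFun i k := artinHom_x i k

theorem artinAut_of_eq {n : ℕ} (i : Fin (2 * n - 1)) (k : Fin (2 * n)) (h : (k : ℕ) = i)
    (hk : (i : ℕ) + 1 < 2 * n) :
    artinAut i (x k) = x k * x ⟨i + 1, hk⟩ * (x k)⁻¹ := by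
  have : k = lo i := Fin.ext h
  subst this
  rw [artinAut_x, artinFun, if_pos h]; rfl

theorem artinAut_of_eq_succ {n : ℕ} (i : Fin (2 * n - 1)) (k : Fin (2 * n))
    (h : (k : ℕ) = i + 1) (hk : (i : ℕ) < 2 * n) : artinAut i (x k) = x ⟨i, hk⟩ := by
  rw [artinAut_x, artinFun, if_neg (by omega), if_pos h]; rfl

theorem artinAut_of_ne {n : ℕ} (i : Fin (2 * n - 1)) (k : Fin (2 * n)) (h : (k : ℕ) ≠ i)
    (h' : (k : ℕ) ≠ i + 1) : artinAut i (x k) = x k := by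
  rw [artinAut_x, artinFun, if_neg h, if_neg h']

theorem mulAut_ext {n : ℕ} {φ ψ : MulAut (OrbifoldGroup n)} (h : ∀ k, φ (x k) = ψ (x k)) :
    φ = ψ := by
  have : (φ : OrbifoldGroup n →* OrbifoldGroup n) = ψ := PresentedGroup.ext h
  ext g
  exact DFunLike.congr_fun this g

/-- Artin's action of `B_{2n}` on the orbifold fundamental group of the sphere with `2n` cone
points (the braid group acting as mapping classes of the disk with `2n` marked points). -/
def artin (n : ℕ) : Braid (2 * n) →* MulAut (OrbifoldGroup n) :=
  Braid.lift artinAut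
    (by
      intro i j hij
      apply mulAut_ext
      intro k
      simp only [MulAut.mul_apply, artinAut_x]
      have e1 : (i : ℕ) ≠ j := by omega
      have e2 : (i : ℕ) ≠ j + 1 := by omega
      have e3 : (i : ℕ) + 1 ≠ j := by omega
      by_cases h1 : (k : ℕ) = i
      · simp [artinFun, h1, artinAut_x, lo, hi, e1, e2, e3]
      by_cases h2 : (k : ℕ) = i + 1
      · simp [artinFun, h2, artinAut_x, lo, e1, e2, e3]
      by_cases h3 : (k : ℕ) = j
      · simp [artinFun, h3, artinAut_x, lo, hi, e1.symm, e2.symm, e3.symm]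
      by_cases h4 : (k : ℕ) = j + 1
      · simp [artinFun, h4, artinAut_x, lo, e1.symm, e2.symm, e3.symm]
      simp [artinFun, h1, h2, h3, h4, artinAut_x])
    (by
      intro i j hij
      apply mulAut_ext
      intro k
      simp only [MulAut.mul_apply]
      obtain ⟨i, hi⟩ := i
      obtain ⟨j, hj⟩ := j
      obtain ⟨k, hk⟩ := k
      obtain rfl : i + 1 = j := hij
      have a1 := artinAut_of_eq ⟨i, hi⟩ ⟨i, by omega⟩ rfl (by simp; omega)
      have a2 := artinAut_of_eq_succ ⟨i, hi⟩ ⟨i + 1, by omega⟩ rfl (by simp; omega)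
      have a3 := artinAut_of_ne ⟨i, hi⟩ ⟨i + 1 + 1, by omega⟩ (by simp; omega) (by simp)
      have b1 := artinAut_of_ne ⟨i + 1, hj⟩ ⟨i, by omega⟩ (by simp) (by simp; omega)
      have b2 := artinAut_of_eq ⟨i + 1, hj⟩ ⟨i + 1, by omega⟩ rfl (by simp; omega)
      have b3 := artinAut_of_eq_succ ⟨i + 1, hj⟩ ⟨i + 1 + 1, by omega⟩ rfl (by simp; omega)
      dsimp only at a1 a2 a3 b1 b2 b3
      by_cases h1 : k = i
      · subst h1
        simp only [a1, a2, a3, b1, b2, b3, map_mul, map_inv]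
        group
      by_cases h2 : k = i + 1
      · subst h2
        simp only [a1, a2, a3, b1, b2, b3, map_mul, map_inv]
      by_cases h3 : k = i + 1 + 1
      · subst h3
        simp only [a1, a2, a3, b1, b2, b3, map_mul, map_inv]
      rw [artinAut_of_ne ⟨i, hi⟩ ⟨k, hk⟩ h1 h2, artinAut_of_ne ⟨i + 1, hj⟩ ⟨k, hk⟩ h2 h3,
        artinAut_of_ne ⟨i, hi⟩ ⟨k, hk⟩ h1 h2, artinAut_of_ne ⟨i + 1, hj⟩ ⟨k, hk⟩ h2 h3])

theorem artin_σ {n : ℕ} (i : Fin (2 * n - 1)) : artin n (Braid.σ i) = artinAut i :=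
  Braid.lift_σ ..

theorem sheet_artin {n : ℕ} (b : Braid (2 * n)) (g : OrbifoldGroup n) :
    sheet n (artin n b g) = sheet n g := by
  induction b using Braid.induction generalizing g with
  | one => simp
  | gen i =>
    rw [artin_σ]
    suffices h : (sheet n).comp (artinHom i) = sheet n from DFunLike.congr_fun h g
    apply PresentedGroup.ext
    intro k
    change sheet n (artinHom i (x k)) = sheet n (x k)
    rw [artinHom_x]
    unfold artinFun
    split_ifs <;> simp [sheet_x]
  | mul a b ha hb => rw [map_mul, MulAut.mul_apply, ha, hb]
  | inv a ha => rw [← ha (artin n a⁻¹ g), ← MulAut.mul_apply, ← map_mul]; simp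

/-- The Birman–Hilden lift: a braid acts on the fundamental group of the double branched cover by
the restriction of Artin's action. -/
def liftAut {n : ℕ} (b : Braid (2 * n)) : SurfaceGroup n →* SurfaceGroup n :=
  ((artin n b : MulAut (OrbifoldGroup n)).toMonoidHom.comp (SurfaceGroup n).subtype).codRestrict
    (SurfaceGroup n) (fun g => by
      rw [MonoidHom.mem_ker]; exact (sheet_artin b g).trans g.2)

theorem coe_liftAut {n : ℕ} (b : Braid (2 * n)) (g : SurfaceGroup n) :
    (liftAut b g : OrbifoldGroup n) = artin n b g := rfl

/-- The action of `B_{2n}` on the fundamental group of the surface. -/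
def surfaceAut (n : ℕ) : Braid (2 * n) →* MulAut (SurfaceGroup n) where
  toFun b := MonoidHom.toMulEquiv (liftAut b) (liftAut b⁻¹)
    (by
      ext g
      change (artin n b⁻¹ (artin n b g) : OrbifoldGroup n) = g
      rw [← MulAut.mul_apply, ← map_mul]; simp)
    (by
      ext g
      change (artin n b (artin n b⁻¹ g) : OrbifoldGroup n) = g
      rw [← MulAut.mul_apply, ← map_mul]; simp)
  map_one' := by
    ext g
    change (artin n 1 g : OrbifoldGroup n) = g
    simp
  map_mul' a b := by
    ext g
    change (artin n (a * b) g : OrbifoldGroup n) = artin n a (artin n b g)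
    simp

theorem coe_surfaceAut {n : ℕ} (b : Braid (2 * n)) (g : SurfaceGroup n) :
    (surfaceAut n b g : OrbifoldGroup n) = artin n b g := rfl

/-- The loop `x_i x_{i+1}` on the surface: the lift of the arc joining the branch points `i` and
`i + 1`. For `i = 0, …, 2g` these are the curves `γ_0, β_1, γ_1, …, β_g, γ_g` of the standard chain
on `Σ_g`, in which consecutive curves meet once and other pairs are disjoint. -/
def chain {n : ℕ} (i : Fin (2 * n - 1)) : SurfaceGroup n :=
  ⟨x (lo i) * x (hi i), by
    rw [MonoidHom.mem_ker, map_mul, sheet_x, sheet_x]; decide⟩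

/-- `σ_{i+1}` acts on the chain as the Dehn twist about its `i`-th curve does: here and in the next
three facts, a curve crossing the `i`-th one once picks up one copy of it, and all other curves of
the chain are fixed. Hence the lift of `σ_{i+1}` is the Dehn twist about the `i`-th curve. -/
theorem surfaceAut_chain_self {n : ℕ} (i : Fin (2 * n - 1)) :
    surfaceAut n (Braid.σ i) (chain i) = chain i := by
  apply Subtype.ext
  rw [coe_surfaceAut, artin_σ]
  change artinAut i (x (lo i) * x (hi i)) = x (lo i) * x (hi i)
  rw [map_mul, artinAut_of_eq i (lo i) rfl (by omega), artinAut_of_eq_succ i (hi i) rfl (by omega)]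
  simp [lo, hi]

theorem surfaceAut_chain_succ {n : ℕ} (i j : Fin (2 * n - 1)) (h : (j : ℕ) = i + 1) :
    surfaceAut n (Braid.σ i) (chain j) = chain i * chain j := by
  apply Subtype.ext
  rw [coe_surfaceAut, artin_σ]
  change artinAut i (x (lo j) * x (hi j)) = x (lo i) * x (hi i) * (x (lo j) * x (hi j))
  have e : lo j = hi i := Fin.ext h
  rw [map_mul, e, artinAut_of_eq_succ i (hi i) rfl (by omega),
    artinAut_of_ne i (hi j) (by simp [hi]; omega) (by simp [hi]; omega), mul_assoc,
    ← mul_assoc (x (hi i)), x_mul_self, one_mul]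
  rfl

theorem surfaceAut_chain_pred {n : ℕ} (i j : Fin (2 * n - 1)) (h : (j : ℕ) + 1 = i) :
    surfaceAut n (Braid.σ i) (chain j) = chain j * (chain i)⁻¹ := by
  apply Subtype.ext
  rw [coe_surfaceAut, artin_σ]
  change artinAut i (x (lo j) * x (hi j)) = x (lo j) * x (hi j) * (x (lo i) * x (hi i))⁻¹
  have e : hi j = lo i := Fin.ext h
  rw [map_mul, e, artinAut_of_eq i (lo i) rfl (by omega),
    artinAut_of_ne i (lo j) (by simp [lo]; omega) (by simp [lo]; omega), mul_inv_rev, x_inv, x_inv]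
  simp [mul_assoc, hi]

theorem surfaceAut_chain_of_ne {n : ℕ} (i j : Fin (2 * n - 1)) (h : (j : ℕ) ≠ i)
    (h1 : (j : ℕ) ≠ i + 1) (h2 : (j : ℕ) + 1 ≠ i) :
    surfaceAut n (Braid.σ i) (chain j) = chain j := by
  apply Subtype.ext
  rw [coe_surfaceAut, artin_σ]
  change artinAut i (x (lo j) * x (hi j)) = x (lo j) * x (hi j)
  rw [map_mul, artinAut_of_ne i (lo j) (by simp [lo]; omega) (by simp [lo]; omega),
    artinAut_of_ne i (hi j) (by simp [hi]; omega) (by simp [hi]; omega)]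

/-! ### Homology, the intersection bivector and the mapping class group -/

open scoped TensorProduct

/-- `H_1(Σ_g; ℂ)`, as the complexified abelianization of the fundamental group. -/
abbrev H1 (n : ℕ) : Type := ℂ ⊗[ℤ] Additive (Abelianization (SurfaceGroup n))

/-- The homology class of a loop on the surface. -/
noncomputable def cls {n : ℕ} (g : SurfaceGroup n) : H1 n :=
  1 ⊗ₜ[ℤ] Additive.ofMul (Abelianization.of g)

theorem cls_mul {n : ℕ} (g h : SurfaceGroup n) : cls (g * h) = cls g + cls h := by
  simp [cls, TensorProduct.tmul_add]

theorem cls_one {n : ℕ} : cls (1 : SurfaceGroup n) = 0 := by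
  simp [cls]

theorem cls_inv {n : ℕ} (g : SurfaceGroup n) : cls g⁻¹ = -cls g := by
  simp [cls, TensorProduct.tmul_neg]

/-- The linear map `φ_*` induced on homology by an automorphism `φ` of the fundamental group. -/
noncomputable def pushforward {n : ℕ} (φ : MulAut (SurfaceGroup n)) : H1 n →ₗ[ℂ] H1 n :=
  LinearMap.baseChange ℂ
    (MonoidHom.toAdditive (Abelianization.map (φ : SurfaceGroup n →* SurfaceGroup n))).toIntLinearMap

theorem pushforward_cls {n : ℕ} (φ : MulAut (SurfaceGroup n)) (g : SurfaceGroup n) :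
    pushforward φ (cls g) = cls (φ g) := rfl

theorem H1_hom_ext {n : ℕ} {f f' : H1 n →ₗ[ℂ] H1 n} (h : ∀ g, f (cls g) = f' (cls g)) :
    f = f' := by
  refine TensorProduct.AlgebraTensorModule.curry_injective (LinearMap.ext_ring ?_)
  ext a
  obtain ⟨g, hg⟩ := QuotientGroup.mk_surjective a.toMul
  obtain rfl : a = Additive.ofMul (Abelianization.of g) := congrArg Additive.ofMul hg.symm
  exact h g

theorem pushforward_one {n : ℕ} : pushforward (1 : MulAut (SurfaceGroup n)) = LinearMap.id :=
  H1_hom_ext fun g => by rw [pushforward_cls]; rfl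

theorem pushforward_mul {n : ℕ} (φ ψ : MulAut (SurfaceGroup n)) :
    pushforward (φ * ψ) = pushforward φ ∘ₗ pushforward ψ :=
  H1_hom_ext fun g => by
    rw [LinearMap.comp_apply, pushforward_cls, pushforward_cls, pushforward_cls]; rfl

theorem pushforward_conj {n : ℕ} (h : SurfaceGroup n) :
    pushforward (MulAut.conj h) = LinearMap.id :=
  H1_hom_ext fun g => by
    rw [pushforward_cls, MulAut.conj_apply, cls_mul, cls_mul, cls_inv]; simp

/-- The homology class (called `c_{k+1}` below) of the `k`-th curve of the chain (`0` beyond the end of the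
chain). With the orientations chosen, `c_k · c_{k+1} = 1`. -/
noncomputable def chainClass (n k : ℕ) : H1 n :=
  if h : k < 2 * n - 1 then cls (chain ⟨k, h⟩) else 0

/-- The class `a_j = c_1 + c_3 + ⋯ + c_{2j-1}`. -/
noncomputable def aCycle (n j : ℕ) : H1 n := ∑ k ∈ Finset.range j, chainClass n (2 * k)

/-- The class `b_j = c_{2j}` (indexed from `0`). -/
noncomputable def bCycle (n j : ℕ) : H1 n := chainClass n (2 * j + 1)

/-- The intersection pairing `ω`, viewed as a bivector by duality: the sum of `a_j ∧ b_j` over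
`j = 1, …, g`, where `a_1, b_1, …, a_g, b_g` is the symplectic basis of `H_1(Σ_g)` with
`a_j = c_1 + c_3 + ⋯ + c_{2j-1}` and `b_j = c_{2j}`. -/
noncomputable def omega (n : ℕ) : ExteriorAlgebra ℂ (H1 n) :=
  ∑ j ∈ Finset.range (n - 1),
    ExteriorAlgebra.ι ℂ (aCycle n (j + 1)) * ExteriorAlgebra.ι ℂ (bCycle n j)

/-- Automorphisms of the fundamental group of `Σ_g` that preserve the intersection pairing, i.e.
those induced by orientation preserving homeomorphisms. -/
noncomputable def orientedAut (n : ℕ) : Subgroup (MulAut (SurfaceGroup n)) where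
  carrier := {φ | ExteriorAlgebra.map (pushforward φ) (omega n) = omega n}
  one_mem' := by
    change ExteriorAlgebra.map _ _ = _
    rw [pushforward_one, ExteriorAlgebra.map_id]; rfl
  mul_mem' := fun {φ ψ} hφ hψ => by
    change ExteriorAlgebra.map _ _ = _
    change ExteriorAlgebra.map _ _ = _ at hφ hψ
    rw [pushforward_mul, ← ExteriorAlgebra.map_comp_map, AlgHom.comp_apply, hψ, hφ]
  inv_mem' := fun {φ} hφ => by
    change ExteriorAlgebra.map _ _ = _
    change ExteriorAlgebra.map _ _ = _ at hφ
    conv_lhs => rw [← hφ]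
    rw [← AlgHom.comp_apply, ExteriorAlgebra.map_comp_map, ← pushforward_mul, inv_mul_cancel,
      pushforward_one, ExteriorAlgebra.map_id]; rfl

/-- The inner automorphisms, as a subgroup of the orientation preserving ones. -/
noncomputable def innerAut (n : ℕ) : Subgroup (orientedAut n) :=
  (MulAut.conj : SurfaceGroup n →* MulAut (SurfaceGroup n)).range.subgroupOf (orientedAut n)

instance (n : ℕ) : (innerAut n).Normal where
  conj_mem := by
    rintro φ ⟨h, hh⟩ ψ
    refine ⟨(ψ : MulAut (SurfaceGroup n)) h, ?_⟩
    have e : ((ψ * φ * ψ⁻¹ : orientedAut n) : MulAut (SurfaceGroup n)) =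
        ψ.1 * MulAut.conj h * ψ.1⁻¹ := by rw [hh]; rfl
    refine Eq.trans ?_ e.symm
    refine MulEquiv.ext fun g => ?_
    simp only [MulAut.mul_apply, MulAut.conj_apply, map_mul, map_inv, MulAut.apply_inv_self]

/-- The mapping class group `M(g, 0)` of the closed surface `Σ_g`, `g = n - 1`: the group of
orientation preserving outer automorphisms of its fundamental group (Dehn–Nielsen–Baer). -/
abbrev MappingClassGroup (n : ℕ) : Type := orientedAut n ⧸ innerAut n

/-- The subspace `ω ∧ Λ^{l-2} H_1(Σ_g; ℂ)` of `Λ^l H_1(Σ_g; ℂ)`, which is `0` for `l < 2`. -/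
noncomputable def omegaWedge (n l : ℕ) : Submodule ℂ (⋀[ℂ]^l (H1 n)) :=
  if 2 ≤ l then
    (Submodule.map (LinearMap.mulLeft ℂ (omega n)) (⋀[ℂ]^(l - 2) (H1 n))).comap
      (⋀[ℂ]^l (H1 n)).subtype
  else ⊥

theorem coe_exteriorPower_map {n l : ℕ} (f : H1 n →ₗ[ℂ] H1 n) (y : ⋀[ℂ]^l (H1 n)) :
    (exteriorPower.map l f y : ExteriorAlgebra ℂ (H1 n)) =
      ExteriorAlgebra.map f (y : ExteriorAlgebra ℂ (H1 n)) := by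
  have : (⋀[ℂ]^l (H1 n)).subtype ∘ₗ exteriorPower.map l f =
      (ExteriorAlgebra.map f).toLinearMap ∘ₗ (⋀[ℂ]^l (H1 n)).subtype := by
    ext m
    simp [ExteriorAlgebra.map_apply_ιMulti]
  exact LinearMap.congr_fun this y

theorem omegaWedge_le_comap {n : ℕ} (l : ℕ) {φ : MulAut (SurfaceGroup n)} (hφ : φ ∈ orientedAut n) :
    omegaWedge n l ≤ (omegaWedge n l).comap (exteriorPower.map l (pushforward φ)) := by
  unfold omegaWedge
  split_ifs with h
  · rintro y ⟨z, hz, hzy⟩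
    change ExteriorAlgebra.map _ _ = _ at hφ
    refine ⟨exteriorPower.map (l - 2) (pushforward φ) ⟨z, hz⟩, Subtype.property _, ?_⟩
    change omega n * _ = _
    change omega n * z = _ at hzy
    rw [Submodule.subtype_apply] at hzy ⊢
    rw [coe_exteriorPower_map, coe_exteriorPower_map, ← hzy, map_mul, hφ]
  · rintro y rfl
    simp

/-- The space `Λ^l H_1(Σ_g; ℂ) / (ω ∧ Λ^{l-2} H_1(Σ_g; ℂ))`, `g = n - 1`. -/
abbrev HomSpace (n l : ℕ) : Type := (⋀[ℂ]^l (H1 n)) ⧸ omegaWedge n l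

/-- The representation `[v_1 ∧ ⋯ ∧ v_l] ↦ [φ_* v_1 ∧ ⋯ ∧ φ_* v_l]` of the mapping class group. -/
noncomputable def rhoTilde (n l : ℕ) : Representation ℂ (MappingClassGroup n) (HomSpace n l) :=
  QuotientGroup.lift (innerAut n)
    { toFun := fun φ => (omegaWedge n l).mapQ (omegaWedge n l)
        (exteriorPower.map l (pushforward φ.1)) (omegaWedge_le_comap l φ.2)
      map_one' := by
        apply Submodule.linearMap_qext
        refine LinearMap.ext fun y => ?_
        simp [pushforward_one]
      map_mul' := fun φ ψ => by
        apply Submodule.linearMap_qext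
        refine LinearMap.ext fun y => ?_
        simp [pushforward_mul] }
    (by
      rintro φ ⟨h, hh⟩
      rw [MonoidHom.mem_ker]
      apply Submodule.linearMap_qext
      refine LinearMap.ext fun y => ?_
      have : pushforward (φ : MulAut (SurfaceGroup n)) = LinearMap.id := by
        rw [← pushforward_conj h]; exact congrArg _ hh.symm
      change Submodule.Quotient.mk (exteriorPower.map l (pushforward φ.1) y) =
        Submodule.Quotient.mk y
      rw [this, exteriorPower.map_id]; rfl)

/-- The Picard–Lefschetz formula on the chain. -/
theorem pushforward_σ_c {n : ℕ} (i : Fin (2 * n - 1)) (k : ℕ) (hk : k < 2 * n - 1) :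
    pushforward (surfaceAut n (Braid.σ i)) (chainClass n k) =
      chainClass n k + (if k = i + 1 then chainClass n i else 0) - (if k + 1 = i then chainClass n i else 0) := by
  have hi : chainClass n i = cls (chain i) := by simp [chainClass]
  rw [hi, show chainClass n k = cls (chain ⟨k, hk⟩) by simp [chainClass, hk], pushforward_cls]
  by_cases h1 : k = i
  · obtain rfl : (⟨k, hk⟩ : Fin (2 * n - 1)) = i := Fin.ext h1
    rw [surfaceAut_chain_self]; simp
  by_cases h2 : k = i + 1
  · rw [surfaceAut_chain_succ _ _ h2, cls_mul, if_pos h2, if_neg (by omega)]; abel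
  by_cases h3 : k + 1 = i
  · rw [surfaceAut_chain_pred _ _ h3, cls_mul, cls_inv, if_neg h2, if_pos h3]; abel
  rw [surfaceAut_chain_of_ne i ⟨k, hk⟩ h1 h2 h3, if_neg h2, if_neg h3]; simp

theorem prod_pairs {G : Type*} [Group G] (m : ℕ) (f : Fin (2 * m) → G) :
    (List.ofFn f).prod =
      (List.ofFn fun k : Fin m => f ⟨2 * k, by omega⟩ * f ⟨2 * k + 1, by omega⟩).prod := by
  induction m with
  | zero => rfl
  | succ m ih =>
    change (List.ofFn (n := 2 * m + 1 + 1) f).prod = _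
    rw [List.ofFn_succ, List.ofFn_succ, List.ofFn_succ, List.prod_cons, List.prod_cons,
      List.prod_cons, ← mul_assoc]
    congr 1
    exact ih _

/-- `c_1 + c_3 + ⋯ + c_{2g+1} = 0`. -/
theorem aCycle_top (n : ℕ) : aCycle n n = 0 := by
  have h := prod_x n
  rw [prod_pairs] at h
  have h' : (List.ofFn fun k : Fin n => (chain ⟨2 * k, by omega⟩ : SurfaceGroup n)).prod = 1 := by
    apply Subtype.ext
    rw [← Subgroup.subtype_apply, map_list_prod, List.map_ofFn]
    exact h
  let F : SurfaceGroup n →* Multiplicative (H1 n) :=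
    { toFun := fun g => .ofAdd (cls g), map_one' := by rw [cls_one]; rfl,
      map_mul' := fun g h => by rw [cls_mul]; rfl }
  have h2 := congrArg F h'
  rw [map_list_prod, List.map_ofFn, map_one, List.prod_ofFn] at h2
  have h3 : ∑ k : Fin n, cls (chain ⟨2 * k, by omega⟩ : SurfaceGroup n) = 0 := h2
  rw [aCycle, Finset.sum_range, ← h3]
  refine Finset.sum_congr rfl fun k _ => ?_
  simp [chainClass, show 2 * (k : ℕ) < 2 * n - 1 by omega]

theorem pushforward_σ_aCycle {n : ℕ} (i : Fin (2 * n - 1)) (j : ℕ) (hj : j ≤ n) :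
    pushforward (surfaceAut n (Braid.σ i)) (aCycle n j) =
      aCycle n j - (if (i : ℕ) + 1 = 2 * j then chainClass n i else 0) := by
  unfold aCycle
  induction j with
  | zero => simp
  | succ j ih =>
    rw [Finset.sum_range_succ, map_add, ih (by omega), pushforward_σ_c _ _ (by omega)]
    rcases lt_trichotomy ((i : ℕ) + 1) (2 * j) with h | h | h
    · rw [if_neg (by omega), if_neg (by omega), if_neg (by omega), if_neg (by omega)]; simp
    · rw [if_pos h, if_pos h.symm, if_neg (by omega), if_neg (by omega)]; abel
    · rw [if_neg (by omega), if_neg (by omega)]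
      by_cases h' : (i : ℕ) + 1 = 2 * (j + 1)
      · rw [if_pos (by omega), if_pos h']; abel
      · rw [if_neg (by omega), if_neg h']; abel

theorem pushforward_σ_bCycle {n : ℕ} (i : Fin (2 * n - 1)) (j : ℕ) (hj : j < n - 1) :
    pushforward (surfaceAut n (Braid.σ i)) (bCycle n j) =
      bCycle n j + (if (i : ℕ) = 2 * j then chainClass n i else 0) -
        (if (i : ℕ) = 2 * (j + 1) then chainClass n i else 0) := by
  unfold bCycle
  rw [pushforward_σ_c _ _ (by omega)]
  have e1 : (2 * j + 1 = (i : ℕ) + 1) = ((i : ℕ) = 2 * j) := propext (by omega)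
  have e2 : (2 * j + 1 + 1 = (i : ℕ)) = ((i : ℕ) = 2 * (j + 1)) := propext (by omega)
  simp only [e1, e2]

theorem σ_mem_orientedAut {n : ℕ} (i : Fin (2 * n - 1)) :
    surfaceAut n (Braid.σ i) ∈ orientedAut n := by
  change ExteriorAlgebra.map _ _ = _
  unfold omega
  rw [map_sum]
  simp only [map_mul, ExteriorAlgebra.map_apply_ι]
  obtain ⟨p, hp | hp⟩ := Nat.even_or_odd' (i : ℕ)
  · have hpn : p < n := by omega
    have key : ∀ j ∈ Finset.range (n - 1),
        ExteriorAlgebra.ι ℂ (pushforward (surfaceAut n (Braid.σ i)) (aCycle n (j + 1))) *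
          ExteriorAlgebra.ι ℂ (pushforward (surfaceAut n (Braid.σ i)) (bCycle n j)) =
        ExteriorAlgebra.ι ℂ (aCycle n (j + 1)) * ExteriorAlgebra.ι ℂ (bCycle n j) +
          ((if j = p then ExteriorAlgebra.ι ℂ (aCycle n (p + 1)) * ExteriorAlgebra.ι ℂ (chainClass n i)
            else 0) -
          (if j + 1 = p then ExteriorAlgebra.ι ℂ (aCycle n p) * ExteriorAlgebra.ι ℂ (chainClass n i)
            else 0)) := by
      intro j hj
      rw [Finset.mem_range] at hj
      rw [pushforward_σ_aCycle _ _ (by omega), pushforward_σ_bCycle _ _ hj, if_neg (by omega)]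
      by_cases h1 : j = p
      · subst h1
        rw [if_pos hp, if_neg (by omega), if_pos rfl, if_neg (by omega)]
        simp [mul_add]
      by_cases h2 : j + 1 = p
      · subst h2
        rw [if_neg (by omega), if_pos hp, if_neg (by omega), if_pos rfl]
        simp [mul_add, sub_eq_add_neg]
      rw [if_neg (by omega), if_neg (by omega), if_neg h1, if_neg h2]
      simp
    rw [Finset.sum_congr rfl key, Finset.sum_add_distrib, Finset.sum_sub_distrib]
    have e1 : (∑ j ∈ Finset.range (n - 1), if j = p then
        ExteriorAlgebra.ι ℂ (aCycle n (p + 1)) * ExteriorAlgebra.ι ℂ (chainClass n i) else 0) =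
        ExteriorAlgebra.ι ℂ (aCycle n (p + 1)) * ExteriorAlgebra.ι ℂ (chainClass n i) := by
      by_cases h : p < n - 1
      · rw [Finset.sum_ite_eq', if_pos (Finset.mem_range.2 h)]
      · rw [show p + 1 = n by omega, aCycle_top]; simp
    have e2 : (∑ j ∈ Finset.range (n - 1), if j + 1 = p then
        ExteriorAlgebra.ι ℂ (aCycle n p) * ExteriorAlgebra.ι ℂ (chainClass n i) else 0) =
        ExteriorAlgebra.ι ℂ (aCycle n p) * ExteriorAlgebra.ι ℂ (chainClass n i) := by
      cases p with
      | zero => simp [aCycle]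
      | succ p =>
        simp only [add_left_inj]
        rw [Finset.sum_ite_eq', if_pos (Finset.mem_range.2 (by omega))]
    rw [e1, e2, ← sub_mul, ← map_sub, show aCycle n (p + 1) - aCycle n p = chainClass n i by
      rw [aCycle, aCycle, Finset.sum_range_succ, hp]; abel, ExteriorAlgebra.ι_sq_zero, add_zero]
  · refine Finset.sum_congr rfl fun j hj => ?_
    rw [Finset.mem_range] at hj
    rw [pushforward_σ_aCycle _ _ (by omega), pushforward_σ_bCycle _ _ hj]
    by_cases h1 : j = p
    · subst h1
      rw [if_pos (by omega), if_neg (by omega), if_neg (by omega), hp]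
      have : bCycle n j = chainClass n (2 * j + 1) := rfl
      simp [sub_mul, this]
    · rw [if_neg (by omega), if_neg (by omega), if_neg (by omega)]; simp

theorem surfaceAut_mem {n : ℕ} (b : Braid (2 * n)) : surfaceAut n b ∈ orientedAut n := by
  induction b using Braid.induction with
  | one => rw [map_one]; exact one_mem _
  | gen i => exact σ_mem_orientedAut i
  | mul a b ha hb => rw [map_mul]; exact mul_mem ha hb
  | inv a ha => rw [map_inv]; exact inv_mem ha

/-- The homomorphism `Ψ : B_{2n} → M(g, 0)`, `g = n - 1`, of Birman and Hilden, mapping the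
standard generators to the Dehn twists about the curves of the standard chain. -/
noncomputable def Psi (n : ℕ) : Braid (2 * n) →* MappingClassGroup n :=
  (QuotientGroup.mk' (innerAut n)).comp ((surfaceAut n).codRestrict (orientedAut n) surfaceAut_mem)

/-- The representation `ρ_hom^{g,l}` of `B_{2n}`, `g = n - 1`. -/
noncomputable def rhoHom (n l : ℕ) : Representation ℂ (Braid (2 * n)) (HomSpace n l) :=
  (rhoTilde n l).comp (Psi n)

/-! ### Arc diagrams and the extended Jones representation -/

/-- Non-crossing pairings of `m` points on a line: `D x` is the partner of `x`. -/
@[ext]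
structure ArcDiagram (m : ℕ) where
  partner : Fin m → Fin m
  invol : ∀ x, partner (partner x) = x
  ne : ∀ x, partner x ≠ x
  noncrossing : ∀ x y, x < y → y < partner x → ¬ partner x < partner y

/-- Stacking the Temperley–Lieb generator `e_{i+1}` on a diagram: the points `i` and `i + 1` become
connected, and so do their former partners. (If `i` and `i + 1` are connected in `D`, the result is
`D`, and a closed circle has been removed.) -/
def capFun {m : ℕ} (i : Fin (m - 1)) (f : Fin m → Fin m) (k : Fin m) : Fin m :=
  if k = lo i then hi i
  else if k = hi i then lo i
  else if k = f (lo i) then f (hi i)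
  else if k = f (hi i) then f (lo i)
  else f k

theorem lo_ne_hi {m : ℕ} (i : Fin (m - 1)) : lo i ≠ hi i := by
  intro h; have := congrArg Fin.val h; simp [lo, hi] at this

set_option maxHeartbeats 4000000 in
/-- Reconnecting two neighbouring points of a non-crossing pairing and their partners gives a
non-crossing pairing. -/
theorem noncrossing_aux {m : ℕ} (f : Fin m → Fin m) (a b : Fin m) (hab : (a : ℕ) + 1 = b)
    (h1 : ∀ x, f (f x) = x) (h2 : ∀ x, f x ≠ x)
    (h3 : ∀ x y, x < y → y < f x → ¬ f x < f y) (x y g g' : Fin m)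
    (hg : g = if x = a then b else if x = b then a else if x = f a then f b
      else if x = f b then f a else f x)
    (hg' : g' = if y = a then b else if y = b then a else if y = f a then f b
      else if y = f b then f a else f y) :
    x < y → y < g → ¬ g < g' := by
  have jx := h1 x; have jy := h1 y; have ja := h1 a; have jb := h1 b
  have kx := h2 x; have ky := h2 y; have ka := h2 a; have kb := h2 b
  have va : a < b := by simp only [Fin.lt_def]; omega
  have vx : x ≤ a ∨ b ≤ x := by simp only [Fin.le_def]; omega
  have vy : y ≤ a ∨ b ≤ y := by simp only [Fin.le_def]; omega
  have vfx : f x ≤ a ∨ b ≤ f x := by simp only [Fin.le_def]; omega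
  have vfy : f y ≤ a ∨ b ≤ f y := by simp only [Fin.le_def]; omega
  have vfa : f a ≤ a ∨ b ≤ f a := by simp only [Fin.le_def]; omega
  have vfb : f b ≤ a ∨ b ≤ f b := by simp only [Fin.le_def]; omega
  clear hab
  split_ifs at hg hg' <;> subst hg <;> subst hg' <;> grind

/-- The diagram obtained by stacking `e_{i+1}` on `D`, with circles removed. -/
def cap {m : ℕ} (i : Fin (m - 1)) (D : ArcDiagram m) : ArcDiagram m where
  partner := capFun i D.partner
  invol x := by
    have h1 := lo_ne_hi i
    have h2 := D.invol
    have h3 := D.ne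
    unfold capFun
    grind
  ne x := by
    have h1 := lo_ne_hi i
    have h2 := D.invol
    have h3 := D.ne
    unfold capFun
    grind
  noncrossing x y :=
    noncrossing_aux D.partner (lo i) (hi i) rfl D.invol D.ne D.noncrossing x y _ _ rfl rfl

theorem cap_lo {m : ℕ} (i : Fin (m - 1)) (D : ArcDiagram m) : (cap i D).partner (lo i) = hi i := by
  simp [cap, capFun]

/-- Stacking `e_{i+1}` on a diagram that connects `i` and `i + 1` reproduces the diagram. -/
theorem cap_of_joined {m : ℕ} (i : Fin (m - 1)) (D : ArcDiagram m) (h : D.partner (lo i) = hi i) :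
    cap i D = D := by
  ext1
  funext x
  have h1 := D.invol
  have h2 := D.ne
  change capFun i D.partner x = _
  unfold capFun
  grind

theorem cap_cap_of_joined {m : ℕ} (i j : Fin (m - 1)) (hij : hi i = lo j ∨ hi j = lo i)
    (D : ArcDiagram m) (h : D.partner (lo i) = hi i) : cap i (cap j D) = D := by
  ext1
  funext x
  have h1 := D.invol
  have h2 := D.ne
  have h3 := lo_ne_hi i
  have h4 := lo_ne_hi j
  have h5 : lo i ≠ hi j ∨ lo j ≠ hi i := by
    simp only [lo, hi, ne_eq, Fin.mk.injEq]; omega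
  change capFun i (capFun j D.partner) x = D.partner x
  generalize D.partner = f at *
  have h6 : f (hi i) = lo i := by rw [← h, h1]
  rcases hij with e | e
  · have hb : hi i ≠ hi j := by rw [e]; exact h4
    have ha : lo i ≠ lo j := by rw [← e]; exact h3
    have e1 : capFun j f (lo i) = f (hi j) := by unfold capFun; grind
    have e2 : capFun j f (hi i) = hi j := by unfold capFun; grind
    unfold capFun at e1 e2 ⊢
    simp only [e1, e2]
    grind
  · have hb : hi i ≠ hi j := by rw [e]; exact h3.symm
    have ha : lo i ≠ lo j := by rw [← e]; exact h4.symm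
    have e1 : capFun j f (lo i) = lo j := by unfold capFun; grind
    have e2 : capFun j f (hi i) = f (lo j) := by unfold capFun; grind
    unfold capFun at e1 e2 ⊢
    simp only [e1, e2]
    grind

theorem cap_comm {m : ℕ} (i j : Fin (m - 1)) (hij : (i : ℕ) + 2 ≤ j)
    (D : ArcDiagram m) : cap i (cap j D) = cap j (cap i D) := by
  ext1
  funext x
  have h1 := D.invol
  have h2 := D.ne
  have h3 := lo_ne_hi i
  have h4 := lo_ne_hi j
  have h5 : lo i ≠ hi j := by simp only [lo, hi, ne_eq, Fin.mk.injEq]; omega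
  have h6 : lo j ≠ hi i := by simp only [lo, hi, ne_eq, Fin.mk.injEq]; omega
  have h7 : lo j ≠ lo i := by simp only [lo, ne_eq, Fin.mk.injEq]; omega
  have h8 : hi j ≠ hi i := by simp only [hi, ne_eq, Fin.mk.injEq]; omega
  change capFun i (capFun j D.partner) x = capFun j (capFun i D.partner) x
  generalize D.partner = f at *
  have key : ∀ k l, capFun k f (lo l) = if lo l = lo k then hi k else if lo l = hi k then lo k
      else if lo l = f (lo k) then f (hi k) else if lo l = f (hi k) then f (lo k)
      else f (lo l) := fun _ _ => rfl
  have key' : ∀ k l, capFun k f (hi l) = if hi l = lo k then hi k else if hi l = hi k then lo k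
      else if hi l = f (lo k) then f (hi k) else if hi l = f (hi k) then f (lo k)
      else f (hi l) := fun _ _ => rfl
  have a1 := key j i
  have a2 := key' j i
  have a3 := key i j
  have a4 := key' i j
  rw [if_neg h7.symm, if_neg h5] at a1
  rw [if_neg h6.symm, if_neg h8.symm] at a2
  rw [if_neg h7, if_neg h6] at a3
  rw [if_neg h5.symm, if_neg h8] at a4
  clear key key'
  have inj : ∀ p q, f p = f q → p = q := fun p q h => by rw [← h1 p, h, h1]
  have b1 := capFun.eq_1 j f x
  have b2 := capFun.eq_1 i f x
  change (if x = lo i then hi i else if x = hi i then lo i else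
      if x = capFun j f (lo i) then capFun j f (hi i) else
      if x = capFun j f (hi i) then capFun j f (lo i) else capFun j f x) =
    (if x = lo j then hi j else if x = hi j then lo j else
      if x = capFun i f (lo j) then capFun i f (hi j) else
      if x = capFun i f (hi j) then capFun i f (lo j) else capFun i f x)
  generalize capFun j f x = u at *
  generalize capFun i f x = v at *
  generalize capFun j f (lo i) = p1 at *
  generalize capFun j f (hi i) = p2 at *
  generalize capFun i f (lo j) = p3 at *
  generalize capFun i f (hi j) = p4 at *
  generalize lo i = A at *
  generalize hi i = B at *
  generalize lo j = C at *
  generalize hi j = E at *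
  by_cases c1 : f A = B
  · have : f B = A := by rw [← c1, h1]
    grind
  by_cases c2 : f C = E
  · have : f E = C := by rw [← c2, h1]
    grind
  by_cases c3 : f A = C
  · have : f C = A := by rw [← c3, h1]
    by_cases c5 : f B = E
    · have : f E = B := by rw [← c5, h1]
      grind
    · grind
  by_cases c4 : f A = E
  · have : f E = A := by rw [← c4, h1]
    by_cases c5 : f B = C
    · have : f C = B := by rw [← c5, h1]
      grind
    · grind
  by_cases c5 : f B = C
  · have : f C = B := by rw [← c5, h1]
    grind
  by_cases c6 : f B = E
  · have : f E = B := by rw [← c6, h1]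
    grind
  grind

/-- A family of operators satisfying the Temperley–Lieb relations gives a representation
`σ_i ↦ u + v e_i` of the braid group, for suitable scalars. -/
noncomputable def tlRep {m : ℕ} {V : Type*} [AddCommGroup V] [Module ℂ V]
    (e : Fin (m - 1) → Module.End ℂ V) (δ τ u v u' v' : ℂ)
    (hsq : ∀ i, e i * e i = δ • e i)
    (hcomm : ∀ i j : Fin (m - 1), (i : ℕ) + 2 ≤ j → e i * e j = e j * e i)
    (htl : ∀ i j : Fin (m - 1), (i : ℕ) + 1 = j →
      e i * e j * e i = τ • e i ∧ e j * e i * e j = τ • e j)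
    (hu : u * u' = 1) (hv : u * v' + v * u' + v * v' * δ = 0)
    (hbr : u ^ 2 * v + u * v ^ 2 * δ + v ^ 3 * τ = 0) : Representation ℂ (Braid m) V :=
  (Units.coeHom (Module.End ℂ V)).comp <| Braid.lift
    (fun i =>
      { val := u • 1 + v • e i
        inv := u' • 1 + v' • e i
        val_inv := by
          have : (u • 1 + v • e i) * (u' • 1 + v' • e i) =
              (u * u') • 1 + (u * v' + v * u') • e i + (v * v') • (e i * e i) := by
            simp only [add_mul, mul_add, smul_mul_smul_comm, one_mul, mul_one]; module
          rw [this, hsq, hu, add_assoc, show (u * v' + v * u') • e i + (v * v') • δ • e i =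
            (u * v' + v * u' + v * v' * δ) • e i by module, hv]
          simp
        inv_val := by
          have : (u' • 1 + v' • e i) * (u • 1 + v • e i) =
              (u * u') • 1 + (u * v' + v * u') • e i + (v * v') • (e i * e i) := by
            simp only [add_mul, mul_add, smul_mul_smul_comm, one_mul, mul_one]; module
          rw [this, hsq, hu, add_assoc, show (u * v' + v * u') • e i + (v * v') • δ • e i =
            (u * v' + v * u' + v * v' * δ) • e i by module, hv]
          simp })
    (fun i j hij => by
      ext1
      change (u • 1 + v • e i) * (u • 1 + v • e j) = (u • 1 + v • e j) * (u • 1 + v • e i)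
      simp only [add_mul, mul_add, smul_mul_smul_comm, one_mul, mul_one, hcomm i j hij]
      module)
    (fun i j hij => by
      ext1
      change (u • 1 + v • e i) * (u • 1 + v • e j) * (u • 1 + v • e i) =
        (u • 1 + v • e j) * (u • 1 + v • e i) * (u • 1 + v • e j)
      have expand : ∀ a b : Module.End ℂ V,
          (u • 1 + v • a) * (u • 1 + v • b) * (u • 1 + v • a) =
          (u ^ 3) • 1 + (2 * u ^ 2 * v) • a + (u ^ 2 * v) • b + (u * v ^ 2) • (a * a) +
            (u * v ^ 2) • (a * b + b * a) + (v ^ 3) • (a * b * a) := fun a b => by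
        simp only [add_mul, mul_add, smul_mul_smul_comm, one_mul, mul_one]; module
      rw [expand, expand, hsq, hsq, (htl i j hij).1, (htl i j hij).2]
      have key : ∀ a b : Module.End ℂ V, (2 * u ^ 2 * v) • a + (u ^ 2 * v) • b +
          (u * v ^ 2) • δ • a + (v ^ 3) • τ • a = (u ^ 2 * v) • a + (u ^ 2 * v) • b := by
        intro a b
        rw [show (2 * u ^ 2 * v) • a + (u ^ 2 * v) • b + (u * v ^ 2) • δ • a + (v ^ 3) • τ • a =
          (u ^ 2 * v) • a + (u ^ 2 * v) • b + (u ^ 2 * v + u * v ^ 2 * δ + v ^ 3 * τ) • a by module,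
          hbr]
        simp
      have k1 := key (e i) (e j)
      have k2 := key (e j) (e i)
      rw [← sub_eq_zero] at k1 k2 ⊢
      rw [← sub_eq_zero.2 (k1.trans k2.symm)]
      module)

theorem tlRep_σ {m : ℕ} {V : Type*} [AddCommGroup V] [Module ℂ V]
    (e : Fin (m - 1) → Module.End ℂ V) (δ τ u v u' v' : ℂ)
    (hsq : ∀ i, e i * e i = δ • e i)
    (hcomm : ∀ i j : Fin (m - 1), (i : ℕ) + 2 ≤ j → e i * e j = e j * e i)
    (htl : ∀ i j : Fin (m - 1), (i : ℕ) + 1 = j →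
      e i * e j * e i = τ • e i ∧ e j * e i * e j = τ • e j)
    (hu : u * u' = 1) (hv : u * v' + v * u' + v * v' * δ = 0)
    (hbr : u ^ 2 * v + u * v ^ 2 * δ + v ^ 3 * τ = 0) (i : Fin (m - 1)) :
    tlRep e δ τ u v u' v' hsq hcomm htl hu hv hbr (Braid.σ i) = u • 1 + v • e i := by
  unfold tlRep
  rw [MonoidHom.comp_apply, Braid.lift_σ]; rfl

/-- The tensor product of a representation of the braid group with the one-dimensional
representation `σ_i ↦ z`. -/
noncomputable def twist {m : ℕ} {V : Type*} [AddCommGroup V] [Module ℂ V] (z : ℂˣ)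
    (ρ : Representation ℂ (Braid m) V) : Representation ℂ (Braid m) V where
  toFun b := ((Braid.lift (m := m) (fun _ => z) (fun _ _ _ => rfl) (fun _ _ _ => rfl) b : ℂˣ) : ℂ) •
    ρ b
  map_one' := by simp
  map_mul' a b := by
    rw [map_mul, map_mul, Units.val_mul, smul_mul_smul_comm]

theorem twist_σ {m : ℕ} {V : Type*} [AddCommGroup V] [Module ℂ V] (z : ℂˣ)
    (ρ : Representation ℂ (Braid m) V) (i : Fin (m - 1)) :
    twist z ρ (Braid.σ i) = (z : ℂ) • ρ (Braid.σ i) := by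
  change ((Braid.lift (m := m) (fun _ => z) _ _ (Braid.σ i) : ℂˣ) : ℂ) • ρ (Braid.σ i) = _
  rw [Braid.lift_σ]

/-- The value `-A² - A⁻²` of a closed circle. -/
noncomputable def loopValue (A : ℂˣ) : ℂ := -(A : ℂ) ^ 2 - ((A⁻¹ : ℂˣ) : ℂ) ^ 2

open Classical in
/-- The action of `e_{i+1}` on the span of the arc diagrams: stack, and replace a closed circle by
the factor `-A² - A⁻²`. -/
noncomputable def diagramE {m : ℕ} (A : ℂˣ) (i : Fin (m - 1)) :
    Module.End ℂ (ArcDiagram m →₀ ℂ) :=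
  Finsupp.linearCombination ℂ fun D =>
    Finsupp.single (cap i D) (if D.partner (lo i) = hi i then loopValue A else 1)

open Classical in
theorem diagramE_single {m : ℕ} (A : ℂˣ) (i : Fin (m - 1)) (D : ArcDiagram m) (z : ℂ) :
    diagramE A i (Finsupp.single D z) =
      Finsupp.single (cap i D) (z * if D.partner (lo i) = hi i then loopValue A else 1) := by
  simp [diagramE]

theorem diagramE_sq {m : ℕ} (A : ℂˣ) (i : Fin (m - 1)) :
    (diagramE A i * diagramE A i : Module.End ℂ (ArcDiagram m →₀ ℂ)) =
      loopValue A • diagramE A i := by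
  refine Finsupp.lhom_ext fun D z => ?_
  rw [Module.End.mul_apply, LinearMap.smul_apply, diagramE_single, diagramE_single,
    cap_of_joined i _ (cap_lo i D), if_pos (cap_lo i D), Finsupp.smul_single, smul_eq_mul]
  congr 1; ring

theorem diagramE_comm {m : ℕ} (A : ℂˣ) (i j : Fin (m - 1)) (hij : (i : ℕ) + 2 ≤ j) :
    (diagramE A i * diagramE A j : Module.End ℂ (ArcDiagram m →₀ ℂ)) =
      diagramE A j * diagramE A i := by
  refine Finsupp.lhom_ext fun D z => ?_
  rw [Module.End.mul_apply, Module.End.mul_apply]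
  simp only [diagramE_single]
  rw [cap_comm i j hij]
  congr 1
  have g1 : (cap j D).partner (lo i) = capFun j D.partner (lo i) := rfl
  have g2 : (cap i D).partner (lo j) = capFun i D.partner (lo j) := rfl
  have h1 := D.invol
  have h5 : lo i ≠ hi j := by simp only [lo, hi, ne_eq, Fin.mk.injEq]; omega
  have h6 : lo j ≠ hi i := by simp only [lo, hi, ne_eq, Fin.mk.injEq]; omega
  have h7 : lo i ≠ lo j := by simp only [lo, ne_eq, Fin.mk.injEq]; omega
  have h8 : hi j ≠ hi i := by simp only [hi, ne_eq, Fin.mk.injEq]; omega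
  by_cases c1 : D.partner (lo i) = hi i
  · have d1 : D.partner (hi i) = lo i := by rw [← c1, h1]
    have : (cap j D).partner (lo i) = hi i := by
      rw [g1]; unfold capFun; grind
    rw [cap_of_joined i D c1, if_pos c1, if_pos this]; ring
  by_cases c2 : D.partner (lo j) = hi j
  · have d1 : D.partner (hi j) = lo j := by rw [← c2, h1]
    have : (cap i D).partner (lo j) = hi j := by
      rw [g2]; unfold capFun; grind
    rw [cap_of_joined j D c2, if_pos c2, if_pos this]; ring
  have : (cap j D).partner (lo i) = hi i ↔ (cap i D).partner (lo j) = hi j := by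
    rw [g1, g2, capFun, capFun, if_neg h7, if_neg h5, if_neg h7.symm, if_neg h6]
    grind
  simp only [if_neg c1, if_neg c2, this]

theorem diagramE_tl {m : ℕ} (A : ℂˣ) (i j : Fin (m - 1)) (hij : hi i = lo j ∨ hi j = lo i) :
    (diagramE A i * diagramE A j * diagramE A i : Module.End ℂ (ArcDiagram m →₀ ℂ)) =
      (1 : ℂ) • diagramE A i := by
  refine Finsupp.lhom_ext fun D z => ?_
  rw [Module.End.mul_apply, Module.End.mul_apply, one_smul]
  simp only [diagramE_single]
  rw [cap_cap_of_joined i j hij _ (cap_lo i D)]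
  congr 1
  have h0 := lo_ne_hi i
  have h0' := lo_ne_hi j
  have h1 := (cap i D).invol
  have h2 := cap_lo i D
  have h3 : hi i ≠ hi j ∧ lo i ≠ lo j := by
    have : (i : ℕ) ≠ j := by
      rintro h
      obtain rfl := Fin.ext h
      grind
    simp only [lo, hi, ne_eq, Fin.mk.injEq]; omega
  have h5 : lo i ≠ hi j ∨ lo j ≠ hi i := by
    simp only [lo, hi, ne_eq, Fin.mk.injEq]; omega
  have hj : (cap i D).partner (lo j) ≠ hi j := by grind
  have hi' : (cap j (cap i D)).partner (lo i) ≠ hi i := by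
    change capFun j (cap i D).partner (lo i) ≠ hi i
    have h6 := (cap i D).ne
    unfold capFun
    grind
  rw [if_neg hj, if_neg hi']; ring

/-- The representation `η_A^{m,0}` of `B_m` on the space `V^{m,0}` spanned by non-crossing
pairings of `m` points: stack the braid on the diagram and resolve its crossings by the Kauffman
bracket, `σ_i ↦ A + A⁻¹ e_i`. -/
noncomputable def eta (m : ℕ) (A : ℂˣ) : Representation ℂ (Braid m) (ArcDiagram m →₀ ℂ) :=
  tlRep (diagramE A) (loopValue A) 1 A (A⁻¹ : ℂˣ) (A⁻¹ : ℂˣ) A (diagramE_sq A) (diagramE_comm A)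
    (fun i j hij => ⟨diagramE_tl A i j (Or.inl (Fin.ext hij)),
      diagramE_tl A j i (Or.inr (Fin.ext hij))⟩)
    (by simp)
    (by have := A.ne_zero; simp only [loopValue, Units.val_inv_eq_inv_val]; field_simp; ring)
    (by have := A.ne_zero; simp only [loopValue, Units.val_inv_eq_inv_val]; field_simp; ring)

/-- The extension of the Jones representation `π_q^{m,0}`, `q = A⁴`, to all non-zero values of
`q`: the representation `σ_i ↦ A⁻¹ η_A(σ_i)`. -/
noncomputable def jonesExt (m : ℕ) (A : ℂˣ) : Representation ℂ (Braid m) (ArcDiagram m →₀ ℂ) :=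
  twist A⁻¹ (eta m A)

/-! ### The Jones representations attached to two-row Young diagrams -/

/-- The number of entries smaller than `k` in the given row (`false`: first row, `true`: second
row), for a filling of a two-row diagram that puts the entry `j` into the row `w j`. -/
def cnt {n : ℕ} (w : Fin n → Bool) (r : Bool) (k : ℕ) : ℕ :=
  (Finset.univ.filter fun j : Fin n => (j : ℕ) < k ∧ w j = r).card

/-- Putting the entries `0, …, n - 1` successively at the end of the row `w j` gives a standard
tableau (at each stage the second row is at most as long as the first one) of shape
`(λ_1 ≥ λ_1 - d)`. -/
def IsStandard {n : ℕ} (d : ℕ) (w : Fin n → Bool) : Prop :=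
  (∀ k ≤ n, cnt w true k ≤ cnt w false k) ∧ cnt w false n = cnt w true n + d

/-- Standard Young tableaux of shape `(λ_1 ≥ λ_1 - d)` with `n` boxes; `j` lies in the row
`t.1 j`. -/
abbrev Tableau (n d : ℕ) : Type := {w : Fin n → Bool // IsStandard d w}

/-- The content, column minus row, of the box containing `j`. -/
def content {n : ℕ} (w : Fin n → Bool) (j : Fin n) : ℤ :=
  (cnt w (w j) j : ℤ) - if w j then 1 else 0

/-- The axial distance `c(i) - c(i+1) - r(i) + r(i+1)` between two consecutive entries. -/
def axial {n : ℕ} (w : Fin n → Bool) (i : Fin (n - 1)) : ℤ := content w (lo i) - content w (hi i)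

/-- Exchange the entries `i` and `i + 1`. -/
def swapWord {n : ℕ} (i : Fin (n - 1)) (w : Fin n → Bool) : Fin n → Bool :=
  w ∘ Equiv.swap (lo i) (hi i)

/-- `a_d(q) = (1 - q^{d+1}) / ((1 + q) (1 - q^d))`. -/
noncomputable def aCoeff (q : ℂ) (d : ℤ) : ℂ := (1 - q ^ (d + 1)) / ((1 + q) * (1 - q ^ d))

open Classical in
/-- The basis vector of a standard tableau; by convention it is `0` for other fillings. -/
noncomputable def tableauVec (n d : ℕ) (w : Fin n → Bool) : Tableau n d →₀ ℂ :=
  if h : IsStandard d w then Finsupp.single ⟨w, h⟩ 1 else 0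

/-- Young's orthogonal form: `e_i v_t = a_d v_t + (a_d a_{-d})^{1/2} v_{s_i t}`, where `d` is the
axial distance from `i` to `i + 1` in `t`. -/
noncomputable def wenzlE (n d : ℕ) (q : ℂ) (i : Fin (n - 1)) : Module.End ℂ (Tableau n d →₀ ℂ) :=
  Finsupp.linearCombination ℂ fun t =>
    aCoeff q (axial t.1 i) • tableauVec n d t.1 +
      (aCoeff q (axial t.1 i) * aCoeff q (-axial t.1 i)) ^ (1 / 2 : ℂ) •
        tableauVec n d (swapWord i t.1)

/-- `q` is a non-zero complex number that is not an `l`-th root of unity for any `2 ≤ l ≤ n`. -/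
def BraidRegular (n : ℕ) (q : ℂ) : Prop := q ≠ 0 ∧ ∀ l, 2 ≤ l → l ≤ n → q ^ l ≠ 1

section Combinatorics

variable {n : ℕ}

theorem cnt_succ (w : Fin n → Bool) (r : Bool) (k : Fin n) :
    cnt w r (k + 1) = cnt w r k + if w k = r then 1 else 0 := by
  unfold cnt
  have : (Finset.univ.filter fun j : Fin n => (j : ℕ) < k + 1 ∧ w j = r) =
      (Finset.univ.filter fun j : Fin n => (j : ℕ) < k ∧ w j = r) ∪
        (if w k = r then {k} else ∅) := by
    ext j
    split_ifs with h
    · simp only [Finset.mem_filter, Finset.mem_union, Finset.mem_singleton, Finset.mem_univ,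
        true_and]
      constructor
      · rintro ⟨h1, h2⟩
        rcases Nat.lt_succ_iff_lt_or_eq.1 h1 with h3 | h3
        · exact Or.inl ⟨h3, h2⟩
        · exact Or.inr (Fin.ext h3)
      · rintro (⟨h1, h2⟩ | rfl)
        · exact ⟨by omega, h2⟩
        · exact ⟨by omega, h⟩
    · simp only [Finset.mem_filter, Finset.mem_univ, true_and, Finset.union_empty]
      constructor
      · rintro ⟨h1, h2⟩
        rcases Nat.lt_succ_iff_lt_or_eq.1 h1 with h3 | h3
        · exact ⟨h3, h2⟩
        · exact absurd (by rw [← h2, Fin.ext h3]) h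
      · rintro ⟨h1, h2⟩
        exact ⟨by omega, h2⟩
  rw [this, Finset.card_union_of_disjoint]
  · split_ifs <;> simp
  · split_ifs <;> simp

theorem swapWord_lo (i : Fin (n - 1)) (w : Fin n → Bool) : swapWord i w (lo i) = w (hi i) := by
  simp [swapWord]

theorem swapWord_hi (i : Fin (n - 1)) (w : Fin n → Bool) : swapWord i w (hi i) = w (lo i) := by
  simp [swapWord]

theorem swapWord_of_ne (i : Fin (n - 1)) (w : Fin n → Bool) (k : Fin n) (h : (k : ℕ) ≠ i)
    (h' : (k : ℕ) ≠ i + 1) : swapWord i w k = w k := by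
  have h1 : k ≠ lo i := fun e => h (congrArg Fin.val e)
  have h2 : k ≠ hi i := fun e => h' (congrArg Fin.val e)
  simp [swapWord, Equiv.swap_apply_of_ne_of_ne h1 h2]

theorem swapWord_swapWord (i : Fin (n - 1)) (w : Fin n → Bool) : swapWord i (swapWord i w) = w := by
  funext k; simp [swapWord]

theorem swapWord_comm (i j : Fin (n - 1)) (h : (i : ℕ) + 2 ≤ j) (w : Fin n → Bool) :
    swapWord i (swapWord j w) = swapWord j (swapWord i w) := by
  have e : ∀ {k : Fin n} {l : Fin n}, (k : ℕ) = l → k = l := fun h => Fin.ext h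
  funext k
  by_cases h1 : (k : ℕ) = i
  · obtain rfl : k = lo i := Fin.ext h1
    rw [swapWord_lo, swapWord_of_ne j _ (hi i) (by simp [hi]; omega) (by simp [hi]; omega),
      swapWord_of_ne j _ (lo i) (by simp [lo]; omega) (by simp [lo]; omega), swapWord_lo]
  by_cases h2 : (k : ℕ) = i + 1
  · obtain rfl : k = hi i := Fin.ext h2
    rw [swapWord_hi, swapWord_of_ne j _ (hi i) (by simp [hi]; omega) (by simp [hi]; omega),
      swapWord_of_ne j _ (lo i) (by simp [lo]; omega) (by simp [lo]; omega), swapWord_hi]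
  rw [swapWord_of_ne i _ k h1 h2]
  by_cases h3 : (k : ℕ) = j
  · obtain rfl : k = lo j := Fin.ext h3
    rw [swapWord_lo, swapWord_lo,
      swapWord_of_ne i _ (hi j) (by simp [hi]; omega) (by simp [hi]; omega)]
  by_cases h4 : (k : ℕ) = j + 1
  · obtain rfl : k = hi j := Fin.ext h4
    rw [swapWord_hi, swapWord_hi,
      swapWord_of_ne i _ (lo j) (by simp [lo]; omega) (by simp [lo]; omega)]
  rw [swapWord_of_ne j _ k h3 h4, swapWord_of_ne j _ k h3 h4, swapWord_of_ne i _ k h1 h2]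

theorem cnt_lo_succ (w : Fin n → Bool) (r : Bool) (i : Fin (n - 1)) :
    cnt w r (i + 1) = cnt w r i + if w (lo i) = r then 1 else 0 := cnt_succ w r (lo i)

theorem cnt_hi_succ (w : Fin n → Bool) (r : Bool) (i : Fin (n - 1)) :
    cnt w r (i + 2) = cnt w r (i + 1) + if w (hi i) = r then 1 else 0 := cnt_succ w r (hi i)

theorem cnt_swapWord (i : Fin (n - 1)) (w : Fin n → Bool) (r : Bool) (k : ℕ) (hk : k ≠ i + 1)
    (hkn : k ≤ n) : cnt (swapWord i w) r k = cnt w r k := by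
  have low : ∀ k ≤ (i : ℕ), cnt (swapWord i w) r k = cnt w r k := by
    intro k hk
    unfold cnt
    congr 1
    ext j
    simp only [Finset.mem_filter, Finset.mem_univ, true_and]
    refine and_congr_right fun hj => ?_
    rw [swapWord_of_ne i w j (by omega) (by omega)]
  rcases lt_or_ge k (i + 1) with h | h
  · exact low k (by omega)
  · obtain ⟨m, rfl⟩ : ∃ m, k = i + 2 + m := ⟨k - (i + 2), by omega⟩
    clear h hk
    induction m with
    | zero =>
      rw [add_zero, cnt_hi_succ, cnt_lo_succ, cnt_hi_succ, cnt_lo_succ, swapWord_lo, swapWord_hi,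
        low i le_rfl]
      ring
    | succ m ih =>
      have e1 := cnt_succ (swapWord i w) r ⟨i + 2 + m, by omega⟩
      have e2 := cnt_succ w r ⟨i + 2 + m, by omega⟩
      rw [swapWord_of_ne i w _ (by simp; omega) (by simp; omega)] at e1
      have := ih (by omega)
      simp only at e1 e2
      rw [← add_assoc, e1, e2, this]

/-- The difference of the row lengths of the boxes with entries `< k`. -/
def height (w : Fin n → Bool) (k : ℕ) : ℤ := (cnt w false k : ℤ) - cnt w true k

theorem height_succ (w : Fin n → Bool) (k : Fin n) :
    height w (k + 1) = height w k + if w k then -1 else 1 := by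
  unfold height
  rw [cnt_succ, cnt_succ]
  cases w k <;> simp <;> ring

theorem height_le (w : Fin n → Bool) (k : ℕ) (hk : k ≤ n) : height w k ≤ k := by
  induction k with
  | zero => simp [height, cnt]
  | succ k ih =>
    have := height_succ w ⟨k, hk⟩
    simp only at this
    have := ih (by omega)
    split_ifs at * <;> push_cast <;> omega

theorem height_swapWord (i : Fin (n - 1)) (w : Fin n → Bool) (k : ℕ) (hk : k ≠ i + 1)
    (hkn : k ≤ n) : height (swapWord i w) k = height w k := by
  unfold height
  rw [cnt_swapWord i w _ k hk hkn, cnt_swapWord i w _ k hk hkn]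

theorem isStandard_iff {d : ℕ} (w : Fin n → Bool) :
    IsStandard d w ↔ (∀ k ≤ n, 0 ≤ height w k) ∧ height w n = d := by
  unfold IsStandard height
  refine and_congr (forall_congr' fun k => imp_congr_right fun _ => ?_) ?_ <;> omega

/-- Exchanging two entries in different rows yields a standard tableau as soon as the column
condition holds at the one place where it can fail. -/
theorem isStandard_swapWord {d : ℕ} (i : Fin (n - 1)) {w : Fin n → Bool} (hw : IsStandard d w)
    (h : 0 ≤ height w i + if w (hi i) then -1 else 1) : IsStandard d (swapWord i w) := by
  rw [isStandard_iff] at hw ⊢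
  refine ⟨fun k hk => ?_, ?_⟩
  · by_cases e : k = i + 1
    · subst e
      have := height_succ (swapWord i w) (lo i)
      rw [swapWord_lo] at this
      change height (swapWord i w) (i + 1) = height (swapWord i w) i + _ at this
      rw [this, height_swapWord i w i (by omega) (by omega)]
      exact h
    · rw [height_swapWord i w k e hk]; exact hw.1 k hk
  · rw [height_swapWord i w n (by omega) le_rfl]; exact hw.2

theorem axial_eq (w : Fin n → Bool) (i : Fin (n - 1)) :
    axial w i = if w (lo i) = w (hi i) then -1 else
      if w (hi i) then height w i + 1 else -(height w i + 1) := by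
  have h : cnt w (w (hi i)) (hi i) = cnt w (w (hi i)) i + if w (lo i) = w (hi i) then 1 else 0 :=
    cnt_lo_succ w _ i
  unfold axial content
  rw [h]
  change ((cnt w (w (lo i)) i : ℕ) : ℤ) - _ - _ = _
  unfold height
  cases w (lo i) <;> cases w (hi i) <;> simp <;> ring

theorem axial_swapWord (w : Fin n → Bool) (i : Fin (n - 1)) (h : w (lo i) ≠ w (hi i)) :
    axial (swapWord i w) i = -axial w i := by
  rw [axial_eq, axial_eq, swapWord_lo, swapWord_hi, if_neg h, if_neg h.symm,
    height_swapWord i w i (by omega) (by omega)]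
  revert h
  cases w (lo i) <;> cases w (hi i) <;> simp

theorem axial_swapWord_of_far (w : Fin n → Bool) (i j : Fin (n - 1))
    (h : (i : ℕ) + 2 ≤ j ∨ (j : ℕ) + 2 ≤ i) : axial (swapWord j w) i = axial w i := by
  rw [axial_eq, axial_eq, swapWord_of_ne j w (lo i) (by simp [lo]; omega) (by simp [lo]; omega),
    swapWord_of_ne j w (hi i) (by simp [hi]; omega) (by simp [hi]; omega),
    height_swapWord j w i (by omega) (by omega)]

end Combinatorics

section Coefficients

variable {q : ℂ}

theorem aCoeff_neg_one : aCoeff q (-1) = 0 := by simp [aCoeff]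

theorem BraidRegular.zpow_ne_one {n : ℕ} (hq : BraidRegular n q) (d : ℤ) (h1 : 1 ≤ d) (h2 : d ≤ n)
    (hn : 2 ≤ n) : q ^ d ≠ 1 := by
  lift d to ℕ using by omega
  rw [zpow_natCast]
  intro h
  by_cases hd : d = 1
  · subst hd
    exact hq.2 2 le_rfl hn (by rw [pow_one] at h; rw [h]; norm_num)
  · exact hq.2 d (by omega) (by omega) h

theorem BraidRegular.one_add_ne_zero {n : ℕ} (hq : BraidRegular n q) (hn : 2 ≤ n) : 1 + q ≠ 0 := by
  intro h
  exact hq.2 2 le_rfl hn (by rw [eq_neg_of_add_eq_zero_right h]; norm_num)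

theorem aCoeff_add_neg (hq : q ≠ 0) (h1 : 1 + q ≠ 0) (d : ℤ) (hd : q ^ d ≠ 1) :
    aCoeff q d + aCoeff q (-d) = 1 := by
  unfold aCoeff
  have h0 : q ^ d ≠ 0 := zpow_ne_zero d hq
  rw [zpow_add₀ hq, zpow_add₀ hq, zpow_neg, zpow_one]
  generalize q ^ d = z at *
  have h2 : 1 - z ≠ 0 := sub_ne_zero.2 hd.symm
  have h3 : z - 1 ≠ 0 := sub_ne_zero.2 hd
  have h4 : 1 - z⁻¹ ≠ 0 := by
    rw [sub_ne_zero]; intro h; exact hd (by rw [eq_comm, inv_eq_one] at h; exact h)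
  have e : (1 - z⁻¹ * q) / ((1 + q) * (1 - z⁻¹)) = (q - z) / ((1 + q) * (1 - z)) := by
    rw [div_eq_div_iff (mul_ne_zero h1 h4) (mul_ne_zero h1 h2)]
    field_simp
    ring
  rw [e]
  field_simp
  ring

theorem aCoeff_mul (hq : q ≠ 0) (h1 : 1 + q ≠ 0) (d : ℤ) (hd : q ^ d ≠ 1)
    (hd' : q ^ (d + 1) ≠ 1) : aCoeff q d * aCoeff q (-(d + 1)) = q / (1 + q) ^ 2 := by
  unfold aCoeff
  have h0 : q ^ d ≠ 0 := zpow_ne_zero d hq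
  rw [show -(d + 1) + 1 = -d by ring, zpow_neg, zpow_neg]
  rw [zpow_add₀ hq, zpow_one] at *
  generalize q ^ d = z at *
  have h2 : 1 - z ≠ 0 := sub_ne_zero.2 hd.symm
  have h3 : 1 - z * q ≠ 0 := sub_ne_zero.2 hd'.symm
  have e : (1 - z⁻¹) / ((1 + q) * (1 - (z * q)⁻¹)) = q * (1 - z) / ((1 + q) * (1 - z * q)) := by
    have h4 : 1 - (z * q)⁻¹ ≠ 0 := by
      rw [sub_ne_zero]; intro h; exact hd' (by rw [eq_comm, inv_eq_one] at h; exact h)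
    rw [div_eq_div_iff (mul_ne_zero h1 h4) (mul_ne_zero h1 h3)]
    field_simp
    ring
  rw [e]
  field_simp

theorem sqrt_sq (z : ℂ) : z ^ (1 / 2 : ℂ) * z ^ (1 / 2 : ℂ) = z := by
  rw [← sq, one_div]
  exact Complex.cpow_nat_inv_pow z two_ne_zero

end Coefficients

section Relations

variable {n d : ℕ} {q : ℂ}

/-- The off-diagonal coefficient `(a_d a_{-d})^{1/2}`. -/
noncomputable def bCoeff (q : ℂ) (w : Fin n → Bool) (i : Fin (n - 1)) : ℂ :=
  (aCoeff q (axial w i) * aCoeff q (-axial w i)) ^ (1 / 2 : ℂ)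

theorem wenzlE_tableauVec (i : Fin (n - 1)) {w : Fin n → Bool} (hw : IsStandard d w) :
    wenzlE n d q i (tableauVec n d w) = aCoeff q (axial w i) • tableauVec n d w +
      bCoeff q w i • tableauVec n d (swapWord i w) := by
  conv_lhs => rw [tableauVec, dif_pos hw]
  unfold wenzlE
  rw [Finsupp.linearCombination_single, one_smul]
  rfl

theorem wenzlE_eq_zero (i : Fin (n - 1)) {w : Fin n → Bool} (hw : IsStandard d w)
    (h : w (lo i) = w (hi i)) : wenzlE n d q i (tableauVec n d w) = 0 := by
  rw [wenzlE_tableauVec i hw, bCoeff, axial_eq, if_pos h, aCoeff_neg_one]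
  simp

theorem end_ext {f g : Module.End ℂ (Tableau n d →₀ ℂ)}
    (h : ∀ w, IsStandard d w → f (tableauVec n d w) = g (tableauVec n d w)) : f = g := by
  refine Finsupp.lhom_ext' fun t => LinearMap.ext_ring ?_
  have := h t.1 t.2
  rw [tableauVec, dif_pos t.2] at this
  exact this

theorem bCoeff_sq (hq : BraidRegular n q) (w : Fin n → Bool) (i : Fin (n - 1))
    (hw : IsStandard d w) (h : w (lo i) ≠ w (hi i)) :
    aCoeff q (axial (swapWord i w) i) = 1 - aCoeff q (axial w i) ∧
    bCoeff q (swapWord i w) i = bCoeff q w i ∧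
    bCoeff q w i * bCoeff q w i = aCoeff q (axial w i) * (1 - aCoeff q (axial w i)) := by
  have hn : 2 ≤ n := by have := i.2; omega
  have h0 := ((isStandard_iff w).1 hw).1 i (by omega)
  have h1 := height_le w i (by omega)
  have key : aCoeff q (axial w i) + aCoeff q (-axial w i) = 1 := by
    have e := aCoeff_add_neg hq.1 (hq.one_add_ne_zero hn) (height w i + 1)
      (hq.zpow_ne_one _ (by omega) (by omega) hn)
    rw [axial_eq, if_neg h]
    split_ifs
    · exact e
    · rw [neg_neg, add_comm]; exact e
  have key' : aCoeff q (-axial w i) = 1 - aCoeff q (axial w i) := by rw [← key]; ring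
  refine ⟨?_, ?_, ?_⟩
  · rw [axial_swapWord w i h, key']
  · rw [bCoeff, bCoeff, axial_swapWord w i h, neg_neg, mul_comm]
  · rw [bCoeff, sqrt_sq, key']

theorem bCoeff_eq_zero_or (w : Fin n → Bool) (i : Fin (n - 1)) (hw : IsStandard d w) :
    bCoeff q w i = 0 ∨ (w (lo i) ≠ w (hi i) ∧ IsStandard d (swapWord i w)) := by
  by_cases h : w (lo i) = w (hi i)
  · left
    rw [bCoeff, axial_eq, if_pos h, aCoeff_neg_one]; simp
  have h0 := ((isStandard_iff w).1 hw).1 i (by omega)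
  by_cases h2 : 0 ≤ height w i + if w (hi i) then -1 else 1
  · exact Or.inr ⟨h, isStandard_swapWord i hw h2⟩
  · left
    split_ifs at h2 with h3
    · have h4 : height w i = 0 := by omega
      rw [bCoeff, axial_eq, if_neg h, if_pos h3, h4, zero_add, aCoeff_neg_one]; simp
    · omega

theorem wenzlE_sq (hq : BraidRegular n q) (i : Fin (n - 1)) :
    wenzlE n d q i * wenzlE n d q i = (1 : ℂ) • wenzlE n d q i := by
  refine end_ext fun w hw => ?_
  rw [Module.End.mul_apply, one_smul]
  by_cases h : w (lo i) = w (hi i)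
  · rw [wenzlE_eq_zero i hw h, map_zero]
  obtain ⟨e1, e2, e3⟩ := bCoeff_sq hq w i hw h
  rw [wenzlE_tableauVec i hw, map_add, map_smul, map_smul, wenzlE_tableauVec i hw]
  generalize aCoeff q (axial w i) = a at *
  rcases bCoeff_eq_zero_or (q := q) w i hw with h0 | ⟨-, h0⟩
  · rw [h0] at e3 ⊢
    have : a * a = a := by linear_combination e3
    simp [smul_smul, this]
  · rw [wenzlE_tableauVec i h0, e1, e2, swapWord_swapWord]
    generalize bCoeff q w i = b at *
    have : a * a + b * b = a := by linear_combination e3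
    calc _ = (a * a + b * b) • tableauVec n d w + b • tableauVec n d (swapWord i w) := by module
      _ = _ := by rw [this]

theorem wenzlE_comm (i j : Fin (n - 1)) (hij : (i : ℕ) + 2 ≤ j) :
    wenzlE n d q i * wenzlE n d q j = wenzlE n d q j * wenzlE n d q i := by
  refine end_ext fun w hw => ?_
  have key : ∀ k l : Fin (n - 1), ((k : ℕ) + 2 ≤ l ∨ (l : ℕ) + 2 ≤ k) →
      bCoeff q w l • wenzlE n d q k (tableauVec n d (swapWord l w)) =
      bCoeff q w l • (aCoeff q (axial w k) • tableauVec n d (swapWord l w) +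
        bCoeff q w k • tableauVec n d (swapWord k (swapWord l w))) := by
    intro k l h
    rcases bCoeff_eq_zero_or (q := q) w l hw with h0 | ⟨-, h0⟩
    · simp [h0]
    · rw [wenzlE_tableauVec k h0, bCoeff, bCoeff, bCoeff, axial_swapWord_of_far w k l h]
  rw [Module.End.mul_apply, Module.End.mul_apply, wenzlE_tableauVec i hw, wenzlE_tableauVec j hw,
    map_add, map_add, map_smul, map_smul, map_smul, map_smul, key i j (Or.inl hij),
    key j i (Or.inr hij), wenzlE_tableauVec i hw, wenzlE_tableauVec j hw, swapWord_comm i j hij]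
  module

/-- The Temperley–Lieb relation in a block spanned by three vectors. -/
theorem tl_block {V : Type*} [AddCommGroup V] [Module ℂ V] (P Q : Module.End ℂ V) (m l r : V)
    (α β γ δ τ : ℂ) (hP : P m = α • m + β • l) (hQ : Q m = γ • m + δ • r) (hτ : α * γ = τ)
    (hβ : β * β = α * (1 - α)) (hδ : δ * δ = γ * (1 - γ))
    (hl : β = 0 ∨ P l = (1 - α) • l + β • m ∧ Q l = 0)
    (hr : δ = 0 ∨ Q r = (1 - γ) • r + δ • m ∧ P r = 0) :
    (P (Q (P m)) = τ • P m ∧ Q (P (Q m)) = τ • Q m) ∧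
    (P l = (1 - α) • l + β • m ∧ Q l = 0 →
      P (Q (P l)) = τ • P l ∧ Q (P (Q l)) = τ • Q l) ∧
    (Q r = (1 - γ) • r + δ • m ∧ P r = 0 →
      P (Q (P r)) = τ • P r ∧ Q (P (Q r)) = τ • Q r) := by
  have hl' : β • Q l = 0 := by rcases hl with h | h <;> simp [h]
  have hr' : δ • P r = 0 := by rcases hr with h | h <;> simp [h]
  have h1 : P (Q (P m)) = τ • P m := by
    rw [hP, map_add, map_smul, map_smul, hl', hQ, add_zero, map_smul, map_add, map_smul, map_smul,
      hr', add_zero, hP, smul_smul, hτ]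
  have h2 : Q (P (Q m)) = τ • Q m := by
    rw [hQ, map_add, map_smul, map_smul, hr', hP, add_zero, map_smul, map_add, map_smul, map_smul,
      hl', add_zero, hQ, smul_smul, mul_comm γ α, hτ]
  refine ⟨⟨h1, h2⟩, ?_, ?_⟩
  · rintro ⟨e1, e2⟩
    have h3 : P (Q m) = γ • P m := by rw [hQ, map_add, map_smul, map_smul, hr', add_zero]
    refine ⟨?_, by rw [e2]; simp⟩
    rw [e1, map_add, map_smul, map_smul, e2, smul_zero, zero_add, map_smul, h3, hP, ← hτ]
    calc _ = (α * γ * β) • m + (γ * (β * β)) • l := by module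
      _ = _ := by rw [hβ]; module
  · rintro ⟨e1, e2⟩
    have h3 : Q (P m) = α • Q m := by rw [hP, map_add, map_smul, map_smul, hl', add_zero]
    refine ⟨by rw [e2]; simp, ?_⟩
    rw [e1, map_add, map_smul, map_smul, e2, smul_zero, zero_add, map_smul, h3, hQ, ← hτ]
    calc _ = (α * γ * δ) • m + (α * (δ * δ)) • r := by module
      _ = _ := by rw [hδ]; module

/-- The relation on the block of a tableau whose entries `i, i + 2` lie in the same row and `i + 1`
in the other one. -/
theorem wenzlE_block (hq : BraidRegular n q) (i j : Fin (n - 1)) (hij : (i : ℕ) + 1 = j)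
    (m : Fin n → Bool) (hm : IsStandard d m) (h1 : m (lo i) ≠ m (hi i)) (h2 : m (lo j) ≠ m (hi j)) :
    ∀ w, IsStandard d w → (w = m ∨ w = swapWord i m ∨ w = swapWord j m) →
      wenzlE n d q i (wenzlE n d q j (wenzlE n d q i (tableauVec n d w))) =
        (q / (1 + q) ^ 2) • wenzlE n d q i (tableauVec n d w) ∧
      wenzlE n d q j (wenzlE n d q i (wenzlE n d q j (tableauVec n d w))) =
        (q / (1 + q) ^ 2) • wenzlE n d q j (tableauVec n d w) := by
  have hh : hi i = lo j := Fin.ext hij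
  have hn : 2 ≤ n := by have := i.2; omega
  have h3 : m (lo i) = m (hi j) := by
    rw [hh] at h1
    revert h1 h2
    cases m (lo i) <;> cases m (lo j) <;> cases m (hi j) <;> simp
  obtain ⟨a1, a2, a3⟩ := bCoeff_sq hq m i hm h1
  obtain ⟨b1, b2, b3⟩ := bCoeff_sq hq m j hm h2
  have hL : IsStandard d (swapWord i m) →
      wenzlE n d q i (tableauVec n d (swapWord i m)) =
        (1 - aCoeff q (axial m i)) • tableauVec n d (swapWord i m) +
          bCoeff q m i • tableauVec n d m ∧
      wenzlE n d q j (tableauVec n d (swapWord i m)) = 0 := by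
    intro h
    refine ⟨by rw [wenzlE_tableauVec i h, a1, a2, swapWord_swapWord], wenzlE_eq_zero j h ?_⟩
    rw [← hh, swapWord_hi, h3, swapWord_of_ne i m (hi j) (by simp [hi]; omega) (by simp [hi]; omega)]
  have hR : IsStandard d (swapWord j m) →
      wenzlE n d q j (tableauVec n d (swapWord j m)) =
        (1 - aCoeff q (axial m j)) • tableauVec n d (swapWord j m) +
          bCoeff q m j • tableauVec n d m ∧
      wenzlE n d q i (tableauVec n d (swapWord j m)) = 0 := by
    intro h
    refine ⟨by rw [wenzlE_tableauVec j h, b1, b2, swapWord_swapWord], wenzlE_eq_zero i h ?_⟩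
    rw [hh, swapWord_lo, ← h3, swapWord_of_ne j m (lo i) (by simp [lo]; omega) (by simp [lo]; omega)]
  have hτ : aCoeff q (axial m i) * aCoeff q (axial m j) = q / (1 + q) ^ 2 := by
    have s0 := (isStandard_iff m).1 hm
    have s1 := s0.1 i (by omega)
    have s2 := s0.1 (i + 1) (by omega)
    have s3 := s0.1 (i + 1 + 1) (by omega)
    have s4 := height_le m i (by omega)
    have t1 : height m (i + 1) = _ := height_succ m (lo i)
    have t2 : height m (i + 1 + 1) = _ := height_succ m (hi i)
    change _ = height m i + _ at t1
    change _ = height m (i + 1) + _ at t2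
    rw [axial_eq m i, axial_eq m j, if_neg h1, if_neg h2, ← hij, ← h3]
    rw [hh] at h1 t2 ⊢
    cases e1 : m (lo i)
    · have e2 : m (lo j) = true := by revert h1; rw [e1]; cases m (lo j) <;> simp
      rw [e1] at t1
      rw [e2]
      simp only [if_true, Bool.false_eq_true, if_false] at t1 ⊢
      rw [t1]
      exact aCoeff_mul hq.1 (hq.one_add_ne_zero hn) _
        (hq.zpow_ne_one _ (by omega) (by omega) hn) (hq.zpow_ne_one _ (by omega) (by omega) hn)
    · have e2 : m (lo j) = false := by revert h1; rw [e1]; cases m (lo j) <;> simp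
      rw [e1] at t1
      rw [e2]
      simp only [if_true, Bool.false_eq_true, if_false] at t1 ⊢
      rw [t1, mul_comm, show height m i + -1 + 1 = height m i by ring]
      exact aCoeff_mul hq.1 (hq.one_add_ne_zero hn) _
        (hq.zpow_ne_one _ (by omega) (by omega) hn) (hq.zpow_ne_one _ (by omega) (by omega) hn)
  obtain ⟨c1, c2, c3⟩ := tl_block (wenzlE n d q i) (wenzlE n d q j) (tableauVec n d m)
    (tableauVec n d (swapWord i m)) (tableauVec n d (swapWord j m)) _ _ _ _ _
    (wenzlE_tableauVec i hm) (wenzlE_tableauVec j hm) hτ a3 b3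
    ((bCoeff_eq_zero_or m i hm).imp_right fun h => hL h.2)
    ((bCoeff_eq_zero_or m j hm).imp_right fun h => hR h.2)
  rintro w hw (rfl | rfl | rfl)
  exacts [c1, c2 (hL hw), c3 (hR hw)]

theorem wenzlE_tl (hq : BraidRegular n q) (i j : Fin (n - 1)) (hij : (i : ℕ) + 1 = j) :
    wenzlE n d q i * wenzlE n d q j * wenzlE n d q i = (q / (1 + q) ^ 2) • wenzlE n d q i ∧
    wenzlE n d q j * wenzlE n d q i * wenzlE n d q j = (q / (1 + q) ^ 2) • wenzlE n d q j := by
  have hh : hi i = lo j := Fin.ext hij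
  have li : ∀ w : Fin n → Bool, swapWord j w (lo i) = w (lo i) := fun w =>
    swapWord_of_ne j w (lo i) (by simp [lo]; omega) (by simp [lo]; omega)
  have hj : ∀ w : Fin n → Bool, swapWord i w (hi j) = w (hi j) := fun w =>
    swapWord_of_ne i w (hi j) (by simp [hi]; omega) (by simp [hi]; omega)
  suffices H : ∀ w, IsStandard d w →
      wenzlE n d q i (wenzlE n d q j (wenzlE n d q i (tableauVec n d w))) =
        (q / (1 + q) ^ 2) • wenzlE n d q i (tableauVec n d w) ∧
      wenzlE n d q j (wenzlE n d q i (wenzlE n d q j (tableauVec n d w))) =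
        (q / (1 + q) ^ 2) • wenzlE n d q j (tableauVec n d w) from
    ⟨end_ext fun w hw => (H w hw).1, end_ext fun w hw => (H w hw).2⟩
  intro w hw
  have s0 := (isStandard_iff w).1 hw
  have s1 := s0.1 i (by omega)
  have s2 := s0.1 (i + 1) (by omega)
  have s3 := s0.1 (i + 1 + 1) (by omega)
  have s4 := s0.1 (i + 1 + 1 + 1) (by omega)
  have t1 : height w (i + 1) = height w i + _ := height_succ w (lo i)
  have t2 : height w (i + 1 + 1) = height w (i + 1) + _ := height_succ w (hi i)
  have t3 : height w (j + 1 + 1) = height w (j + 1) + _ := height_succ w (hi j)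
  rw [← hij] at t3
  by_cases h1 : w (lo i) = w (hi i)
  · by_cases h2 : w (lo j) = w (hi j)
    · rw [wenzlE_eq_zero i hw h1, wenzlE_eq_zero j hw h2]; simp
    · have hm : IsStandard d (swapWord j w) := by
        refine isStandard_swapWord j hw ?_
        rw [← hij]
        split_ifs at * <;> simp_all
      refine wenzlE_block hq i j hij (swapWord j w) hm ?_ ?_ w hw
        (Or.inr (Or.inr (swapWord_swapWord j w).symm))
      · rw [li, hh, swapWord_lo, h1, hh]; exact h2
      · rw [swapWord_lo, swapWord_hi]; exact fun h => h2 h.symm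
  · by_cases h2 : w (lo j) = w (hi j)
    · have hm : IsStandard d (swapWord i w) := by
        refine isStandard_swapWord i hw ?_
        split_ifs at * <;> simp_all
      refine wenzlE_block hq i j hij (swapWord i w) hm ?_ ?_ w hw
        (Or.inr (Or.inl (swapWord_swapWord i w).symm))
      · rw [swapWord_lo, swapWord_hi]; exact fun h => h1 h.symm
      · rw [hj, ← hh, swapWord_hi, ← h2, ← hh]; exact h1
    · exact wenzlE_block hq i j hij w hw h1 h2 w hw (Or.inl rfl)

end Relations

/-- The representation of `B_n` through the Hecke algebra in Young's orthogonal form,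
`σ_i ↦ g_i = q - (1 + q) e_i`, on the span of the standard tableaux of shape
`(λ_1 ≥ λ_1 - d)`; the eigenvalues of `g_i` are `q` and `-1`. -/
noncomputable def heckeRep (n d : ℕ) (q : ℂ) (hq : BraidRegular n q) :
    Representation ℂ (Braid n) (Tableau n d →₀ ℂ) :=
  tlRep (wenzlE n d q) 1 (q / (1 + q) ^ 2) q (-(1 + q)) q⁻¹ (-(1 + q⁻¹))
    (wenzlE_sq hq) wenzlE_comm (wenzlE_tl hq) (mul_inv_cancel₀ hq.1)
    (by have := hq.1; field_simp; ring)
    (by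
      by_cases h : 1 + q = 0
      · simp [h]
      · have := hq.1; field_simp; ring)

/-- The Jones representation `π_q^{n,d}` of `B_n` attached to the Young diagram
`(λ_1 ≥ λ_1 - d)` with `n` boxes, normalised so that `σ_i` acts as
`q⁻¹ g_i = 1 - (1 + q⁻¹) e_i`, with eigenvalues `1` and `-q⁻¹`. -/
noncomputable def jonesRep (n d : ℕ) (q : ℂ) (hq : BraidRegular n q) :
    Representation ℂ (Braid n) (Tableau n d →₀ ℂ) :=
  twist (Units.mk0 q hq.1)⁻¹ (heckeRep n d q hq)

/-! ### The intertwiner -/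

/-- The starting (left) points of the arcs of the diagram obtained from `D` by removing the last
point and connecting its partner to `∞`, in increasing order. -/
def arcs {n : ℕ} (D : ArcDiagram (2 * n)) : List (Fin (2 * n)) :=
  (List.finRange (2 * n)).filter fun k => k < D.partner k ∧ (D.partner k : ℕ) + 1 ≠ 2 * n

/-- The class `X_e = c_{e_0} + ⋯ + c_{e_1 - 1}` of the loop covering the arc `e` from `k = e_0` to
its partner `e_1`. -/
noncomputable def arcClass {n : ℕ} (D : ArcDiagram (2 * n)) (k : Fin (2 * n)) : H1 n :=
  ∑ j ∈ Finset.Ico (k : ℕ) (D.partner k), chainClass n j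

/-- `w(e)`: the number of arcs between the end points of the arc `e` starting at `k`. -/
def arcW {n : ℕ} (D : ArcDiagram (2 * n)) (k : Fin (2 * n)) : ℕ :=
  (Finset.univ.filter fun l => k < l ∧ l < D.partner l ∧ D.partner l < D.partner k).card

/-- `v(e)`: the number of points to the right of the arc `e` starting at `k` that are connected to
`∞`, i.e. to the last point in `D`. -/
def arcV {n : ℕ} (D : ArcDiagram (2 * n)) (k : Fin (2 * n)) : ℕ :=
  (Finset.univ.filter fun l => D.partner k < l ∧ (D.partner l : ℕ) + 1 = 2 * n).card

/-- The scaled wedge `(-i)^{∑ (w(e) + v(e))} ⋀ X_e` of the classes of the lifted arcs. -/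
noncomputable def scaledWedge {n : ℕ} (D : ArcDiagram (2 * n)) : ExteriorAlgebra ℂ (H1 n) :=
  (-Complex.I) ^ ((arcs D).map fun k => arcW D k + arcV D k).sum •
    ((arcs D).map fun k => ExteriorAlgebra.ι ℂ (arcClass D k)).prod

end JonesHomology

open JonesHomology

/-!
The extension is the Temperley–Lieb representation: `jonesExt` sends `σ_i` to `1 + A⁻² E_i` and
its inverse to `1 + A² E_i`, where `E_i` is the stacking operator. The entries of `E_i` are `0`,
`1` and the value `δ = -A² - A⁻²` of a circle, so the entries for an arbitrary braid are Laurent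
polynomials (`jonesExt_mem_laurentFun`).

*Regular values.* A standard tableau is a lattice path that returns to the height `0`. The map
`pathMap` sends an arc diagram `D` to the vector whose coefficient at a path is `0` unless the
path takes opposite steps at the two end points of each arc, and otherwise is the product over the
left end points of weights that depend only on the height and the direction of the step. The
weights `cupWeight`, together with dual weights `capWeight`, factor the operators `δ e_i` of
Young's orthogonal representation through a cap and a cup, and they straighten zigzags; therefore
`pathMap` intertwines `E_i` with `δ e_i` (`pathMap_diagramE`). It is injective, because `D` is
determined by the path `D.word` going up at the left end points, and all the other paths
compatible with `D` have a larger sum of positions of the up steps (`pathMap_injective`). It is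
surjective, because its image is invariant, contains the lowest path, and every other path is
reached by raising a valley to a peak (`tableauVec_mem_range`).

*The value `A⁴ = -1`.* Here `δ = 0`. Let `κ = A⁻²`, so `κ² = -1`, and consider a vector space with
vectors `θ_x` indexed by the points. The wedge of the vectors `κ^x (θ_x - θ_y)` over all arcs from
`x` to `y` of a diagram transforms under the transvection lifting a Dehn twist in the same way as
the diagram transforms under `1 + κ E_i` (`map_fullWedge`). The alternating sum `r = ∑ (-1)^x θ_x`
is invariant, and its product with the wedge over all arcs but the one ending in the last point is
the full wedge (`ι_altSum_mul_openWedge`). Since `θ_x - θ_y ↦ c_x + ⋯ + c_{y-1}` extends to a map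
that sends `r` to `0`, the wedges of the arc classes in the exterior power of the homology
transform as the diagrams do (`map_pushforward_openWedge`).

These wedges are linearly independent even modulo `ω ∧ Λ^{g-2}`. In the exterior power itself this
is a triangularity statement in the starting points of the arcs (`linearIndependent_arcElement`).
As the arcs of a diagram do not cross, their classes are pairwise orthogonal, so the contraction
with the symplectic form annihilates the wedges (`contraction_openWedge`); on the other hand, by
the commutation relation between the contraction and the multiplication by `ω`, it is injective on
`ω ∧ Λ^{g-2}` (`SymplecticData.eq_zero_of_bivector_mul`). The dimension of the quotient is at most
`C(2g, g) - C(2g, g-2)`, a Catalan number, and this is at most the number of diagrams, so that the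
classes of the wedges form a basis.

For `κ = i`, the sum of `w(e) + v(e)` and of the starting points over the arcs is `(n - 1)²` for
every diagram (`sum_exponent`). Hence the normalisation `(-i)^{∑ (w(e) + v(e))}` differs from
`∏ κ^x` only by a constant factor.

The homology of the surface is computed from the orbifold group: its actions on `ℂ` by
translations and point reflections yield enough functionals (`exists_functional`), and the curves
of the chain generate the surface group (`mem_chainSubgroup`), so that the first `2g` curves are a
basis. -/

namespace JonesHomology

open JonesHomology.OrbifoldGroup (x)
open scoped TensorProduct

/-! ### Generators and Laurent polynomial entries -/

/-- A linear map that intertwines the actions of the generators intertwines the actions of all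
braids. -/
theorem equiv_of_gen {m : ℕ} {V W : Type*} [AddCommGroup V] [Module ℂ V] [AddCommGroup W]
    [Module ℂ W] {ρ : Representation ℂ (Braid m) V} {ρ' : Representation ℂ (Braid m) W}
    (f : V →ₗ[ℂ] W) (h : ∀ i, f ∘ₗ ρ (Braid.σ i) = ρ' (Braid.σ i) ∘ₗ f) (b : Braid m) :
    f ∘ₗ ρ b = ρ' b ∘ₗ f := by
  induction b using Braid.induction with
  | one => ext v; simp
  | gen i => exact h i
  | mul a b ha hb =>
    rw [map_mul, map_mul, Module.End.mul_eq_comp, Module.End.mul_eq_comp, ← LinearMap.comp_assoc,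
      ha, LinearMap.comp_assoc, hb, LinearMap.comp_assoc]
  | inv a ha =>
    have h1 : ρ a ∘ₗ ρ a⁻¹ = LinearMap.id := by
      rw [← Module.End.mul_eq_comp, ← map_mul, mul_inv_cancel, map_one]; rfl
    have h2 : ρ' a⁻¹ ∘ₗ ρ' a = LinearMap.id := by
      rw [← Module.End.mul_eq_comp, ← map_mul, inv_mul_cancel, map_one]; rfl
    calc f ∘ₗ ρ a⁻¹ = (ρ' a⁻¹ ∘ₗ ρ' a) ∘ₗ f ∘ₗ ρ a⁻¹ := by rw [h2, LinearMap.id_comp]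
      _ = ρ' a⁻¹ ∘ₗ (f ∘ₗ ρ a) ∘ₗ ρ a⁻¹ := by rw [ha]; rfl
      _ = ρ' a⁻¹ ∘ₗ f := by rw [LinearMap.comp_assoc, h1, LinearMap.comp_id]

theorem jonesExt_σ {m : ℕ} (A : ℂˣ) (i : Fin (m - 1)) :
    jonesExt m A (Braid.σ i) = 1 + ((A : ℂ)⁻¹ ^ 2) • diagramE A i := by
  rw [jonesExt, twist_σ, eta, tlRep_σ, smul_add, smul_smul, smul_smul]
  simp [sq]

theorem jonesRep_σ {n d : ℕ} {q : ℂ} (hq : BraidRegular n q) (i : Fin (n - 1)) :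
    jonesRep n d q hq (Braid.σ i) = 1 - (1 + q⁻¹) • wenzlE n d q i := by
  have := hq.1
  rw [jonesRep, twist_σ, heckeRep, tlRep_σ, smul_add, smul_smul, smul_smul]
  simp only [Units.val_inv_eq_inv_val, Units.val_mk0]
  rw [inv_mul_cancel₀ this, one_smul, show q⁻¹ * -(1 + q) = -(1 + q⁻¹) by field_simp; ring]
  module

theorem rhoHom_σ_mkQ {n l : ℕ} (b : Braid (2 * n)) (y : ⋀[ℂ]^l (H1 n)) :
    rhoHom n l b ((omegaWedge n l).mkQ y) =
      (omegaWedge n l).mkQ (exteriorPower.map l (pushforward (surfaceAut n b)) y) := rfl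

instance (m : ℕ) : Finite (ArcDiagram m) :=
  Finite.of_injective ArcDiagram.partner fun _ _ h => ArcDiagram.ext h

/-- The ring of functions `A ↦ p(A)` on `ℂˣ` given by Laurent polynomials `p` with integer
coefficients. -/
noncomputable def laurentFun : Subring (ℂˣ → ℂ) :=
  (RingHom.pi fun A : ℂˣ => LaurentPolynomial.eval₂ (Int.castRingHom ℂ) A).range

theorem exists_of_mem_laurentFun {f : ℂˣ → ℂ} (hf : f ∈ laurentFun) :
    ∃ p : ℤ →₀ ℤ, ∀ A : ℂˣ, f A = p.sum fun k z => (z : ℂ) * ((A ^ k : ℂˣ) : ℂ) := by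
  obtain ⟨p, rfl⟩ := hf
  refine ⟨p.coeff, fun A => ?_⟩
  change LaurentPolynomial.eval₂ (Int.castRingHom ℂ) A p = _
  induction p using LaurentPolynomial.induction_on' with
  | add p q hp hq =>
    rw [map_add, hp, hq, AddMonoidAlgebra.coeff_add, Finsupp.sum_add_index'] <;> simp [add_mul]
  | C_mul_T k z =>
    rw [LaurentPolynomial.eval₂_C_mul_T, ← LaurentPolynomial.single_eq_C_mul_T,
      AddMonoidAlgebra.coeff_single, Finsupp.sum_single_index] <;> simp

theorem zpow_mem_laurentFun (k : ℤ) : (fun A : ℂˣ => ((A ^ k : ℂˣ) : ℂ)) ∈ laurentFun :=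
  ⟨LaurentPolynomial.T k, by ext A; simp⟩

theorem loopValue_mem_laurentFun : loopValue ∈ laurentFun := by
  have := sub_mem (neg_mem (zpow_mem_laurentFun 2)) (zpow_mem_laurentFun (-2))
  convert this using 1
  ext A
  simp [loopValue]

/-- The matrix entries of the operators `e_i` on arc diagrams are Laurent polynomials. -/
theorem diagramE_mem_laurentFun {m : ℕ} (i : Fin (m - 1)) (D D' : ArcDiagram m) :
    (fun A => diagramE A i (Finsupp.single D 1) D') ∈ laurentFun := by
  classical
  simp only [diagramE_single, one_mul, Finsupp.single_apply]
  split_ifs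
  exacts [loopValue_mem_laurentFun, one_mem _, zero_mem _]

theorem jonesExt_inv_σ {m : ℕ} (A : ℂˣ) (i : Fin (m - 1)) :
    jonesExt m A (Braid.σ i)⁻¹ = 1 + ((A : ℂ) ^ 2) • diagramE A i := by
  have h : jonesExt m A (Braid.σ i) * (1 + ((A : ℂ) ^ 2) • diagramE A i) = 1 := by
    have hA := A.ne_zero
    rw [jonesExt_σ]
    have : (1 + ((A : ℂ)⁻¹ ^ 2) • diagramE A i) * (1 + ((A : ℂ) ^ 2) • diagramE A i) =
        1 + ((A : ℂ) ^ 2 + (A : ℂ)⁻¹ ^ 2) • diagramE A i +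
          ((A : ℂ)⁻¹ ^ 2 * (A : ℂ) ^ 2) • (diagramE A i * diagramE A i) := by
      simp only [add_mul, mul_add, one_mul, mul_one, smul_mul_smul_comm]; module
    rw [this, diagramE_sq, ← mul_pow, inv_mul_cancel₀ hA, loopValue]
    simp only [Units.val_inv_eq_inv_val]
    module
  calc _ = jonesExt m A (Braid.σ i)⁻¹ *
        (jonesExt m A (Braid.σ i) * (1 + ((A : ℂ) ^ 2) • diagramE A i)) := by rw [h, mul_one]
    _ = _ := by rw [← mul_assoc, ← map_mul, inv_mul_cancel, map_one, one_mul]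

theorem one_add_smul_mem_laurentFun {m : ℕ} (k : ℤ) (i : Fin (m - 1)) (D D' : ArcDiagram m) :
    (fun A : ℂˣ => ((1 + ((A ^ k : ℂˣ) : ℂ) • diagramE A i : Module.End ℂ (ArcDiagram m →₀ ℂ))
      (Finsupp.single D 1)) D') ∈ laurentFun := by
  classical
  refine add_mem (?_ : (fun _ : ℂˣ => (Finsupp.single D (1 : ℂ)) D') ∈ _)
    (mul_mem (zpow_mem_laurentFun k) (diagramE_mem_laurentFun i D D'))
  simp only [Finsupp.single_apply]
  split_ifs
  exacts [one_mem _, zero_mem _]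

/-- The matrix entries of a braid and of its inverse are Laurent polynomials. Both are needed,
since the induction on braids has a step for inverses. -/
theorem jonesExt_mem_laurentFun {m : ℕ} (b : Braid m) :
    (∀ D D' : ArcDiagram m,
      (fun A => jonesExt m A b (Finsupp.single D 1) D') ∈ laurentFun) ∧
    ∀ D D' : ArcDiagram m,
      (fun A => jonesExt m A b⁻¹ (Finsupp.single D 1) D') ∈ laurentFun := by
  classical
  have hmul : ∀ a b : Braid m,
      (∀ D D' : ArcDiagram m, (fun A => jonesExt m A a (Finsupp.single D 1) D') ∈ laurentFun) →
      (∀ D D' : ArcDiagram m, (fun A => jonesExt m A b (Finsupp.single D 1) D') ∈ laurentFun) →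
      ∀ D D' : ArcDiagram m,
        (fun A => jonesExt m A (a * b) (Finsupp.single D 1) D') ∈ laurentFun := by
    intro a b ha hb D D'
    have := Fintype.ofFinite (ArcDiagram m)
    have key : (fun A => jonesExt m A (a * b) (Finsupp.single D 1) D') =
        ∑ D'' : ArcDiagram m, (fun A => jonesExt m A b (Finsupp.single D 1) D'') *
          fun A => jonesExt m A a (Finsupp.single D'' 1) D' := by
      ext A
      rw [map_mul, Module.End.mul_apply]
      conv_lhs => rw [← Finsupp.univ_sum_single (jonesExt m A b (Finsupp.single D 1))]
      rw [map_sum, Finsupp.finsetSum_apply, Finset.sum_apply]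
      refine Finset.sum_congr rfl fun D'' _ => ?_
      rw [← mul_one (jonesExt m A b (Finsupp.single D 1) D''), ← smul_eq_mul, ← Finsupp.smul_single,
        map_smul]
      simp
    rw [key]
    exact sum_mem fun D'' _ => mul_mem (hb _ _) (ha _ _)
  induction b using Braid.induction with
  | one =>
    have h : ∀ D D' : ArcDiagram m,
        (fun A => jonesExt m A 1 (Finsupp.single D 1) D') ∈ laurentFun := by
      intro D D'
      simp only [map_one, Module.End.one_apply, Finsupp.single_apply]
      split_ifs
      exacts [one_mem _, zero_mem _]
    exact ⟨h, by simpa using h⟩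
  | gen i =>
    refine ⟨fun D D' => ?_, fun D D' => ?_⟩
    · simpa only [jonesExt_σ, zpow_neg, Units.val_inv_eq_inv_val, zpow_ofNat,
        Units.val_pow_eq_pow_val, inv_pow] using one_add_smul_mem_laurentFun (-2) i D D'
    · simpa only [jonesExt_inv_σ, zpow_ofNat, Units.val_pow_eq_pow_val] using
        one_add_smul_mem_laurentFun 2 i D D'
  | mul a b ha hb =>
    refine ⟨hmul a b ha.1 hb.1, ?_⟩
    rw [mul_inv_rev]
    exact hmul _ _ hb.2 ha.2
  | inv a ha => exact ⟨ha.2, by rw [inv_inv]; exact ha.1⟩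

/-- A family of vectors is linearly independent if it is triangular with respect to a family of
functionals and a grading of the index set. -/
theorem linearIndependent_of_triangular {ι V : Type*} [AddCommGroup V] [Module ℂ V]
    (v : ι → V) (l : ι → V →ₗ[ℂ] ℂ) (ρ : ι → ℕ) (h1 : ∀ a, l a (v a) ≠ 0)
    (h2 : ∀ a b, l a (v b) ≠ 0 → a = b ∨ ρ b < ρ a) : LinearIndependent ℂ v := by
  classical
  rw [linearIndependent_iff']
  intro s c hc
  by_contra hne
  push Not at hne
  obtain ⟨a, ha, hmin⟩ := Finset.exists_min_image (s.filter fun a => c a ≠ 0) ρ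
    (by obtain ⟨a, ha, hca⟩ := hne; exact ⟨a, Finset.mem_filter.2 ⟨ha, hca⟩⟩)
  rw [Finset.mem_filter] at ha
  have := congrArg (l a) hc
  rw [map_sum, map_zero, Finset.sum_eq_single a] at this
  · rw [map_smul, smul_eq_mul] at this
    exact (mul_ne_zero ha.2 (h1 a)) this
  · intro b hb hba
    by_cases hcb : c b = 0
    · simp [hcb]
    · have := hmin b (Finset.mem_filter.2 ⟨hb, hcb⟩)
      rcases eq_or_ne (l a (v b)) 0 with h0 | h0
      · rw [map_smul, h0, smul_zero]
      · rcases h2 a b h0 with h | h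
        · exact absurd h.symm hba
        · omega
  · exact fun h => absurd ha.1 h

/-! ### Combinatorics of arc diagrams -/

section ArcCombinatorics

variable {m : ℕ}

/-- A sum over a set of points stable under `D` can be taken arc by arc. -/
theorem sum_eq_sum_arcs {M : Type*} [AddCommMonoid M] (D : ArcDiagram m) (p : Fin m → Prop)
    [DecidablePred p] (hp : ∀ x, p x → p (D.partner x)) (F : Fin m → M) :
    ∑ x with p x, F x = ∑ x with p x ∧ x < D.partner x, (F x + F (D.partner x)) := by
  classical
  rw [Finset.sum_add_distrib, ← Finset.sum_filter_add_sum_filter_not _ (fun x => x < D.partner x),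
    Finset.filter_filter]
  congr 1
  refine Finset.sum_bij' (fun x _ => D.partner x) (fun x _ => D.partner x) ?_ ?_ ?_ ?_ ?_
  · intro x hx
    simp only [Finset.mem_filter, Finset.mem_univ, true_and, not_lt] at hx ⊢
    rw [D.invol]
    exact ⟨hp x hx.1, lt_of_le_of_ne hx.2 (D.ne x)⟩
  · intro x hx
    simp only [Finset.mem_filter, Finset.mem_univ, true_and, not_lt] at hx ⊢
    rw [D.invol]
    exact ⟨hp x hx.1, hx.2.le⟩
  all_goals simp [D.invol]

/-- The interval `[a, b)` of points is a union of arcs of `D`. -/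
def ArcDiagram.Closed (D : ArcDiagram m) (a b : ℕ) : Prop :=
  ∀ x : Fin m, a ≤ x ∧ (x : ℕ) < b → a ≤ D.partner x ∧ (D.partner x : ℕ) < b

theorem ArcDiagram.closed_univ (D : ArcDiagram m) : D.Closed 0 m :=
  fun x _ => ⟨Nat.zero_le _, (D.partner x).2⟩

theorem ArcDiagram.closed_arc (D : ArcDiagram m) {x y : Fin m} (h : D.partner x = y) (hx : x < y) :
    D.Closed (x + 1) y := by
  subst h
  rintro z ⟨h1, h2⟩
  have a1 : x < z := by rw [Fin.lt_def]; omega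
  have a2 : z < D.partner x := by rw [Fin.lt_def]; omega
  have h3 := D.noncrossing x z a1 a2
  have h4 : ¬ D.partner z < x := fun h => by
    have := D.noncrossing (D.partner z) x h (by rw [D.invol]; exact a1)
    rw [D.invol] at this
    exact this a2
  have h5 : D.partner z ≠ x := fun h => by rw [← h, D.invol] at a2; exact lt_irrefl _ a2
  have h6 : D.partner z ≠ D.partner x := fun h => by
    have := congrArg D.partner h
    rw [D.invol, D.invol] at this
    exact a1.ne' this
  rw [ne_eq, Fin.ext_iff] at h5 h6
  rw [Fin.lt_def] at h3 h4
  omega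

theorem card_Ico_fin (a b : ℕ) (hb : b ≤ m) :
    (Finset.univ.filter fun x : Fin m => a ≤ x ∧ (x : ℕ) < b).card = b - a := by
  have : (Finset.univ.filter fun x : Fin m => a ≤ x ∧ (x : ℕ) < b).map Fin.valEmbedding =
      Finset.Ico a b := by
    ext k
    simp only [Finset.mem_map, Finset.mem_filter, Finset.mem_univ, true_and, Finset.mem_Ico,
      Fin.valEmbedding_apply]
    exact ⟨by rintro ⟨x, h, rfl⟩; exact h, fun h => ⟨⟨k, by omega⟩, h, rfl⟩⟩
  rw [← Finset.card_map, this, Nat.card_Ico]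

/-- The number of arcs starting in `[a, b)`. -/
def ArcDiagram.arcCount (D : ArcDiagram m) (a b : ℕ) : ℕ :=
  (Finset.univ.filter fun x : Fin m => (a ≤ x ∧ (x : ℕ) < b) ∧ x < D.partner x).card

theorem ArcDiagram.Closed.sub_eq {D : ArcDiagram m} {a b : ℕ} (h : D.Closed a b) (hb : b ≤ m) :
    b - a = 2 * D.arcCount a b := by
  have := sum_eq_sum_arcs D (fun x => a ≤ x ∧ (x : ℕ) < b) h (fun _ => 1)
  rw [← Finset.card_eq_sum_ones, card_Ico_fin a b hb] at this
  rw [this, Finset.sum_const, smul_eq_mul, mul_comm]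
  rfl

/-- The end points of an arc have different parity. -/
theorem ArcDiagram.arc_eq (D : ArcDiagram m) {x y : Fin m} (h : D.partner x = y) (hx : x < y) :
    (y : ℕ) = x + 1 + 2 * D.arcCount (x + 1) y := by
  have h1 := (D.closed_arc h hx).sub_eq y.2.le
  rw [Fin.lt_def] at hx
  omega

theorem cap_hi (i : Fin (m - 1)) (D : ArcDiagram m) : (cap i D).partner (hi i) = lo i := by
  rw [← cap_lo i D, (cap i D).invol]

variable {i : Fin (m - 1)} {D : ArcDiagram m} {j k : Fin m}

theorem lo_lt_hi (i : Fin (m - 1)) : lo i < hi i := by simp [lo, hi, Fin.lt_def]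

theorem cap_partner_lo (hj : D.partner (lo i) = j) (hk : D.partner (hi i) = k) (h : j ≠ hi i) :
    (cap i D).partner j = k := by
  have h1 := D.invol
  have h2 := D.ne
  change capFun i D.partner j = k
  unfold capFun
  grind

theorem cap_partner_hi (hj : D.partner (lo i) = j) (hk : D.partner (hi i) = k) (h : j ≠ hi i) :
    (cap i D).partner k = j := by
  rw [← cap_partner_lo hj hk h, (cap i D).invol]

theorem cap_partner_of_ne (hj : D.partner (lo i) = j) (hk : D.partner (hi i) = k) {y : Fin m}
    (h1 : y ≠ lo i) (h2 : y ≠ hi i) (h3 : y ≠ j) (h4 : y ≠ k) :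
    (cap i D).partner y = D.partner y := by
  change capFun i D.partner y = _
  unfold capFun
  rw [if_neg h1, if_neg h2, hj, hk, if_neg h3, if_neg h4]

/-- The possible positions of the partners `j`, `k` of two neighbouring points that are not
connected: on both sides, both to the right, or both to the left. -/
theorem cap_cases (hj : D.partner (lo i) = j) (hk : D.partner (hi i) = k) (h : j ≠ hi i) :
    (j < lo i ∧ hi i < k) ∨ (hi i < k ∧ k < j) ∨ (k < j ∧ j < lo i) := by
  have h1 := D.invol
  have h2 := D.ne
  have h3 := lo_lt_hi i
  have n1 := D.noncrossing j k
  have n2 := D.noncrossing k (lo i)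
  have n3 := D.noncrossing (lo i) (hi i)
  have ej : D.partner j = lo i := by rw [← hj, h1]
  have ek : D.partner k = hi i := by rw [← hk, h1]
  have a1 : j ≠ lo i := hj ▸ h2 _
  have a2 : k ≠ hi i := hk ▸ h2 _
  have a3 : k ≠ lo i := fun e => h (by rw [← hj, ← e, ek])
  have a4 : j ≠ k := fun e => h3.ne (by rw [← ej, ← ek, e])
  rw [ej, ek] at n1
  rw [ek, hj] at n2
  rw [hj, hk] at n3
  have e1 : (hi i : ℕ) = lo i + 1 := rfl
  simp only [Fin.lt_def, ne_eq, Fin.ext_iff] at *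
  omega

theorem partner_ne_of_ne (hj : D.partner (lo i) = j) (hk : D.partner (hi i) = k) {y : Fin m}
    (h1 : y ≠ lo i) (h2 : y ≠ hi i) (h3 : y ≠ j) (h4 : y ≠ k) :
    D.partner y ≠ lo i ∧ D.partner y ≠ hi i ∧ D.partner y ≠ j ∧ D.partner y ≠ k := by
  have h := D.invol
  refine ⟨fun e => h3 ?_, fun e => h4 ?_, fun e => h1 ?_, fun e => h2 ?_⟩
  · rw [← hj, ← e, h]
  · rw [← hk, ← e, h]
  · rw [← h y, e, ← hj, h]
  · rw [← h y, e, ← hk, h]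

/-- The diagram is determined by the set of left end points of its arcs. -/
theorem ArcDiagram.ext_of_openers {D D' : ArcDiagram m}
    (h : ∀ x, x < D.partner x ↔ x < D'.partner x) : D = D' := by
  -- an arc of `D` is an arc of `D'`, by induction on its length: its end points cannot be connected
  -- in `D'` to points inside, so otherwise `D'` would have two crossing arcs
  have key : ∀ n : ℕ, ∀ D D' : ArcDiagram m, (∀ x, x < D.partner x ↔ x < D'.partner x) →
      ∀ x y : Fin m, D.partner x = y → x < y → (y : ℕ) - x = n → D'.partner x = y := by
    intro n
    induction n using Nat.strong_induction_on with
    | _ n ih =>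
      intro D D' h x y hxy hlt hn
      by_contra hne
      have hx' : x < D'.partner x := (h x).1 (by rw [hxy]; exact hlt)
      have hyx : D.partner y = x := by rw [← hxy, D.invol]
      have hy' : D'.partner y < y := by
        have h1 : ¬ y < D'.partner y := fun h1 => by
          have := (h y).2 h1
          rw [hyx] at this
          exact lt_asymm this hlt
        exact lt_of_le_of_ne (not_lt.1 h1) (D'.ne y)
      -- points strictly inside the arc are matched in the same way
      have inside : ∀ z, x < z → z < y → D'.partner z = D.partner z := by
        intro z h1 h2
        have hc := D.closed_arc hxy hlt z ⟨by rw [Fin.lt_def] at h1; omega, h2⟩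
        rcases lt_trichotomy z (D.partner z) with h3 | h3 | h3
        · exact ih (D.partner z - z) (by simp only [Fin.lt_def] at *; omega) D D' h z _ rfl h3 rfl
        · exact absurd h3.symm (D.ne z)
        · have := ih (z - D.partner z) (by simp only [Fin.lt_def] at *; omega) D D' h (D.partner z)
            z (D.invol z) h3 rfl
          rw [← this, D'.invol, this]
      have hxp : y < D'.partner x := by
        by_contra hle
        have h1 : D'.partner x < y := lt_of_le_of_ne (not_lt.1 hle) hne
        have h2 := inside _ hx' h1
        rw [D'.invol] at h2
        have h3 := congrArg D.partner h2
        rw [D.invol, hxy] at h3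
        exact h1.ne h3.symm
      have hyp : D'.partner y < x := by
        by_contra hle
        have h1 : x ≠ D'.partner y := fun e => by
          have := congrArg D'.partner e
          rw [D'.invol] at this
          exact hne this
        have h2 := inside _ (lt_of_le_of_ne (not_lt.1 hle) h1) hy'
        rw [D'.invol] at h2
        have h3 := congrArg D.partner h2
        rw [D.invol, hyx] at h3
        exact h1 h3
      exact D'.noncrossing (D'.partner y) x hyp (by rw [D'.invol]; exact hlt) (by rwa [D'.invol])
  ext1
  funext x
  rcases lt_trichotomy x (D.partner x) with h3 | h3 | h3
  · exact (key _ D D' h x _ rfl h3 rfl).symm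
  · exact absurd h3.symm (D.ne x)
  · have := key _ D D' h (D.partner x) x (D.invol x) h3 rfl
    rw [← this, D'.invol, this]

end ArcCombinatorics

/-! ### Compatible words and heights -/

section Compatible

variable {m : ℕ}

/-- The word `w` takes opposite values at the two end points of each arc of `D`. -/
def ArcDiagram.Compatible (D : ArcDiagram m) (w : Fin m → Bool) : Prop :=
  ∀ x, w (D.partner x) = !w x

/-- The word of left and right end points of `D` (`false`: left, `true`: right). -/
def ArcDiagram.word (D : ArcDiagram m) (x : Fin m) : Bool := decide (D.partner x < x)

theorem ArcDiagram.word_eq_false {D : ArcDiagram m} {x : Fin m} :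
    D.word x = false ↔ x < D.partner x := by
  rw [ArcDiagram.word, decide_eq_false_iff_not, not_lt]
  exact ⟨fun h => lt_of_le_of_ne h (D.ne x).symm, le_of_lt⟩

theorem ArcDiagram.compatible_word (D : ArcDiagram m) : D.Compatible D.word := by
  intro x
  rcases lt_trichotomy x (D.partner x) with h | h | h
  · simp [ArcDiagram.word, D.invol, h, h.le]
  · exact absurd h.symm (D.ne x)
  · simp [ArcDiagram.word, D.invol, h, h.le]

/-- The sum of the positions of the letters `false`. -/
def posSum (w : Fin m → Bool) : ℕ := ∑ y : Fin m, if w y = false then (y : ℕ) else 0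

/-- Among the words compatible with `D`, the word of `D` has the smallest sum of positions of the
letters `false`: this makes the vectors of the diagrams triangular. -/
theorem ArcDiagram.Compatible.eq_or_posSum_lt {D : ArcDiagram m} {w : Fin m → Bool}
    (h : D.Compatible w) : w = D.word ∨ posSum D.word < posSum w := by
  have key : ∀ w, D.Compatible w → posSum w =
      ∑ y with True ∧ y < D.partner y, if w y = false then (y : ℕ) else D.partner y := by
    intro w hw
    have := sum_eq_sum_arcs D (fun _ => True) (fun _ _ => trivial)
      (fun y => if w y = false then (y : ℕ) else 0)
    rw [Finset.filter_true] at this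
    rw [posSum, this]
    refine Finset.sum_congr rfl fun y _ => ?_
    rw [hw y]
    cases w y <;> simp
  rw [key _ h, key _ D.compatible_word, or_iff_not_imp_left]
  intro hne
  refine Finset.sum_lt_sum (fun y hy => ?_) ?_
  · have hy : y < D.partner y := (Finset.mem_filter.1 hy).2.2
    rw [if_pos (ArcDiagram.word_eq_false.2 hy)]
    split_ifs
    exacts [le_rfl, hy.le]
  · by_contra hcon
    push Not at hcon
    apply hne
    have hop : ∀ y, y < D.partner y → w y = D.word y := by
      intro y hy
      have := hcon y (by simpa using hy)
      rw [ArcDiagram.word_eq_false.2 hy] at this ⊢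
      by_contra hw
      rw [if_pos rfl, if_neg hw] at this
      exact absurd hy (not_lt.2 this)
    funext y
    rcases lt_trichotomy y (D.partner y) with h3 | h3 | h3
    · exact hop y h3
    · exact absurd h3.symm (D.ne y)
    · have h4 := hop (D.partner y) (by rwa [D.invol])
      rw [h y, D.compatible_word y] at h4
      simpa using h4

theorem height_zero (w : Fin m → Bool) : height w 0 = 0 := by simp [height, cnt]

theorem height_eq_add_sum (w : Fin m → Bool) (a b : ℕ) (hab : a ≤ b) (hb : b ≤ m) :
    height w b = height w a + ∑ y ∈ Finset.univ.filter (fun y : Fin m => a ≤ y ∧ (y : ℕ) < b),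
      if w y then (-1 : ℤ) else 1 := by
  induction b, hab using Nat.le_induction with
  | base =>
    rw [Finset.filter_false_of_mem (fun y _ => by omega), Finset.sum_empty, add_zero]
  | succ b hab ih =>
    have e : (Finset.univ.filter fun y : Fin m => a ≤ y ∧ (y : ℕ) < b + 1) =
        insert ⟨b, hb⟩ (Finset.univ.filter fun y : Fin m => a ≤ y ∧ (y : ℕ) < b) := by
      ext y
      simp only [Finset.mem_filter, Finset.mem_univ, true_and, Finset.mem_insert, Fin.ext_iff]
      omega
    rw [e, Finset.sum_insert (by simp), height_succ w ⟨b, hb⟩]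
    have := ih (by omega)
    simp only
    rw [this]
    ring

/-- Compatible words return to the same height after a union of arcs. -/
theorem ArcDiagram.Closed.height_eq {D : ArcDiagram m} {w : Fin m → Bool} {a b : ℕ}
    (hc : D.Closed a b) (hab : a ≤ b) (hb : b ≤ m) (hw : D.Compatible w) :
    height w b = height w a := by
  rw [height_eq_add_sum w a b hab hb, sum_eq_sum_arcs D (fun y => a ≤ y ∧ (y : ℕ) < b) hc,
    Finset.sum_eq_zero, add_zero]
  intro y _
  rw [hw y]
  cases w y <;> simp

theorem le_height_add (w : Fin m → Bool) (k : ℕ) (hk : k ≤ m) :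
    height w k ≤ height w m + (m - k) := by
  rw [height_eq_add_sum w k m hk le_rfl]
  have : ∑ y ∈ Finset.univ.filter (fun y : Fin m => k ≤ y ∧ (y : ℕ) < m), (-1 : ℤ) ≤
      ∑ y ∈ Finset.univ.filter (fun y : Fin m => k ≤ y ∧ (y : ℕ) < m),
        if w y then (-1 : ℤ) else 1 :=
    Finset.sum_le_sum fun y _ => by split_ifs <;> simp
  rw [Finset.sum_const, card_Ico_fin k m le_rfl, nsmul_eq_mul] at this
  push_cast [hk] at this
  linarith

theorem height_hi_succ (w : Fin m → Bool) (i : Fin (m - 1)) (h : w (lo i) ≠ w (hi i)) :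
    height w (i + 2) = height w i := by
  have t1 : height w (i + 1) = height w i + _ := height_succ w (lo i)
  have t2 : height w (i + 1 + 1) = height w (i + 1) + _ := height_succ w (hi i)
  change height w (i + 1 + 1) = _
  rw [t2, t1]
  revert h
  cases w (lo i) <;> cases w (hi i) <;> simp

end Compatible

/-! ### Weights of paths -/

section Weights

variable {n : ℕ} {A : ℂˣ}

theorem loopValue_sq_mul (A : ℂˣ) : loopValue A ^ 2 * (A : ℂ) ^ 4 = (1 + (A : ℂ) ^ 4) ^ 2 := by
  have := A.ne_zero
  simp only [loopValue, Units.val_inv_eq_inv_val]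
  field_simp
  ring

theorem loopValue_ne_zero (hn : 1 ≤ n) (hq : BraidRegular (2 * n) ((A : ℂ) ^ 4)) :
    loopValue A ≠ 0 := by
  intro h
  have := loopValue_sq_mul A
  rw [h] at this
  have h2 := hq.one_add_ne_zero (by omega)
  simp only [ne_eq, OfNat.ofNat_ne_zero, not_false_eq_true, zero_pow, zero_mul] at this
  exact h2 (pow_eq_zero_iff two_ne_zero |>.1 this.symm)

/-- The coefficient `δ a_d(A⁴)` of `δ e_i`, where `δ` is the value of a circle. -/
noncomputable def dCoeff (A : ℂˣ) (d : ℤ) : ℂ := loopValue A * aCoeff ((A : ℂ) ^ 4) d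

theorem dCoeff_mul (hn : 1 ≤ n) (hq : BraidRegular (2 * n) ((A : ℂ) ^ 4)) (d : ℤ) (h1 : 1 ≤ d)
    (h2 : d + 1 ≤ 2 * n) : dCoeff A d * dCoeff A (-(d + 1)) = 1 := by
  have e := aCoeff_mul hq.1 (hq.one_add_ne_zero (by omega)) d
    (hq.zpow_ne_one d h1 (by push_cast; omega) (by omega))
    (hq.zpow_ne_one (d + 1) (by omega) (by push_cast; omega) (by omega))
  have h3 := hq.one_add_ne_zero (by omega)
  have h4 := A.ne_zero
  unfold dCoeff
  calc _ = loopValue A ^ 2 * (aCoeff ((A : ℂ) ^ 4) d * aCoeff ((A : ℂ) ^ 4) (-(d + 1))) := by ring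
    _ = loopValue A ^ 2 * (A : ℂ) ^ 4 / (1 + (A : ℂ) ^ 4) ^ 2 := by rw [e]; ring
    _ = 1 := by rw [loopValue_sq_mul, div_self (pow_ne_zero 2 h3)]

theorem dCoeff_add (hn : 1 ≤ n) (hq : BraidRegular (2 * n) ((A : ℂ) ^ 4)) (d : ℤ) (h1 : 1 ≤ d)
    (h2 : d ≤ 2 * n) : dCoeff A d + dCoeff A (-d) = loopValue A := by
  have e := aCoeff_add_neg hq.1 (hq.one_add_ne_zero (by omega)) d
    (hq.zpow_ne_one d h1 (by push_cast; omega) (by omega))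
  unfold dCoeff
  rw [← mul_add, e, mul_one]

/-- The off-diagonal coefficient of `δ e_i` at the height `h`. -/
noncomputable def offCoeff (A : ℂˣ) (h : ℤ) : ℂ :=
  loopValue A * (aCoeff ((A : ℂ) ^ 4) (h + 1) * aCoeff ((A : ℂ) ^ 4) (-(h + 1))) ^ (1 / 2 : ℂ)

theorem offCoeff_sq (A : ℂˣ) (h : ℤ) :
    offCoeff A h * offCoeff A h = dCoeff A (h + 1) * dCoeff A (-(h + 1)) := by
  unfold offCoeff dCoeff
  have := sqrt_sq (aCoeff ((A : ℂ) ^ 4) (h + 1) * aCoeff ((A : ℂ) ^ 4) (-(h + 1)))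
  linear_combination (loopValue A) ^ 2 * this

theorem dCoeff_ne_zero (hn : 1 ≤ n) (hq : BraidRegular (2 * n) ((A : ℂ) ^ 4)) (d : ℤ) (h1 : 1 ≤ d)
    (h2 : d + 1 ≤ 2 * n) : dCoeff A d ≠ 0 := fun h => by
  have := dCoeff_mul hn hq d h1 h2
  rw [h, zero_mul] at this
  exact zero_ne_one this

theorem offCoeff_ne_zero (hn : 1 ≤ n) (hq : BraidRegular (2 * n) ((A : ℂ) ^ 4)) (h : ℤ)
    (h1 : 1 ≤ h) (h2 : h + 2 ≤ 2 * n) : offCoeff A h ≠ 0 := fun h0 => by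
  have := offCoeff_sq A h
  rw [h0, zero_mul, eq_comm, mul_eq_zero] at this
  rcases this with h3 | h3
  · exact dCoeff_ne_zero hn hq (h + 1) (by omega) (by omega) h3
  · have := dCoeff_mul hn hq h h1 (by omega)
    rw [h3, mul_zero] at this
    exact zero_ne_one this

/-- The weight of a left end point of an arc at which the path goes up from height `h`. -/
noncomputable def upWeight (A : ℂˣ) : ℕ → ℂ
  | 0 => 1
  | h + 1 => offCoeff A (h + 1) * upWeight A h

theorem upWeight_ne_zero (hn : 1 ≤ n) (hq : BraidRegular (2 * n) ((A : ℂ) ^ 4)) (h : ℕ)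
    (h1 : h + 1 ≤ n) : upWeight A h ≠ 0 := by
  induction h with
  | zero => exact one_ne_zero
  | succ h ih =>
    exact mul_ne_zero (offCoeff_ne_zero hn hq _ (by omega) (by omega)) (ih (by omega))

/-- The weight of the left end point of an arc at which a path goes up (`false`) or down (`true`)
from the height `h`. -/
noncomputable def cupWeight (A : ℂˣ) (h : ℤ) (b : Bool) : ℂ :=
  if b then upWeight A (h - 1).toNat / dCoeff A h else upWeight A h.toNat

/-- The weight of a cap joining two consecutive steps of a path, dual to `cupWeight`. -/
noncomputable def capWeight (A : ℂˣ) (h : ℤ) (b : Bool) : ℂ :=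
  if b then (upWeight A (h - 1).toNat)⁻¹ else dCoeff A (h + 1) / upWeight A h.toNat

/-- The change of height at a letter. -/
def step (b : Bool) : ℤ := if b then -1 else 1

/-- Straightening a zigzag of a cap and a cup. -/
theorem capWeight_mul_cupWeight (hq : BraidRegular (2 * n) ((A : ℂ) ^ 4)) {h : ℤ} {b : Bool}
    (h0 : 0 ≤ h + step b) (h0' : 0 ≤ h) (h1 : h + 1 ≤ n) :
    capWeight A h b * cupWeight A (h + step b) (!b) = 1 := by
  have hn : 1 ≤ n := by omega
  cases b
  · have h2 := upWeight_ne_zero hn hq h.toNat (by omega)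
    have h3 := dCoeff_ne_zero hn hq (h + 1) (by omega) (by omega)
    simp only [capWeight, cupWeight, step, Bool.not_false, if_true, Bool.false_eq_true, if_false,
      add_sub_cancel_right]
    field_simp
  · have h2 := upWeight_ne_zero hn hq (h - 1).toNat (by omega)
    simp only [capWeight, cupWeight, step, Bool.not_true, if_true, Bool.false_eq_true, if_false,
      ← sub_eq_add_neg]
    exact inv_mul_cancel₀ h2

/-- The diagonal coefficient of `δ e_i` at a peak. -/
theorem cupWeight_mul_capWeight_up (hq : BraidRegular (2 * n) ((A : ℂ) ^ 4)) {h : ℤ} (h0 : 0 ≤ h)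
    (h1 : h + 1 ≤ n) : cupWeight A h false * capWeight A h false = dCoeff A (h + 1) := by
  have h2 := upWeight_ne_zero (by omega) hq h.toNat (by omega)
  simp only [capWeight, cupWeight, Bool.false_eq_true, if_false]
  field_simp

/-- The diagonal coefficient of `δ e_i` at a valley. -/
theorem cupWeight_mul_capWeight_down (hq : BraidRegular (2 * n) ((A : ℂ) ^ 4)) {h : ℤ} (h0 : 1 ≤ h)
    (h1 : h + 1 ≤ n) : cupWeight A h true * capWeight A h true = dCoeff A (-(h + 1)) := by
  have h2 := upWeight_ne_zero (by omega) hq (h - 1).toNat (by omega)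
  have h3 := dCoeff_ne_zero (by omega) hq h h0 (by omega)
  have h4 := dCoeff_mul (by omega) hq h h0 (by omega)
  simp only [capWeight, cupWeight, if_true]
  field_simp
  linear_combination -h4

theorem upWeight_toNat {h : ℤ} (h0 : 1 ≤ h) :
    upWeight A h.toNat = offCoeff A h * upWeight A (h - 1).toNat := by
  obtain ⟨k, rfl⟩ : ∃ k : ℕ, h = k + 1 := ⟨(h - 1).toNat, by omega⟩
  rw [show ((k : ℤ) + 1).toNat = k + 1 by omega, show ((k : ℤ) + 1 - 1).toNat = k by omega,
    upWeight]

/-- The coefficient of `δ e_i` exchanging a peak and a valley. -/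
theorem cupWeight_mul_capWeight_not (hq : BraidRegular (2 * n) ((A : ℂ) ^ 4)) {h : ℤ} (h0 : 1 ≤ h)
    (h1 : h + 1 ≤ n) (b : Bool) : cupWeight A h b * capWeight A h (!b) = offCoeff A h := by
  have hn : 1 ≤ n := by omega
  have h2 := upWeight_ne_zero hn hq (h - 1).toNat (by omega)
  have h3 := dCoeff_ne_zero hn hq h h0 (by omega)
  have h4 := dCoeff_mul hn hq h h0 (by omega)
  have h5 := offCoeff_ne_zero hn hq h h0 (by omega)
  have h6 := offCoeff_sq A h
  cases b
  · simp only [capWeight, cupWeight, Bool.not_false, if_true, Bool.false_eq_true, if_false]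
    rw [upWeight_toNat h0]
    field_simp
  · simp only [capWeight, cupWeight, Bool.not_true, if_true, Bool.false_eq_true, if_false]
    rw [upWeight_toNat h0]
    field_simp
    linear_combination -dCoeff A (h + 1) * h4 - dCoeff A h * h6

/-- The coefficients of `δ e_i` in Young's orthogonal form, in terms of cups and caps. -/
theorem dCoeff_axial (hq : BraidRegular (2 * n) ((A : ℂ) ^ 4)) {w : Fin (2 * n) → Bool}
    {i : Fin (2 * n - 1)} (h0 : 0 ≤ height w i + step (w (lo i))) (h0' : 0 ≤ height w i)
    (h1 : height w i + 1 ≤ n) (h : w (lo i) ≠ w (hi i)) :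
    dCoeff A (axial w i) =
      cupWeight A (height w i) (w (lo i)) * capWeight A (height w i) (w (lo i)) := by
  rw [axial_eq, if_neg h]
  cases e1 : w (lo i) <;> rw [e1] at h h0
  · have e2 : w (hi i) = true := by simpa using h.symm
    rw [if_pos e2, cupWeight_mul_capWeight_up hq h0' h1]
  · have e2 : w (hi i) = false := by simpa using h.symm
    simp only [step, if_true] at h0
    rw [e2, if_neg (by simp), cupWeight_mul_capWeight_down hq (by omega) h1]

theorem bCoeff_eq_offCoeff {w : Fin (2 * n) → Bool} {i : Fin (2 * n - 1)}
    (h : w (lo i) ≠ w (hi i)) :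
    loopValue A * bCoeff ((A : ℂ) ^ 4) w i = offCoeff A (height w i) := by
  rw [bCoeff, offCoeff, axial_eq, if_neg h]
  split_ifs
  · rfl
  · rw [neg_neg, mul_comm (aCoeff _ _)]

end Weights

/-! ### Arc diagrams in the space of tableaux -/

section PathVector

variable {n : ℕ} {A : ℂˣ}

/-- The contribution of the point `y` to the weight of a path: only left end points count. -/
noncomputable def pointWeight {m : ℕ} (A : ℂˣ) (D : ArcDiagram m) (w : Fin m → Bool) (y : Fin m) :
    ℂ :=
  if y < D.partner y then cupWeight A (height w y) (w y) else 1

open Classical in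
/-- The coefficient of the word `w` in the vector attached to the arc diagram `D`. -/
noncomputable def pathCoeff {m : ℕ} (A : ℂˣ) (D : ArcDiagram m) (w : Fin m → Bool) : ℂ :=
  if D.Compatible w then ∏ y, pointWeight A D w y else 0

theorem prod_eq_four {m : ℕ} (G : Fin m → ℂ) {a b c d : Fin m} (h1 : a ≠ b) (h2 : a ≠ c)
    (h3 : a ≠ d) (h4 : b ≠ c) (h5 : b ≠ d) (h6 : c ≠ d) :
    ∏ y, G y = G a * G b * G c * G d * ∏ y ∈ Finset.univ \ {a, b, c, d}, G y := by
  rw [← Finset.prod_sdiff (Finset.subset_univ {a, b, c, d}), mul_comm,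
    Finset.prod_insert (by simp [h1, h2, h3]), Finset.prod_insert (by simp [h4, h5]),
    Finset.prod_insert (by simp [h6]), Finset.prod_singleton]
  ring

section Local

variable {m : ℕ} {i : Fin (m - 1)} {D : ArcDiagram m} {j k : Fin m} {w w' : Fin m → Bool}

theorem height_eq_of_agree (hw : w' = w ∨ w' = swapWord i w) (l : ℕ) (hl : l ≤ m) (h : l ≠ i + 1) :
    height w' l = height w l := by
  rcases hw with rfl | rfl
  exacts [rfl, height_swapWord i w l h hl]

theorem agree_of_ne (hw : w' = w ∨ w' = swapWord i w) (y : Fin m) (h1 : y ≠ lo i) (h2 : y ≠ hi i) :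
    w' y = w y := by
  rcases hw with rfl | rfl
  exacts [rfl, swapWord_of_ne i w y (fun e => h1 (Fin.ext e)) (fun e => h2 (Fin.ext e))]

/-- The four points involved in stacking `e_i` on a diagram in which `i`, `i + 1` are not
connected are distinct. -/
theorem four_ne (hj : D.partner (lo i) = j) (hk : D.partner (hi i) = k) (h : j ≠ hi i) :
    lo i ≠ hi i ∧ lo i ≠ j ∧ lo i ≠ k ∧ hi i ≠ j ∧ hi i ≠ k ∧ j ≠ k := by
  have h1 := D.invol
  refine ⟨lo_ne_hi i, fun e => D.ne _ (hj.trans e.symm), fun e => h ?_, h.symm,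
    fun e => D.ne _ (hk.trans e.symm), fun e => lo_ne_hi i ?_⟩
  · rw [← hj, e, ← hk, h1]
  · rw [← h1 (lo i), hj, e, ← hk, h1]

theorem compatible_cap_iff (hj : D.partner (lo i) = j) (hk : D.partner (hi i) = k) (h : j ≠ hi i)
    (hw : w' = w ∨ w' = swapWord i w) (hne : w (lo i) ≠ w (hi i)) (hwj : w' (lo i) = !w j) :
    (cap i D).Compatible w ↔ D.Compatible w' := by
  obtain ⟨d1, d2, d3, d4, d5, d6⟩ := four_ne hj hk h
  have hlo : w' (hi i) = !w' (lo i) := by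
    revert hne
    rcases hw with rfl | rfl
    · cases w' (lo i) <;> cases w' (hi i) <;> simp
    · rw [swapWord_lo, swapWord_hi]; cases w (lo i) <;> cases w (hi i) <;> simp
  have ej : w' j = w j := agree_of_ne hw j d2.symm d4.symm
  have ek : w' k = w k := agree_of_ne hw k d3.symm d5.symm
  constructor
  · intro H y
    have Hj := H j
    rw [cap_partner_lo hj hk h] at Hj
    by_cases y1 : y = lo i
    · rw [y1, hj, ej, hwj, Bool.not_not]
    by_cases y2 : y = hi i
    · rw [y2, hk, ek, Hj, hlo, hwj, Bool.not_not]
    by_cases y3 : y = j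
    · rw [y3, ← hj, D.invol, hj, ej, hwj]
    by_cases y4 : y = k
    · rw [y4, ← hk, D.invol, hk, ek, Hj, hlo, hwj]
    obtain ⟨p1, p2, -, -⟩ := partner_ne_of_ne hj hk y1 y2 y3 y4
    rw [agree_of_ne hw y y1 y2, agree_of_ne hw _ p1 p2, ← cap_partner_of_ne hj hk y1 y2 y3 y4, H y]
  · intro H y
    have Hk := H (hi i)
    rw [hk, ek, hlo, hwj, Bool.not_not] at Hk
    by_cases y1 : y = lo i
    · rw [y1, cap_lo]; revert hne; cases w (lo i) <;> cases w (hi i) <;> simp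
    by_cases y2 : y = hi i
    · rw [y2, cap_hi]; revert hne; cases w (lo i) <;> cases w (hi i) <;> simp
    by_cases y3 : y = j
    · rw [y3, cap_partner_lo hj hk h, Hk]
    by_cases y4 : y = k
    · rw [y4, cap_partner_hi hj hk h, Hk, Bool.not_not]
    obtain ⟨p1, p2, -, -⟩ := partner_ne_of_ne hj hk y1 y2 y3 y4
    rw [cap_partner_of_ne hj hk y1 y2 y3 y4, ← agree_of_ne hw y y1 y2, ← agree_of_ne hw _ p1 p2,
      H y]

end Local

/-- A compatible word that has to be straightened stays at non-negative heights. -/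
theorem zigzag_nonneg {i : Fin (2 * n - 1)} {D : ArcDiagram (2 * n)} {j k : Fin (2 * n)}
    {w w' : Fin (2 * n) → Bool} (hj : D.partner (lo i) = j) (hk : D.partner (hi i) = k)
    (h : j ≠ hi i) (hw : w' = w ∨ w' = swapWord i w) (hst : IsStandard 0 w)
    (hne : w (lo i) ≠ w (hi i)) (hD : D.Compatible w') : 0 ≤ height w i + step (w' (lo i)) := by
  obtain ⟨d1, d2, d3, d4, d5, d6⟩ := four_ne hj hk h
  have hpos := ((isStandard_iff w).1 hst).1
  have vlo : (lo i : ℕ) = i := rfl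
  have vhi : (hi i : ℕ) = i + 1 := rfl
  -- for an arc ending at `lo i` the height before the arc is the height in question
  have left : j < lo i → 0 ≤ height w i + step (w' (lo i)) := by
    intro hlt
    have hc := (D.closed_arc (by rw [← hj, D.invol]) hlt).height_eq hlt (lo i).2.le hD
    rw [vlo, height_eq_of_agree hw i (by omega) (by omega), height_succ w' j] at hc
    rw [Fin.lt_def] at hlt
    have e := hD (lo i)
    rw [hj] at e
    rw [e, height_eq_of_agree hw j (by omega) (by omega)] at hc
    have := hpos j (by omega)
    have h2 : step (w' (lo i)) = -(if (!w' (lo i)) = true then -1 else 1) := by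
      cases w' (lo i) <;> simp [step]
    rw [h2, hc]
    linarith
  rcases cap_cases hj hk h with ⟨c1, c2⟩ | ⟨c1, c2⟩ | ⟨c1, c2⟩
  · exact left c1
  · have hc := (D.closed_arc hk c1).height_eq c1 k.2.le hD
    have hw' : w' (lo i) ≠ w' (hi i) := by
      rcases hw with rfl | rfl
      · exact hne
      · rw [swapWord_lo, swapWord_hi]; exact hne.symm
    rw [Fin.lt_def] at c1
    rw [vhi, show (i : ℕ) + 1 + 1 = i + 2 by ring, height_hi_succ w' i hw',
      height_eq_of_agree hw i (by omega) (by omega)] at hc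
    have e := hD (hi i)
    rw [hk] at e
    have h3 := hpos (k + 1) k.2
    rw [← height_eq_of_agree hw _ k.2 (by omega), height_succ, hc, e] at h3
    have h2 : step (w' (lo i)) = if (!w' (hi i)) = true then -1 else 1 := by
      revert hw'; cases w' (lo i) <;> cases w' (hi i) <;> simp [step]
    rwa [h2]
  · exact left c2

/-- Stacking `e_i` on a diagram in which `i` and `i + 1` are not connected. -/
theorem pathCoeff_cap (hq : BraidRegular (2 * n) ((A : ℂ) ^ 4)) {i : Fin (2 * n - 1)}
    {D : ArcDiagram (2 * n)} {j k : Fin (2 * n)}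
    {w w' : Fin (2 * n) → Bool} (hj : D.partner (lo i) = j) (hk : D.partner (hi i) = k)
    (h : j ≠ hi i) (hw : w' = w ∨ w' = swapWord i w) (hst : IsStandard 0 w)
    (hne : w (lo i) ≠ w (hi i)) (hD : D.Compatible w') (h1 : height w i + 1 ≤ n) :
    pathCoeff A (cap i D) w =
      cupWeight A (height w i) (w (lo i)) * capWeight A (height w i) (w' (lo i)) *
        pathCoeff A D w' := by
  obtain ⟨d1, d2, d3, d4, d5, d6⟩ := four_ne hj hk h
  have ej : w' j = w j := agree_of_ne hw j d2.symm d4.symm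
  have ek : w' k = w k := agree_of_ne hw k d3.symm d5.symm
  have Hlo := hD (lo i)
  rw [hj, ej] at Hlo
  have hcap : (cap i D).Compatible w :=
    (compatible_cap_iff hj hk h hw hne (by rw [Hlo, Bool.not_not])).2 hD
  have vlo : (lo i : ℕ) = i := rfl
  have vhi : (hi i : ℕ) = i + 1 := rfl
  have hlo : w' (hi i) = !w' (lo i) := by
    revert hne
    rcases hw with rfl | rfl
    · cases w' (lo i) <;> cases w' (hi i) <;> simp
    · rw [swapWord_lo, swapWord_hi]; cases w (lo i) <;> cases w (hi i) <;> simp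
  have hpos := ((isStandard_iff w).1 hst).1
  have hzz := capWeight_mul_cupWeight hq (zigzag_nonneg hj hk h hw hst hne hD)
    (hpos i (by omega)) h1
  have hsucc : height w' (hi i) = height w i + step (w' (lo i)) := by
    have := height_succ w' (lo i)
    rw [vlo] at this
    rw [vhi, this, height_eq_of_agree hw i (by omega) (by omega)]
    rfl
  have pj : D.partner j = lo i := by rw [← hj, D.invol]
  have pk : D.partner k = hi i := by rw [← hk, D.invol]
  rw [pathCoeff, if_pos hcap, pathCoeff, if_pos hD,
    prod_eq_four (pointWeight A (cap i D) w) d1 d2 d3 d4 d5 d6,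
    prod_eq_four (pointWeight A D w') d1 d2 d3 d4 d5 d6]
  have hrest : ∏ y ∈ Finset.univ \ {lo i, hi i, j, k}, pointWeight A (cap i D) w y =
      ∏ y ∈ Finset.univ \ {lo i, hi i, j, k}, pointWeight A D w' y := by
    refine Finset.prod_congr rfl fun y hy => ?_
    simp only [Finset.mem_sdiff, Finset.mem_univ, true_and, Finset.mem_insert,
      Finset.mem_singleton, not_or] at hy
    obtain ⟨y1, y2, y3, y4⟩ := hy
    rw [pointWeight, pointWeight, cap_partner_of_ne hj hk y1 y2 y3 y4, agree_of_ne hw y y1 y2,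
      height_eq_of_agree hw y y.2.le (fun e => y2 (Fin.ext e))]
  rw [hrest]
  have c1 : pointWeight A (cap i D) w (lo i) = cupWeight A (height w i) (w (lo i)) := by
    rw [pointWeight, cap_lo, if_pos (lo_lt_hi i), vlo]
  have c2 : pointWeight A (cap i D) w (hi i) = 1 := by
    rw [pointWeight, cap_hi, if_neg (lo_lt_hi i).not_gt]
  have cj : pointWeight A (cap i D) w j = if j < k then cupWeight A (height w j) (w j) else 1 := by
    rw [pointWeight, cap_partner_lo hj hk h]
  have ck : pointWeight A (cap i D) w k = if k < j then cupWeight A (height w k) (w k) else 1 := by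
    rw [pointWeight, cap_partner_hi hj hk h]
  have hj' : height w' j = height w j :=
    height_eq_of_agree hw j j.2.le (fun e => d4 (Fin.ext e.symm))
  have hk' : height w' k = height w k :=
    height_eq_of_agree hw k k.2.le (fun e => d5 (Fin.ext e.symm))
  have dj : pointWeight A D w' j = if j < lo i then cupWeight A (height w j) (w j) else 1 := by
    rw [pointWeight, pj, hj', ej]
  have dk : pointWeight A D w' k = if k < hi i then cupWeight A (height w k) (w k) else 1 := by
    rw [pointWeight, pk, hk', ek]
  have dlo : pointWeight A D w' (lo i) =
      if lo i < j then cupWeight A (height w i) (w' (lo i)) else 1 := by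
    rw [pointWeight, hj, vlo, height_eq_of_agree hw i (by omega) (by omega)]
  have dhi : pointWeight A D w' (hi i) =
      if hi i < k then cupWeight A (height w i + step (w' (lo i))) (!w' (lo i)) else 1 := by
    rw [pointWeight, hk, hsucc, hlo]
  rw [c1, c2, cj, ck, dj, dk, dlo, dhi]
  have hlt := lo_lt_hi i
  rcases cap_cases hj hk h with ⟨b1, b2⟩ | ⟨b1, b2⟩ | ⟨b1, b2⟩
  · rw [if_pos (b1.trans (hlt.trans b2)), if_neg (b1.trans (hlt.trans b2)).not_gt, if_pos b1,
      if_neg b2.not_gt, if_neg b1.not_gt, if_pos b2]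
    linear_combination (-cupWeight A (height w i) (w (lo i)) * cupWeight A (height w j) (w j) *
      ∏ y ∈ Finset.univ \ {lo i, hi i, j, k}, pointWeight A D w' y) * hzz
  · rw [if_neg b2.not_gt, if_pos b2, if_neg (hlt.trans (b1.trans b2)).not_gt, if_neg b1.not_gt,
      if_pos (hlt.trans (b1.trans b2)), if_pos b1]
    have hkh : height w k = height w i := by
      have hc := (D.closed_arc hk b1).height_eq b1 k.2.le hD
      rw [Fin.lt_def] at b1
      rw [← hk', hc, vhi, show (i : ℕ) + 1 + 1 = i + 2 by ring,
        height_hi_succ w' i (by rw [hlo]; cases w' (lo i) <;> simp),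
        height_eq_of_agree hw i (by omega) (by omega)]
    have hwk : w k = w' (lo i) := by rw [← ek, ← hk, hD, hlo, Bool.not_not]
    rw [hkh, hwk]
    linear_combination (-cupWeight A (height w i) (w (lo i)) *
      cupWeight A (height w i) (w' (lo i)) *
      ∏ y ∈ Finset.univ \ {lo i, hi i, j, k}, pointWeight A D w' y) * hzz
  · rw [if_neg b1.not_gt, if_pos b1, if_pos b2, if_pos (b1.trans (b2.trans hlt)),
      if_neg b2.not_gt, if_neg (b1.trans (b2.trans hlt)).not_gt]
    have hjh : height w j = height w i + step (w' (lo i)) := by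
      have hc := (D.closed_arc pj b2).height_eq b2 (lo i).2.le hD
      rw [vlo, height_eq_of_agree hw i (by omega) (by omega), height_succ, hj', ej, Hlo] at hc
      rw [hc]
      cases w' (lo i) <;> simp [step]
    rw [hjh, Hlo]
    linear_combination (-cupWeight A (height w i) (w (lo i)) * cupWeight A (height w k) (w k) *
      ∏ y ∈ Finset.univ \ {lo i, hi i, j, k}, pointWeight A D w' y) * hzz

end PathVector

/-! ### The equivalence with the Jones representation -/

section JonesEquivalence

variable {n : ℕ} {A : ℂˣ}

open Classical in
/-- The coefficient of a word in a vector of the Young module, `0` unless the word is standard. -/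
noncomputable def wordCoeff {m d : ℕ} (v : Tableau m d →₀ ℂ) (w : Fin m → Bool) : ℂ :=
  if h : IsStandard d w then v ⟨w, h⟩ else 0

theorem wordCoeff_tableauVec {m d : ℕ} {w : Fin m → Bool} (hw : IsStandard d w)
    (w' : Fin m → Bool) [Decidable (w = w')] :
    wordCoeff (tableauVec m d w) w' = if w = w' then 1 else 0 := by
  classical
  rw [wordCoeff, tableauVec, dif_pos hw]
  by_cases h : w = w'
  · subst h; simp [hw]
  · rw [if_neg h]
    split_ifs
    · rw [Finsupp.single_apply, if_neg (by simpa using h)]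
    · rfl

theorem wordCoeff_add {m d : ℕ} (u v : Tableau m d →₀ ℂ) (w : Fin m → Bool) :
    wordCoeff (u + v) w = wordCoeff u w + wordCoeff v w := by
  unfold wordCoeff; split_ifs <;> simp

theorem wordCoeff_smul {m d : ℕ} (z : ℂ) (v : Tableau m d →₀ ℂ) (w : Fin m → Bool) :
    wordCoeff (z • v) w = z * wordCoeff v w := by
  unfold wordCoeff; split_ifs <;> simp

theorem wordCoeff_tableauVec_swapWord {m d : ℕ} {q : ℂ} (i : Fin (m - 1)) {w : Fin m → Bool}
    (hw : IsStandard d w) (w' : Fin m → Bool) [Decidable (swapWord i w = w')] :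
    bCoeff q w i * wordCoeff (tableauVec m d (swapWord i w)) w' =
      bCoeff q w i * if swapWord i w = w' then 1 else 0 := by
  rcases bCoeff_eq_zero_or (q := q) w i hw with h | h
  · rw [h, zero_mul, zero_mul]
  · rw [wordCoeff_tableauVec h.2]

/-- The coefficients of `e_i v`, in the symmetric form of Young's orthogonal representation. -/
theorem wordCoeff_wenzlE {m d : ℕ} {q : ℂ} (i : Fin (m - 1)) (v : Tableau m d →₀ ℂ)
    {w : Fin m → Bool} (hne : w (lo i) ≠ w (hi i)) :
    wordCoeff (wenzlE m d q i v) w =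
      aCoeff q (axial w i) * wordCoeff v w + bCoeff q w i * wordCoeff v (swapWord i w) := by
  classical
  induction v using Finsupp.induction_linear with
  | zero => simp [wordCoeff]
  | add u v hu hv => rw [map_add, wordCoeff_add, hu, hv, wordCoeff_add, wordCoeff_add]; ring
  | single t z =>
    have ht : Finsupp.single t z = z • tableauVec m d t.1 := by
      rw [tableauVec, dif_pos t.2, Finsupp.smul_single, smul_eq_mul, mul_one]
    rw [ht, map_smul, wenzlE_tableauVec i t.2]
    simp only [wordCoeff_smul, wordCoeff_add]
    rw [wordCoeff_tableauVec_swapWord i t.2, wordCoeff_tableauVec t.2, wordCoeff_tableauVec t.2]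
    have e1 : swapWord i t.1 = w ↔ t.1 = swapWord i w :=
      ⟨fun h => by rw [← h, swapWord_swapWord], fun h => by rw [h, swapWord_swapWord]⟩
    rw [if_congr e1 rfl rfl]
    by_cases h1 : t.1 = w
    · have h2 : w ≠ swapWord i w := fun h => by
        have := congrFun h (lo i)
        rw [swapWord_lo] at this
        exact hne this
      rw [h1, if_pos rfl, if_neg h2]; ring
    · by_cases h2 : t.1 = swapWord i w
      · rw [if_neg h1, if_pos h2, h2, bCoeff, bCoeff, axial_swapWord w i hne, neg_neg,
          mul_comm (aCoeff q (-axial w i)) (aCoeff q (axial w i))]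
        ring
      · simp [h1, h2]

theorem wordCoeff_wenzlE_eq_zero {m d : ℕ} {q : ℂ} (i : Fin (m - 1)) (v : Tableau m d →₀ ℂ)
    {w : Fin m → Bool} (heq : w (lo i) = w (hi i)) : wordCoeff (wenzlE m d q i v) w = 0 := by
  classical
  induction v using Finsupp.induction_linear with
  | zero => simp [wordCoeff]
  | add u v hu hv => rw [map_add, wordCoeff_add, hu, hv, add_zero]
  | single t z =>
    have ht : Finsupp.single t z = z • tableauVec m d t.1 := by
      rw [tableauVec, dif_pos t.2, Finsupp.smul_single, smul_eq_mul, mul_one]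
    rw [ht, map_smul, wordCoeff_smul]
    by_cases h : t.1 (lo i) = t.1 (hi i)
    · rw [wenzlE_eq_zero i t.2 h]; simp [wordCoeff]
    · rw [wenzlE_tableauVec i t.2, wordCoeff_add, wordCoeff_smul, wordCoeff_smul,
        wordCoeff_tableauVec_swapWord i t.2, wordCoeff_tableauVec t.2, if_neg, if_neg]
      · ring
      · rintro rfl
        rw [swapWord_lo, swapWord_hi] at heq
        exact h heq.symm
      · rintro rfl
        exact h heq

/-- The map from the span of the arc diagrams to Young's module, whose matrix entries are the
products over the arcs of the weights of the steps of a path at their left end points. -/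
noncomputable def pathMap (n : ℕ) (A : ℂˣ) :
    (ArcDiagram (2 * n) →₀ ℂ) →ₗ[ℂ] (Tableau (2 * n) 0 →₀ ℂ) :=
  Finsupp.linearCombination ℂ fun D =>
    Finsupp.equivFunOnFinite.symm fun t : Tableau (2 * n) 0 => pathCoeff A D t.1

theorem pathMap_single (D : ArcDiagram (2 * n)) (z : ℂ) (t : Tableau (2 * n) 0) :
    pathMap n A (Finsupp.single D z) t = z * pathCoeff A D t.1 := by
  simp [pathMap]

theorem wordCoeff_pathMap_single (D : ArcDiagram (2 * n)) {w : Fin (2 * n) → Bool}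
    (hw : IsStandard 0 w) : wordCoeff (pathMap n A (Finsupp.single D 1)) w = pathCoeff A D w := by
  rw [wordCoeff, dif_pos hw, pathMap_single, one_mul]

theorem ext_wordCoeff {m d : ℕ} {u v : Tableau m d →₀ ℂ}
    (h : ∀ w, IsStandard d w → wordCoeff u w = wordCoeff v w) : u = v := by
  ext t
  have := h t.1 t.2
  rwa [wordCoeff, wordCoeff, dif_pos t.2, dif_pos t.2] at this

theorem height_add_one_le {w : Fin (2 * n) → Bool} (hst : IsStandard 0 w) (i : Fin (2 * n - 1))
    (hne : w (lo i) ≠ w (hi i)) : height w i + 1 ≤ n := by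
  have h1 := height_le w i (by omega)
  have h2 := le_height_add w (i + 2) (by omega)
  rw [height_hi_succ w i hne, ((isStandard_iff w).1 hst).2] at h2
  push_cast at h2
  omega

/-- `δ e_i` acts on path vectors through the products of a cap and a cup, as long as these make
sense, i.e. above the height `0`. -/
theorem loopValue_mul_wordCoeff_wenzlE (hq : BraidRegular (2 * n) ((A : ℂ) ^ 4))
    (i : Fin (2 * n - 1)) (D : ArcDiagram (2 * n)) {w : Fin (2 * n) → Bool} (hst : IsStandard 0 w)
    (hne : w (lo i) ≠ w (hi i)) :
    loopValue A * wordCoeff (wenzlE (2 * n) 0 ((A : ℂ) ^ 4) i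
        (pathMap n A (Finsupp.single D 1))) w =
      cupWeight A (height w i) (w (lo i)) * capWeight A (height w i) (w (lo i)) * pathCoeff A D w +
      if 1 ≤ height w i then cupWeight A (height w i) (w (lo i)) *
        capWeight A (height w i) (!w (lo i)) * pathCoeff A D (swapWord i w) else 0 := by
  have hn : 1 ≤ n := by have := i.2; omega
  have h1 := height_add_one_le hst i hne
  have hs := (isStandard_iff w).1 hst
  have h0 := hs.1 i (by omega)
  have hup : 0 ≤ height w i + step (w (lo i)) := by
    have e : height w (i + 1) = height w i + _ := height_succ w (lo i)
    have := hs.1 (i + 1) (by omega)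
    rw [e] at this
    exact this
  rw [wordCoeff_wenzlE i _ hne, wordCoeff_pathMap_single D hst,
    ← dCoeff_axial hq hup h0 h1 hne, dCoeff]
  split_ifs with h
  · rw [cupWeight_mul_capWeight_not hq h h1, ← bCoeff_eq_offCoeff hne, wordCoeff_pathMap_single]
    · ring
    · refine isStandard_swapWord i hst ?_
      split_ifs <;> omega
  · have hlo : w (lo i) = false := by
      cases e : w (lo i)
      · rfl
      · rw [e] at hup; simp only [step, if_true] at hup; omega
    have : bCoeff ((A : ℂ) ^ 4) w i = 0 := by
      have hz : height w i = 0 := by omega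
      have h2 := bCoeff_eq_offCoeff (A := A) hne
      rw [hz, offCoeff, zero_add, aCoeff_neg_one, mul_zero, Complex.zero_cpow (by norm_num),
        mul_zero] at h2
      exact (mul_eq_zero.1 h2).resolve_left (loopValue_ne_zero hn hq)
    rw [this]
    ring

/-- The stacking operator `E_i`, with `E_i² = δ E_i`, corresponds to `δ` times the projection
`e_i`. -/
theorem pathMap_diagramE (hq : BraidRegular (2 * n) ((A : ℂ) ^ 4)) (i : Fin (2 * n - 1)) :
    pathMap n A ∘ₗ diagramE A i =
      (loopValue A • wenzlE (2 * n) 0 ((A : ℂ) ^ 4) i) ∘ₗ pathMap n A := by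
  classical
  refine Finsupp.lhom_ext' fun D => LinearMap.ext_ring ?_
  simp only [LinearMap.comp_apply, Finsupp.lsingle_apply, LinearMap.smul_apply, diagramE_single,
    one_mul]
  have hn : 1 ≤ n := by have := i.2; omega
  refine ext_wordCoeff fun w hst => ?_
  rw [wordCoeff_smul, wordCoeff, dif_pos hst, pathMap_single]
  by_cases hne : w (lo i) = w (hi i)
  · have hc : ¬ (cap i D).Compatible w := fun h => by
      have := h (lo i)
      rw [cap_lo, hne] at this
      revert this; cases w (hi i) <;> simp
    rw [wordCoeff_wenzlE_eq_zero i _ hne, mul_zero, pathCoeff, if_neg hc, mul_zero]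
  rw [loopValue_mul_wordCoeff_wenzlE hq i D hst hne]
  have h1 := height_add_one_le hst i hne
  have hs := (isStandard_iff w).1 hst
  have h0 := hs.1 i (by omega)
  have vlo : (lo i : ℕ) = i := rfl
  by_cases hj : D.partner (lo i) = hi i
  · -- a closed circle: the weights of the two possible steps add up to its value
    have hj' : D.partner (hi i) = lo i := by rw [← hj, D.invol]
    have hcomp : D.Compatible (swapWord i w) ↔ D.Compatible w := by
      refine forall_congr' fun y => ?_
      by_cases y1 : y = lo i
      · rw [y1, hj, swapWord_lo, swapWord_hi]; cases w (lo i) <;> cases w (hi i) <;> simp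
      by_cases y2 : y = hi i
      · rw [y2, hj', swapWord_lo, swapWord_hi]; cases w (lo i) <;> cases w (hi i) <;> simp
      have p1 : D.partner y ≠ lo i := fun e => y2 (by rw [← hj, ← e, D.invol])
      have p2 : D.partner y ≠ hi i := fun e => y1 (by rw [← hj', ← e, D.invol])
      rw [agree_of_ne (Or.inr rfl : swapWord i w = w ∨ _) y y1 y2,
        agree_of_ne (Or.inr rfl : swapWord i w = w ∨ _) _ p1 p2]
    rw [if_pos hj, cap_of_joined i D hj]
    simp only [pathCoeff, hcomp]
    split_ifs with hc hh
    · have hprod : ∀ w', (w' = w ∨ w' = swapWord i w) → ∏ y, pointWeight A D w' y =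
          cupWeight A (height w i) (w' (lo i)) *
            ∏ y ∈ Finset.univ.erase (lo i), pointWeight A D w y := by
        intro w' hw'
        rw [← Finset.mul_prod_erase _ _ (Finset.mem_univ (lo i))]
        congr 1
        · rw [pointWeight, hj, if_pos (lo_lt_hi i), vlo,
            height_eq_of_agree hw' i (by omega) (by omega)]
        · refine Finset.prod_congr rfl fun y hy => ?_
          have y1 := (Finset.mem_erase.1 hy).1
          by_cases y2 : y = hi i
          · rw [y2, pointWeight, pointWeight, hj', if_neg (lo_lt_hi i).not_gt,
              if_neg (lo_lt_hi i).not_gt]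
          · rw [pointWeight, pointWeight, agree_of_ne hw' y y1 y2,
              height_eq_of_agree hw' y y.2.le (fun e => y2 (Fin.ext e))]
      rw [hprod w (Or.inl rfl), hprod _ (Or.inr rfl), swapWord_lo]
      have hhi : w (hi i) = !w (lo i) := by
        revert hne; cases w (lo i) <;> cases w (hi i) <;> simp
      rw [hhi]
      have e1 := cupWeight_mul_capWeight_up hq h0 h1
      have e2 := cupWeight_mul_capWeight_down hq hh h1
      have e3 := dCoeff_add hn hq (height w i + 1) (by omega) (by omega)
      rw [← e1, ← e2] at e3
      rw [← e3]
      cases w (lo i) <;> simp only [Bool.not_true, Bool.not_false] <;> ring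
    · have hz : height w i = 0 := by omega
      have hlo : w (lo i) = false := by
        cases e : w (lo i)
        · rfl
        · have e2 : height w (i + 1) = height w i + _ := height_succ w (lo i)
          have := hs.1 (i + 1) (by omega)
          rw [e2, e, hz] at this
          simp at this
      have e1 := cupWeight_mul_capWeight_up hq h0 h1
      have e3 := dCoeff_add hn hq 1 (by omega) (by omega)
      rw [hlo, e1, hz, zero_add, ← e3, dCoeff, dCoeff, aCoeff_neg_one]
      ring
    · simp
    · simp
  · rw [if_neg hj, one_mul]
    have key : ∀ w', (w' = w ∨ w' = swapWord i w) → D.Compatible w' →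
        w' (lo i) = !w (D.partner (lo i)) := by
      intro w' hw' hc
      have := hc (lo i)
      rw [agree_of_ne hw' _ (D.ne _) hj] at this
      rw [this, Bool.not_not]
    have hhi : w (hi i) = !w (lo i) := by
      revert hne; cases w (lo i) <;> cases w (hi i) <;> simp
    by_cases hc1 : D.Compatible w
    · have hc2 : ¬ D.Compatible (swapWord i w) := fun hc2 => by
        have e1 := key w (Or.inl rfl) hc1
        have e2 := key _ (Or.inr rfl) hc2
        rw [swapWord_lo, ← e1] at e2
        exact hne e2.symm
      rw [pathCoeff_cap hq rfl rfl hj (Or.inl rfl) hst hne hc1 h1]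
      simp [pathCoeff, hc2]
    · by_cases hc2 : D.Compatible (swapWord i w)
      · have hz := zigzag_nonneg rfl rfl hj (Or.inr rfl) hst hne hc2
        have hh : 1 ≤ height w i := by
          rw [swapWord_lo, hhi] at hz
          by_contra hlt
          have hz0 : height w i = 0 := by omega
          cases e : w (lo i)
          · rw [e, hz0] at hz; simp [step] at hz
          · have e2 : height w (i + 1) = height w i + _ := height_succ w (lo i)
            have := hs.1 (i + 1) (by omega)
            rw [e2, e, hz0] at this
            simp at this
        rw [pathCoeff_cap hq rfl rfl hj (Or.inr rfl) hst hne hc2 h1, if_pos hh, swapWord_lo, hhi]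
        simp [pathCoeff, hc1]
      · have hcap : ¬ (cap i D).Compatible w := fun h => by
          by_cases e : w (lo i) = !w (D.partner (lo i))
          · exact hc1 ((compatible_cap_iff rfl rfl hj (Or.inl rfl) hne e).1 h)
          · refine hc2 ((compatible_cap_iff rfl rfl hj (Or.inr rfl) hne ?_).1 h)
            rw [swapWord_lo, hhi]
            revert e; cases w (lo i) <;> cases w (D.partner (lo i)) <;> simp
        simp [pathCoeff, hc1, hc2, hcap]

end JonesEquivalence

/-! ### Bijectivity -/

section Bijectivity

variable {n : ℕ} {A : ℂˣ}

theorem ArcDiagram.isStandard_word {m : ℕ} (D : ArcDiagram m) : IsStandard 0 D.word := by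
  have h0 : height D.word m = 0 := by
    rw [D.closed_univ.height_eq (Nat.zero_le m) le_rfl D.compatible_word, height_zero]
  refine ⟨fun k _ => ?_, by unfold height at h0; omega⟩
  refine Finset.card_le_card_of_injOn D.partner ?_ ?_
  · intro y hy
    simp only [Finset.coe_filter, Finset.mem_univ, true_and, Set.mem_ofPred_eq] at hy ⊢
    have h : D.partner y < y := by simpa [ArcDiagram.word] using hy.2
    rw [D.compatible_word y, hy.2]
    exact ⟨by rw [Fin.lt_def] at h; omega, rfl⟩
  · intro y _ z _ h
    rw [← D.invol y, h, D.invol]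

theorem pathCoeff_word_ne_zero (hq : BraidRegular (2 * n) ((A : ℂ) ^ 4)) (D : ArcDiagram (2 * n)) :
    pathCoeff A D D.word ≠ 0 := by
  rw [pathCoeff, if_pos D.compatible_word, Finset.prod_ne_zero_iff]
  intro y _
  rw [pointWeight]
  split_ifs with h
  · have hw := ArcDiagram.word_eq_false.2 h
    have hs := (isStandard_iff _).1 D.isStandard_word
    have h1 := height_le D.word y y.2.le
    have h2 := le_height_add D.word (y + 1) y.2
    have h3 := hs.1 y y.2.le
    rw [hs.2, height_succ, hw] at h2
    rw [hw, cupWeight, if_neg (by simp)]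
    push_cast at h2
    exact upWeight_ne_zero (by omega) hq _ (by omega)
  · exact one_ne_zero

theorem compatible_of_pathCoeff_ne_zero {m : ℕ} {D : ArcDiagram m} {w : Fin m → Bool}
    (h : pathCoeff A D w ≠ 0) : D.Compatible w := by
  by_contra hc
  exact h (by rw [pathCoeff, if_neg hc])

theorem ArcDiagram.word_injective {m : ℕ} : Function.Injective (ArcDiagram.word (m := m)) :=
  fun D D' h => ArcDiagram.ext_of_openers fun y => by
    rw [← ArcDiagram.word_eq_false, ← ArcDiagram.word_eq_false, h]

/-- Triangularity: the coefficient at the word of `D` vanishes for all diagrams other than `D`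
whose word does not have a smaller sum of positions. -/
theorem pathMap_injective (hq : BraidRegular (2 * n) ((A : ℂ) ^ 4)) :
    Function.Injective (pathMap n A) := by
  refine linearIndependent_of_triangular _
    (fun D => Finsupp.lapply (⟨D.word, D.isStandard_word⟩ : Tableau (2 * n) 0))
    (fun D => posSum D.word) (fun D => ?_) (fun D D' h => ?_)
  · exact pathCoeff_word_ne_zero hq D
  · rcases (compatible_of_pathCoeff_ne_zero h).eq_or_posSum_lt with h1 | h1
    · exact Or.inl (ArcDiagram.word_injective h1)
    · exact Or.inr h1

/-- The diagram in which each point with an even number is connected to the next one. -/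
def flatDiagram (n : ℕ) : ArcDiagram (2 * n) where
  partner y := if h : (y : ℕ) % 2 = 0 then ⟨y + 1, by omega⟩ else ⟨y - 1, by omega⟩
  invol y := by
    apply Fin.ext
    by_cases h : (y : ℕ) % 2 = 0
    · simp [h, show ((y : ℕ) + 1) % 2 = 1 by omega]
    · simp [h, show ((y : ℕ) - 1) % 2 = 0 by omega]
      omega
  ne y := by rw [ne_eq, Fin.ext_iff]; split_ifs <;> simp <;> omega
  noncrossing y z h1 h2 := by
    rw [Fin.lt_def] at h1 h2
    split_ifs at h2 <;> simp at h2 <;> omega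

theorem flatDiagram_word (y : Fin (2 * n)) : (flatDiagram n).word y = decide ((y : ℕ) % 2 = 1) := by
  rw [ArcDiagram.word, decide_eq_decide, Fin.lt_def]
  simp only [flatDiagram]
  split_ifs <;> simp <;> omega

theorem eq_word_of_height {w : Fin (2 * n) → Bool}
    (h : ∀ k ≤ 2 * n, height w k = (k % 2 : ℕ)) : w = (flatDiagram n).word := by
  funext y
  have h1 := h y y.2.le
  have h2 := h (y + 1) y.2
  rw [height_succ, h1] at h2
  rw [flatDiagram_word]
  rcases Nat.mod_two_eq_zero_or_one y with h3 | h3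
  · rw [h3, show ((y : ℕ) + 1) % 2 = 1 by omega] at h2
    rw [h3]
    revert h2; cases w y <;> simp
  · rw [h3, show ((y : ℕ) + 1) % 2 = 0 by omega] at h2
    rw [h3]
    revert h2; cases w y <;> simp

theorem eq_word_of_compatible_flat {w : Fin (2 * n) → Bool} (hst : IsStandard 0 w)
    (hw : (flatDiagram n).Compatible w) : w = (flatDiagram n).word := by
  have hs := (isStandard_iff w).1 hst
  refine eq_word_of_height fun k hk => ?_
  have even : ∀ j ≤ n, height w (2 * j) = 0 := by
    intro j hj
    rw [ArcDiagram.Closed.height_eq (D := flatDiagram n) (a := 0) ?_ (Nat.zero_le _) (by omega) hw,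
      height_zero]
    rintro y ⟨-, hy⟩
    refine ⟨Nat.zero_le _, ?_⟩
    simp only [flatDiagram]
    split_ifs <;> simp <;> omega
  obtain ⟨j, rfl | rfl⟩ := Nat.even_or_odd' k
  · rw [even j (by omega)]; simp
  · have h1 := height_succ w ⟨2 * j, by omega⟩
    have h2 := hs.1 (2 * j + 1) hk
    simp only [even j (by omega)] at h1
    rw [h1] at h2 ⊢
    rw [show (2 * j + 1) % 2 = 1 by omega]
    split_ifs at h2 ⊢ <;> simp_all

/-- A standard word all of whose peaks are at height one is the flat one. -/
theorem eq_word_of_no_peak {w : Fin (2 * n) → Bool} (hst : IsStandard 0 w)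
    (h : ∀ i : Fin (2 * n - 1), w (lo i) = false → w (hi i) = true → height w i < 1) :
    w = (flatDiagram n).word := by
  have hs := (isStandard_iff w).1 hst
  obtain ⟨k, hk, hmax⟩ := Finset.exists_max_image (Finset.range (2 * n + 1)) (height w) ⟨0, by simp⟩
  have hle : ∀ l ≤ 2 * n, height w l ≤ 1 := by
    intro l hl
    refine (hmax l (by simp; omega)).trans ?_
    by_contra hgt
    have hk' : k ≤ 2 * n := by simp at hk; omega
    have hk0 : k ≠ 0 := by rintro rfl; rw [height_zero] at hgt; omega
    have hk1 : k ≠ 2 * n := by rintro rfl; rw [hs.2] at hgt; simp at hgt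
    obtain ⟨i, rfl⟩ : ∃ i, k = i + 1 := ⟨k - 1, by omega⟩
    have e1 := height_succ w ⟨i, by omega⟩
    have e2 := height_succ w ⟨i + 1, by omega⟩
    have m1 := hmax i (by simp; omega)
    have m2 := hmax (i + 1 + 1) (by simp; omega)
    simp only at e1 e2
    have a1 : w ⟨i, by omega⟩ = false := by
      cases e : w ⟨i, by omega⟩
      · rfl
      · rw [e] at e1; simp at e1; omega
    have a2 : w ⟨i + 1, by omega⟩ = true := by
      cases e : w ⟨i + 1, by omega⟩
      · rw [e] at e2; simp at e2; omega
      · rfl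
    have := h ⟨i, by omega⟩ a1 a2
    rw [a1] at e1
    simp at e1 this
    omega
  refine eq_word_of_height fun k hk => ?_
  induction k with
  | zero => simp [height_zero]
  | succ k ih =>
    have e := height_succ w ⟨k, hk⟩
    have b1 := hle (k + 1) hk
    have b2 := hs.1 (k + 1) hk
    simp only at e
    rw [ih (by omega)] at e
    rcases Nat.mod_two_eq_zero_or_one k with h3 | h3
    · rw [show (k + 1) % 2 = 1 by omega]
      rw [h3] at e
      split_ifs at e <;> simp at e <;> simp [e] at b2 ⊢
    · rw [show (k + 1) % 2 = 0 by omega]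
      rw [h3] at e
      split_ifs at e <;> simp at e <;> simp [e] at b1 ⊢

theorem posSum_lt_swapWord {m : ℕ} {i : Fin (m - 1)} {w : Fin m → Bool} (h1 : w (lo i) = false)
    (h2 : w (hi i) = true) : posSum w < posSum (swapWord i w) := by
  have : posSum (swapWord i w) =
      ∑ y, if w y = false then ((Equiv.swap (lo i) (hi i) y : Fin m) : ℕ) else 0 := by
    unfold posSum
    rw [← Equiv.sum_comp (Equiv.swap (lo i) (hi i))]
    simp [swapWord]
  rw [this]
  refine Finset.sum_lt_sum (fun y _ => ?_) ⟨lo i, Finset.mem_univ _, ?_⟩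
  · by_cases y1 : y = lo i
    · rw [y1, Equiv.swap_apply_left, if_pos h1, if_pos h1]; exact (lo_lt_hi i).le
    by_cases y2 : y = hi i
    · rw [y2, if_neg (by simp [h2]), if_neg (by simp [h2])]
    rw [Equiv.swap_apply_of_ne_of_ne y1 y2]
  · rw [if_pos h1, if_pos h1, Equiv.swap_apply_left]
    exact lo_lt_hi i

theorem posSum_le {m : ℕ} (w : Fin m → Bool) : posSum w ≤ ∑ y : Fin m, (y : ℕ) :=
  Finset.sum_le_sum fun y _ => by split_ifs <;> simp

theorem pathMap_flatDiagram : pathMap n A (Finsupp.single (flatDiagram n) 1) =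
    pathCoeff A (flatDiagram n) (flatDiagram n).word •
      tableauVec (2 * n) 0 (flatDiagram n).word := by
  classical
  refine ext_wordCoeff fun w hst => ?_
  rw [wordCoeff_pathMap_single _ hst, wordCoeff_smul, wordCoeff_tableauVec
    (flatDiagram n).isStandard_word]
  by_cases h : (flatDiagram n).word = w
  · rw [if_pos h, mul_one, h]
  · rw [if_neg h, mul_zero, pathCoeff, if_neg]
    exact fun hc => h (eq_word_of_compatible_flat hst hc).symm

/-- The vector of a path that is not flat is obtained from the one of a path with a lower peak. -/
theorem tableauVec_mem_range (hq : BraidRegular (2 * n) ((A : ℂ) ^ 4)) (N : ℕ) :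
    ∀ w : Fin (2 * n) → Bool, IsStandard 0 w → (∑ y : Fin (2 * n), (y : ℕ)) - posSum w = N →
      tableauVec (2 * n) 0 w ∈ LinearMap.range (pathMap n A) := by
  induction N using Nat.strong_induction_on with
  | _ N ih =>
    intro w hst hN
    by_cases h : ∀ i : Fin (2 * n - 1), w (lo i) = false → w (hi i) = true → height w i < 1
    · rw [eq_word_of_no_peak hst h]
      have h1 := pathCoeff_word_ne_zero hq (flatDiagram n)
      rw [← inv_smul_smul₀ h1 (tableauVec (2 * n) 0 (flatDiagram n).word), ← pathMap_flatDiagram]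
      exact Submodule.smul_mem _ _ (LinearMap.mem_range_self _ _)
    · push Not at h
      obtain ⟨i, h1, h2, h3⟩ := h
      have hn : 1 ≤ n := by have := i.2; omega
      have hne : w (lo i) ≠ w (hi i) := by rw [h1, h2]; simp
      have hst' : IsStandard 0 (swapWord i w) :=
        isStandard_swapWord i hst (by rw [h2, if_pos rfl]; omega)
      have hlt := posSum_lt_swapWord h1 h2
      have hmem := ih _ (by have := posSum_le (swapWord i w); omega) _ hst' rfl
      have hE : wenzlE (2 * n) 0 ((A : ℂ) ^ 4) i (tableauVec (2 * n) 0 (swapWord i w)) ∈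
          LinearMap.range (pathMap n A) := by
        obtain ⟨v, hv⟩ := hmem
        refine ⟨(loopValue A)⁻¹ • diagramE A i v, ?_⟩
        have := LinearMap.congr_fun (pathMap_diagramE hq i) v
        simp only [LinearMap.comp_apply, LinearMap.smul_apply] at this
        rw [map_smul, this, smul_smul, inv_mul_cancel₀ (loopValue_ne_zero hn hq), one_smul, hv]
      have hb : bCoeff ((A : ℂ) ^ 4) (swapWord i w) i ≠ 0 := by
        intro h0
        have h5 := height_add_one_le hst i hne
        have h4 := bCoeff_eq_offCoeff (A := A) (w := swapWord i w) (i := i)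
          (by rw [swapWord_lo, swapWord_hi]; exact hne.symm)
        rw [h0, mul_zero, height_swapWord i w i (by omega) (by omega)] at h4
        exact offCoeff_ne_zero hn hq _ h3 (by omega) h4.symm
      rw [wenzlE_tableauVec i hst', swapWord_swapWord] at hE
      have h6 := Submodule.sub_mem _ hE (Submodule.smul_mem _
        (aCoeff ((A : ℂ) ^ 4) (axial (swapWord i w) i)) hmem)
      rw [add_sub_cancel_left] at h6
      rw [← inv_smul_smul₀ hb (tableauVec (2 * n) 0 w)]
      exact Submodule.smul_mem _ _ h6

theorem pathMap_bijective (hq : BraidRegular (2 * n) ((A : ℂ) ^ 4)) :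
    Function.Bijective (pathMap n A) := by
  refine ⟨pathMap_injective hq, LinearMap.range_eq_top.1 (top_unique ?_)⟩
  intro v _
  induction v using Finsupp.induction_linear with
  | zero => exact zero_mem _
  | add u v hu hv => exact add_mem (hu trivial) (hv trivial)
  | single t z =>
    have := tableauVec_mem_range hq _ t.1 t.2 rfl
    rw [tableauVec, dif_pos t.2] at this
    have h2 := Submodule.smul_mem _ z this
    rwa [Finsupp.smul_single, smul_eq_mul, mul_one] at h2

/-- For regular values of `A⁴` the extension is equivalent to the Jones representation. -/
noncomputable def jonesExtEquiv (hq : BraidRegular (2 * n) ((A : ℂ) ^ 4)) :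
    (jonesExt (2 * n) A).Equiv (jonesRep (2 * n) 0 ((A : ℂ) ^ 4) hq) :=
  Representation.Equiv.mk (LinearEquiv.ofBijective (pathMap n A) (pathMap_bijective hq))
    (equiv_of_gen (pathMap n A) fun i => by
      rw [jonesExt_σ, jonesRep_σ, LinearMap.comp_add, LinearMap.comp_smul, pathMap_diagramE hq,
        LinearMap.smul_comp, smul_smul, LinearMap.sub_comp, LinearMap.smul_comp]
      have hA := A.ne_zero
      have : (A : ℂ)⁻¹ ^ 2 * loopValue A = -(1 + ((A : ℂ) ^ 4)⁻¹) := by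
        simp only [loopValue, Units.val_inv_eq_inv_val]
        field_simp
        ring
      rw [this]
      refine LinearMap.ext fun v => ?_
      simp only [LinearMap.add_apply, LinearMap.sub_apply, LinearMap.smul_apply,
        LinearMap.comp_apply, Module.End.one_apply]
      module)

end Bijectivity

/-! ### The number of arc diagrams -/

section Count

/-- Both sides are the dimensions of equivalent representations, for the regular value `A = 2`. -/
theorem card_arcDiagram (n : ℕ) : Nat.card (ArcDiagram (2 * n)) = Nat.card (Tableau (2 * n) 0) := by
  have hq : BraidRegular (2 * n) (((Units.mk0 2 two_ne_zero : ℂˣ) : ℂ) ^ 4) := by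
    refine ⟨by simp, fun l hl _ h => ?_⟩
    have h2 := congrArg norm h
    simp only [Units.val_mk0, norm_pow, Complex.norm_ofNat, norm_one] at h2
    have := one_lt_pow₀ (show (1 : ℝ) < 2 ^ 4 by norm_num) (show l ≠ 0 by omega)
    linarith
  have := (LinearEquiv.ofBijective _ (pathMap_bijective hq)).finrank_eq
  have f1 := Fintype.ofFinite (ArcDiagram (2 * n))
  have f2 := Fintype.ofFinite (Tableau (2 * n) 0)
  rw [Nat.card_eq_fintype_card, Nat.card_eq_fintype_card]
  simpa using this

/-- The standard word of a Dyck word. -/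
def dyckFun {m : ℕ} (p : DyckWord) (h : p.toList.length = m) (y : Fin m) : Bool :=
  decide (p.toList[(y : ℕ)]'(by omega) = DyckStep.D)

theorem cnt_dyckFun {m : ℕ} (p : DyckWord) (h : p.toList.length = m) (k : ℕ) (hk : k ≤ m) :
    cnt (dyckFun p h) true k = (p.toList.take k).count DyckStep.D ∧
    cnt (dyckFun p h) false k = (p.toList.take k).count DyckStep.U := by
  induction k with
  | zero => simp [cnt]
  | succ k ih =>
    have e1 := cnt_succ (dyckFun p h) true ⟨k, hk⟩
    have e2 := cnt_succ (dyckFun p h) false ⟨k, hk⟩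
    simp only at e1 e2
    rw [e1, e2, (ih (by omega)).1, (ih (by omega)).2, List.take_succ_eq_append_getElem (by omega),
      List.count_append, List.count_append]
    have h4 : dyckFun p h ⟨k, hk⟩ = decide (p.toList[k]'(by omega) = DyckStep.D) := rfl
    rw [h4]
    rcases DyckStep.dichotomy (p.toList[k]'(by omega)) with h3 | h3 <;> simp [h3]

/-- Dyck words give standard tableaux, which are as many as the arc diagrams. -/
theorem catalan_le_card_arcDiagram (n : ℕ) : catalan n ≤ Nat.card (ArcDiagram (2 * n)) := by
  rw [card_arcDiagram, ← DyckWord.card_dyckWord_semilength_eq_catalan, ← Nat.card_eq_fintype_card]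
  have hl : ∀ p : {p : DyckWord // p.semilength = n}, p.1.toList.length = 2 * n := fun p => by
    rw [← p.1.two_mul_semilength_eq_length, p.2]
  refine Nat.card_le_card_of_injective
    (fun p => (⟨dyckFun p.1 (hl p), ?_, ?_⟩ : Tableau (2 * n) 0)) ?_
  · intro k hk
    rw [(cnt_dyckFun _ _ k hk).1, (cnt_dyckFun _ _ k hk).2]
    exact p.1.count_D_le_count_U k
  · rw [(cnt_dyckFun _ _ _ le_rfl).1, (cnt_dyckFun _ _ _ le_rfl).2, add_zero,
      List.take_of_length_le (hl p).le, p.1.count_U_eq_count_D]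
  · intro p p' h
    have h1 : dyckFun p.1 (hl p) = dyckFun p'.1 (hl p') := congrArg Subtype.val h
    refine Subtype.ext (DyckWord.ext (List.ext_getElem ((hl p).trans (hl p').symm) ?_))
    intro k hk hk'
    have h2 := congrFun h1 ⟨k, by rw [← hl p]; exact hk⟩
    simp only [dyckFun, decide_eq_decide] at h2
    rcases DyckStep.dichotomy (p.1.toList[k]) with h3 | h3 <;>
    rcases DyckStep.dichotomy (p'.1.toList[k]) with h4 | h4 <;> simp_all

/-- The dimension of the primitive part of the middle exterior power is a Catalan number. -/
theorem catalan_add_choose (g : ℕ) (hg : 2 ≤ g) :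
    catalan (g + 1) + (2 * g).choose (g - 2) = (2 * g).choose g := by
  obtain ⟨k, rfl⟩ : ∃ k, g = k + 2 := ⟨g - 2, by omega⟩
  have h1 := succ_mul_catalan_eq_centralBinom (k + 2 + 1)
  rw [Nat.centralBinom_eq_two_mul_choose] at h1
  have s : 2 * (k + 2 + 1) = 2 * (k + 2) + 1 + 1 := by ring
  have a := Nat.choose_succ_succ (2 * (k + 2)) (k + 2)
  have b := Nat.choose_succ_succ (2 * (k + 2)) (k + 1)
  have b' := Nat.choose_succ_succ (2 * (k + 2)) k
  have c := Nat.choose_succ_succ (2 * (k + 2) + 1) (k + 2)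
  have c' := Nat.choose_succ_succ (2 * (k + 2) + 1) (k + 1)
  have d : (2 * (k + 2)).choose (k + 3) = (2 * (k + 2)).choose (k + 1) := by
    rw [← Nat.choose_symm_of_eq_add]; omega
  have f := Nat.choose_succ_right_eq (2 * (k + 2) + 1 + 1) (k + 2)
  rw [show k + 2 - 2 = k by omega]
  rw [s] at h1
  simp only [Nat.succ_eq_add_one, add_assoc, Nat.reduceAdd] at *
  rw [show 2 * (k + 2) + 2 - (k + 2) = k + 4 by omega] at f
  have h2 : (k + 4) * (catalan (k + 3) + (2 * (k + 2) + 2).choose (k + 2)) =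
      (k + 4) * (2 * (k + 2) + 2).choose (k + 3) := by
    rw [mul_add, h1, mul_comm (k + 4) (Nat.choose _ (k + 2)), ← f]; ring
  have h3 := Nat.eq_of_mul_eq_mul_left (by omega) h2
  omega

end Count

/-! ### The first homology of the surface -/

section Homology

variable {n : ℕ}

theorem prod_ofFn_addLeft {m : ℕ} (a : Fin m → ℂ) :
    (List.ofFn fun k => (Equiv.addLeft (a k) : Equiv.Perm ℂ)).prod = Equiv.addLeft (∑ k, a k) := by
  induction m with
  | zero => ext z; simp
  | succ m ih =>
    rw [List.ofFn_succ, List.prod_cons, ih, Fin.sum_univ_succ]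
    ext z
    simp

/-- The action of the orbifold group on `ℂ` in which the `j`-th generator acts as the point
reflection `z ↦ v j - z`. -/
def reflectionAction (v : ℕ → ℂ) (hv : ∑ k : Fin n, (v (2 * k) - v (2 * k + 1)) = 0) :
    OrbifoldGroup n →* Equiv.Perm ℂ :=
  OrbifoldGroup.lift (fun j => Equiv.subLeft (v j)) (fun j => by ext z; simp) (by
    rw [prod_pairs]
    have : (fun k : Fin n => (Equiv.subLeft (v (2 * k)) * Equiv.subLeft (v (2 * k + 1)) :
        Equiv.Perm ℂ)) = fun k : Fin n => Equiv.addLeft (v (2 * k) - v (2 * k + 1)) := by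
      funext k
      ext z
      simp; ring
    simp only [this]
    rw [prod_ofFn_addLeft, hv]
    ext z
    simp)

theorem reflectionAction_x (v : ℕ → ℂ) (hv : ∑ k : Fin n, (v (2 * k) - v (2 * k + 1)) = 0)
    (j : Fin (2 * n)) : reflectionAction v hv (x j) = Equiv.subLeft (v j) :=
  OrbifoldGroup.lift_x ..

/-- An element of the orbifold group acts as a translation or as a reflection, depending on the
sheet. -/
theorem reflectionAction_cases (v : ℕ → ℂ) (hv : ∑ k : Fin n, (v (2 * k) - v (2 * k + 1)) = 0)
    (g : OrbifoldGroup n) :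
    (sheet n g = 1 ∧ ∃ t, reflectionAction v hv g = Equiv.addLeft t) ∨
      (sheet n g = .ofAdd 1 ∧ ∃ t, reflectionAction v hv g = Equiv.subLeft t) := by
  have h11 : (Multiplicative.ofAdd 1 : Multiplicative (ZMod 2)) * .ofAdd 1 = 1 := by decide
  refine PresentedGroup.generated_by (rels := orbifoldRels n)
    { carrier := {g | (sheet n g = 1 ∧ ∃ t, reflectionAction v hv g = Equiv.addLeft t) ∨
        (sheet n g = .ofAdd 1 ∧ ∃ t, reflectionAction v hv g = Equiv.subLeft t)}
      one_mem' := Or.inl ⟨map_one _, 0, by ext z; simp⟩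
      mul_mem' := ?_
      inv_mem' := ?_ } (fun j => Or.inr ⟨sheet_x j, v j, reflectionAction_x v hv j⟩) g
  · rintro a b (⟨ha, s, hs⟩ | ⟨ha, s, hs⟩) (⟨hb, t, ht⟩ | ⟨hb, t, ht⟩)
    · exact Or.inl ⟨by rw [map_mul, ha, hb, one_mul], s + t, by
        rw [map_mul, hs, ht]; ext z; simp⟩
    · exact Or.inr ⟨by rw [map_mul, ha, hb, one_mul], s + t, by
        rw [map_mul, hs, ht]; ext z; simp [add_sub_assoc]⟩
    · exact Or.inr ⟨by rw [map_mul, ha, hb, mul_one], s - t, by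
        rw [map_mul, hs, ht]; ext z; simp; ring⟩
    · exact Or.inl ⟨by rw [map_mul, ha, hb, h11], s - t, by
        rw [map_mul, hs, ht]; ext z; simp; ring⟩
  · rintro a (⟨ha, s, hs⟩ | ⟨ha, s, hs⟩)
    · exact Or.inl ⟨by rw [map_inv, ha, inv_one], -s, by
        rw [map_inv, hs, inv_eq_iff_mul_eq_one]; ext z; simp⟩
    · exact Or.inr ⟨by rw [map_inv, ha]; decide, s, by
        rw [map_inv, hs, inv_eq_iff_mul_eq_one]; ext z; simp⟩

/-- The homomorphism from the surface group to `ℂ` given by the translation part of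
`reflectionAction`. -/
def translationHom (v : ℕ → ℂ) (hv : ∑ k : Fin n, (v (2 * k) - v (2 * k + 1)) = 0) :
    SurfaceGroup n →* Multiplicative ℂ where
  toFun g := .ofAdd (reflectionAction v hv (g : OrbifoldGroup n) 0)
  map_one' := by simp
  map_mul' g h := by
    rcases reflectionAction_cases v hv (g : OrbifoldGroup n) with ⟨-, t, ht⟩ | ⟨h0, -⟩
    · rw [Subgroup.coe_mul, map_mul, Equiv.Perm.mul_apply, ht, ← ofAdd_add]
      simp
    · have h1 : sheet n (g : OrbifoldGroup n) = 1 := g.2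
      rw [h1] at h0
      exact absurd h0 (by decide)

/-- There are linear functionals on the homology with arbitrary values on the curves of the chain,
subject to the relation `c_1 + c_3 + ⋯ + c_{2g+1} = 0`. -/
theorem exists_functional (n : ℕ) (d : ℕ → ℂ) (hd : ∑ k ∈ Finset.range n, d (2 * k) = 0) :
    ∃ φ : H1 n →ₗ[ℂ] ℂ, ∀ k < 2 * n - 1, φ (chainClass n k) = d k := by
  set v : ℕ → ℂ := fun j => -∑ k ∈ Finset.range j, d k with hvdef
  have hv1 : ∀ j, v j - v (j + 1) = d j := fun j => by
    simp only [hvdef, Finset.sum_range_succ]; ring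
  have hv : ∑ k : Fin n, (v (2 * k) - v (2 * k + 1)) = 0 := by
    simp only [hv1]
    rw [← hd, Finset.sum_range]
  refine ⟨LinearMap.liftBaseChange ℂ
    (MonoidHom.toAdditiveLeft (Abelianization.lift (translationHom v hv))).toIntLinearMap, ?_⟩
  intro k hk
  rw [chainClass, dif_pos hk, cls, LinearMap.liftBaseChange_tmul, one_smul]
  change reflectionAction v hv (x (lo ⟨k, hk⟩) * x (hi ⟨k, hk⟩)) 0 = d k
  rw [map_mul, reflectionAction_x, reflectionAction_x, ← hv1]
  simp [lo, hi]

/-- The subgroup of the orbifold group generated by the curves of the chain. -/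
def chainSubgroup (n : ℕ) : Subgroup (OrbifoldGroup n) :=
  Subgroup.closure (Set.range fun i : Fin (2 * n - 1) => x (lo i) * x (hi i))

theorem x_mul_x_mem (j k : Fin (2 * n)) : x j * x k ∈ chainSubgroup n := by
  have up : ∀ (d : ℕ) (j k : Fin (2 * n)), (k : ℕ) = j + d → x j * x k ∈ chainSubgroup n := by
    intro d
    induction d with
    | zero =>
      intro j k h
      obtain rfl : k = j := Fin.ext h
      rw [x_mul_self]; exact one_mem _
    | succ d ih =>
      intro j k h
      have h1 := ih j ⟨j + d, by omega⟩ rfl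
      have h2 : x (lo ⟨j + d, by omega⟩) * x (hi ⟨j + d, by omega⟩) ∈ chainSubgroup n :=
        Subgroup.subset_closure ⟨_, rfl⟩
      have h3 : x j * x k = x j * x ⟨j + d, by omega⟩ *
          (x (lo ⟨j + d, by omega⟩) * x (hi ⟨j + d, by omega⟩)) := by
        rw [mul_assoc, show lo (⟨j + d, by omega⟩ : Fin (2 * n - 1)) = ⟨j + d, by omega⟩ from rfl,
          ← mul_assoc (x (⟨j + d, by omega⟩ : Fin (2 * n))), x_mul_self, one_mul,
          show hi (⟨j + d, by omega⟩ : Fin (2 * n - 1)) = k from Fin.ext (by simp [hi]; omega)]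
      rw [h3]
      exact mul_mem h1 h2
  rcases le_total (j : ℕ) k with h | h
  · exact up (k - j) j k (by omega)
  · have := inv_mem (up (j - k) k j (by omega))
    rwa [mul_inv_rev, x_inv, x_inv] at this

theorem conj_x_mem (j : Fin (2 * n)) {g : OrbifoldGroup n} (hg : g ∈ chainSubgroup n) :
    x j * g * x j ∈ chainSubgroup n := by
  induction hg using Subgroup.closure_induction with
  | mem g hg =>
    obtain ⟨i, rfl⟩ := hg
    have := mul_mem (x_mul_x_mem j (lo i)) (x_mul_x_mem (hi i) j)
    simpa only [mul_assoc] using this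
  | one => rw [mul_one, x_mul_self]; exact one_mem _
  | mul a b _ _ ha hb =>
    have e : x j * (a * b) * x j = x j * a * x j * (x j * b * x j) := by
      simp only [mul_assoc]
      rw [← mul_assoc (x j) (x j), x_mul_self, one_mul]
    rw [e]; exact mul_mem ha hb
  | inv a _ ha =>
    have := inv_mem ha
    rwa [mul_inv_rev, mul_inv_rev, x_inv, ← mul_assoc] at this

/-- The curves of the chain generate the surface group, the kernel of `sheet`: the elements of the
kernel lie in `chainSubgroup`, and the others do so after multiplication by the first reflection.
-/
theorem mem_chainSubgroup (hn : 1 ≤ n) (g : OrbifoldGroup n) :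
    (sheet n g = 1 ∧ g ∈ chainSubgroup n) ∨
      (sheet n g = .ofAdd 1 ∧ g * x ⟨0, by omega⟩ ∈ chainSubgroup n) := by
  have h11 : (Multiplicative.ofAdd 1 : Multiplicative (ZMod 2)) * .ofAdd 1 = 1 := by decide
  set y : OrbifoldGroup n := x ⟨0, by omega⟩ with hy
  have hyy : y * y = 1 := x_mul_self _
  have hleft : ∀ g, g * y ∈ chainSubgroup n → y * g ∈ chainSubgroup n := fun g hg => by
    have := conj_x_mem ⟨0, by omega⟩ hg
    rwa [← hy, mul_assoc, mul_assoc, hyy, mul_one] at this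
  refine PresentedGroup.generated_by (rels := orbifoldRels n)
    { carrier := {g | (sheet n g = 1 ∧ g ∈ chainSubgroup n) ∨
        (sheet n g = .ofAdd 1 ∧ g * y ∈ chainSubgroup n)}
      one_mem' := Or.inl ⟨map_one _, one_mem _⟩
      mul_mem' := ?_
      inv_mem' := ?_ } (fun j => Or.inr ⟨sheet_x j, x_mul_x_mem _ _⟩) g
  · rintro a b (⟨ha, ha'⟩ | ⟨ha, ha'⟩) (⟨hb, hb'⟩ | ⟨hb, hb'⟩)
    · exact Or.inl ⟨by rw [map_mul, ha, hb, one_mul], mul_mem ha' hb'⟩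
    · exact Or.inr ⟨by rw [map_mul, ha, hb, one_mul], by rw [mul_assoc]; exact mul_mem ha' hb'⟩
    · refine Or.inr ⟨by rw [map_mul, ha, hb, mul_one], ?_⟩
      have := mul_mem ha' (conj_x_mem ⟨0, by omega⟩ hb')
      rwa [← hy, mul_assoc, ← mul_assoc y, ← mul_assoc y, hyy, one_mul, ← mul_assoc] at this
    · refine Or.inl ⟨by rw [map_mul, ha, hb, h11], ?_⟩
      have := mul_mem ha' (hleft b hb')
      rwa [mul_assoc, ← mul_assoc y, hyy, one_mul] at this
  · rintro a (⟨ha, ha'⟩ | ⟨ha, ha'⟩)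
    · exact Or.inl ⟨by rw [map_inv, ha, inv_one], inv_mem ha'⟩
    · refine Or.inr ⟨by rw [map_inv, ha]; decide, ?_⟩
      have := inv_mem (hleft a ha')
      rwa [mul_inv_rev, hy, x_inv] at this

theorem cls_mem_span (hn : 1 ≤ n) (g : SurfaceGroup n) :
    cls g ∈ Submodule.span ℂ (Set.range fun k : Fin (2 * n - 1) => chainClass n k) := by
  set W := Submodule.span ℂ (Set.range fun k : Fin (2 * n - 1) => chainClass n k)
  let S : Subgroup (SurfaceGroup n) :=
    { carrier := {g | cls g ∈ W}
      one_mem' := by change cls 1 ∈ W; rw [cls_one]; exact zero_mem _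
      mul_mem' := fun {a b} ha hb => by
        change cls (a * b) ∈ W; rw [cls_mul]; exact add_mem ha hb
      inv_mem' := fun {a} ha => by
        change cls a⁻¹ ∈ W; rw [cls_inv]; exact neg_mem ha }
  have hle : chainSubgroup n ≤ S.map (SurfaceGroup n).subtype := by
    rw [chainSubgroup, Subgroup.closure_le]
    rintro _ ⟨i, rfl⟩
    refine ⟨chain i, ?_, rfl⟩
    refine Submodule.subset_span ⟨i, ?_⟩
    simp [chainClass]
  rcases mem_chainSubgroup hn (g : OrbifoldGroup n) with ⟨-, h⟩ | ⟨h, -⟩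
  · obtain ⟨g', hg', e⟩ := hle h
    obtain rfl : g' = g := Subtype.ext e
    exact hg'
  · have h1 : sheet n (g : OrbifoldGroup n) = 1 := g.2
    rw [h1] at h
    exact absurd h (by decide)

theorem linearMap_ext_chainClass {V : Type*} [AddCommGroup V] [Module ℂ V] (hn : 1 ≤ n)
    {f f' : H1 n →ₗ[ℂ] V} (h : ∀ k < 2 * n - 1, f (chainClass n k) = f' (chainClass n k)) :
    f = f' := by
  have hcls : ∀ g, f (cls g) = f' (cls g) := fun g =>
    LinearMap.eqOn_span (s := Set.range fun k : Fin (2 * n - 1) => chainClass n k)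
      (by rintro _ ⟨k, rfl⟩; exact h k k.2) (cls_mem_span hn g)
  refine TensorProduct.AlgebraTensorModule.curry_injective (LinearMap.ext_ring ?_)
  ext a
  obtain ⟨g, hg⟩ := QuotientGroup.mk_surjective a.toMul
  obtain rfl : a = Additive.ofMul (Abelianization.of g) := congrArg Additive.ofMul hg.symm
  exact hcls g

theorem span_chainClass (hn : 1 ≤ n) :
    Submodule.span ℂ (Set.range fun k : Fin (2 * n - 1) => chainClass n k) = ⊤ := by
  set S := Submodule.span ℂ (Set.range fun k : Fin (2 * n - 1) => chainClass n k) with hS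
  have : S.mkQ = 0 := linearMap_ext_chainClass hn fun k hk => by
    rw [LinearMap.zero_apply, Submodule.mkQ_apply, Submodule.Quotient.mk_eq_zero]
    exact Submodule.subset_span ⟨⟨k, hk⟩, rfl⟩
  rw [← Submodule.ker_mkQ S, this, LinearMap.ker_zero]

/-- The functionals dual to the first `2g` curves of the chain. -/
theorem exists_dualChain (n k : ℕ) (hk : k < 2 * n - 2) :
    ∃ φ : H1 n →ₗ[ℂ] ℂ, ∀ l < 2 * n - 2, φ (chainClass n l) = if k = l then 1 else 0 := by
  obtain ⟨φ, hφ⟩ := exists_functional n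
    (fun l => (if k = l then 1 else 0) - if k % 2 = 0 ∧ l = 2 * n - 2 then 1 else 0) (by
      rw [Finset.sum_sub_distrib, sub_eq_zero]
      by_cases h : k % 2 = 0
      · rw [Finset.sum_eq_single (k / 2), Finset.sum_eq_single (n - 1), if_pos (by omega),
          if_pos (by omega)]
        · intro j _ hj; rw [if_neg (by omega)]
        · intro hj; simp at hj; omega
        · intro j _ hj; rw [if_neg (by omega)]
        · intro hj; simp at hj; omega
      · rw [Finset.sum_eq_zero, Finset.sum_eq_zero]
        · intro j _; rw [if_neg (by omega)]
        · intro j _; rw [if_neg (by omega)])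
  exact ⟨φ, fun l hl => by rw [hφ l (by omega), if_neg (c := _ ∧ _) (by omega), sub_zero]⟩

theorem linearIndependent_chainClass (n : ℕ) :
    LinearIndependent ℂ (fun k : Fin (2 * n - 2) => chainClass n k) := by
  choose φ hφ using fun k : Fin (2 * n - 2) => exists_dualChain n k k.2
  refine linearIndependent_of_triangular _ φ (fun _ => 0) (fun k => ?_) fun k l h => ?_
  · rw [hφ k k k.2]; simp
  · rw [hφ k l l.2] at h
    left
    by_contra hne
    rw [if_neg (fun e => hne (Fin.ext e))] at h
    exact h rfl

theorem span_chainClass_top (hn : 1 ≤ n) :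
    ⊤ ≤ Submodule.span ℂ (Set.range fun k : Fin (2 * n - 2) => chainClass n k) := by
  rw [← span_chainClass hn, Submodule.span_le]
  rintro _ ⟨k, rfl⟩
  by_cases hk : (k : ℕ) < 2 * n - 2
  · exact Submodule.subset_span ⟨⟨k, hk⟩, rfl⟩
  · have h := aCycle_top n
    obtain ⟨m, rfl⟩ : ∃ m, n = m + 1 := ⟨n - 1, by omega⟩
    rw [aCycle, Finset.sum_range_succ, add_eq_zero_iff_neg_eq] at h
    have e : (k : ℕ) = 2 * m := by omega
    simp only [e, SetLike.mem_coe]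
    rw [← h]
    refine neg_mem (sum_mem fun j hj => Submodule.subset_span ⟨⟨2 * j, ?_⟩, rfl⟩)
    rw [Finset.mem_range] at hj
    omega

/-- The basis of the homology consisting of the first `2g` curves of the chain. -/
noncomputable def chainBasis (hn : 1 ≤ n) : Module.Basis (Fin (2 * n - 2)) ℂ (H1 n) :=
  Module.Basis.mk (linearIndependent_chainClass n) (span_chainClass_top hn)

theorem finite_H1 (hn : 1 ≤ n) : Module.Finite ℂ (H1 n) := Module.Finite.of_basis (chainBasis hn)

theorem finrank_H1 (hn : 1 ≤ n) : Module.finrank ℂ (H1 n) = 2 * n - 2 := by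
  rw [Module.finrank_eq_card_basis (chainBasis hn), Fintype.card_fin]

end Homology

/-! ### Contraction with a symplectic form -/

section Contraction

variable {M : Type*} [AddCommGroup M] [Module ℂ M]

/-- The contraction of an element of the exterior algebra with a functional. -/
noncomputable def contr (φ : M →ₗ[ℂ] ℂ) : ExteriorAlgebra ℂ M →ₗ[ℂ] ExteriorAlgebra ℂ M :=
  CliffordAlgebra.contractLeft (Q := (0 : QuadraticForm ℂ M)) φ

theorem contr_ι_mul (φ : M →ₗ[ℂ] ℂ) (u : M) (z : ExteriorAlgebra ℂ M) :
    contr φ (ExteriorAlgebra.ι ℂ u * z) = φ u • z - ExteriorAlgebra.ι ℂ u * contr φ z :=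
  CliffordAlgebra.contractLeft_ι_mul (Q := 0) (d := φ) u z

theorem contr_one (φ : M →ₗ[ℂ] ℂ) : contr φ 1 = 0 := CliffordAlgebra.contractLeft_one ..

theorem ι_mul_ι_comm (u v : M) : ExteriorAlgebra.ι ℂ u * ExteriorAlgebra.ι ℂ v =
    -(ExteriorAlgebra.ι ℂ v * ExteriorAlgebra.ι ℂ u) :=
  eq_neg_of_add_eq_zero_left (ExteriorAlgebra.ι_add_mul_swap u v)

theorem ι_mul_mem {k : ℕ} (u : M) {z : ExteriorAlgebra ℂ M} (hz : z ∈ ⋀[ℂ]^k M) :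
    ExteriorAlgebra.ι ℂ u * z ∈ ⋀[ℂ]^(k + 1) M := by
  rw [ExteriorAlgebra.exteriorPower, pow_succ']
  exact Submodule.mul_mem_mul (LinearMap.mem_range_self _ u) hz

/-- Induction on the degree for homogeneous elements of the exterior algebra. -/
theorem exteriorPower_induction {C : (k : ℕ) → ExteriorAlgebra ℂ M → Prop} (h0 : C 0 1)
    (hadd : ∀ k y z, C k y → C k z → C k (y + z)) (hsmul : ∀ k (c : ℂ) z, C k z → C k (c • z))
    (hmul : ∀ k u z, z ∈ ⋀[ℂ]^k M → C k z → C (k + 1) (ExteriorAlgebra.ι ℂ u * z)) (k : ℕ) :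
    ∀ z ∈ ⋀[ℂ]^k M, C k z := by
  induction k with
  | zero =>
    intro z hz
    rw [ExteriorAlgebra.exteriorPower, pow_zero] at hz
    obtain ⟨c, rfl⟩ := Submodule.mem_one.1 hz
    rw [Algebra.algebraMap_eq_smul_one]
    exact hsmul _ _ _ h0
  | succ k ih =>
    intro z hz
    rw [ExteriorAlgebra.exteriorPower, pow_succ'] at hz
    refine Submodule.mul_induction_on hz ?_ (hadd _)
    rintro _ ⟨u, rfl⟩ y hy
    exact hmul k u y hy (ih y hy)

theorem contr_mem (φ : M →ₗ[ℂ] ℂ) (k : ℕ) (z : ExteriorAlgebra ℂ M) (hz : z ∈ ⋀[ℂ]^k M) :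
    (k = 0 → contr φ z = 0) ∧ ∀ l, k = l + 1 → contr φ z ∈ ⋀[ℂ]^l M := by
  refine exteriorPower_induction (C := fun k z => (k = 0 → contr φ z = 0) ∧
    ∀ l, k = l + 1 → contr φ z ∈ ⋀[ℂ]^l M) ?_ ?_ ?_ ?_ k z hz
  · exact ⟨fun _ => contr_one φ, fun l hl => by omega⟩
  · rintro k y z ⟨h1, h2⟩ ⟨h3, h4⟩
    exact ⟨fun hk => by rw [map_add, h1 hk, h3 hk, add_zero],
      fun l hl => by rw [map_add]; exact add_mem (h2 l hl) (h4 l hl)⟩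
  · rintro k c z ⟨h1, h2⟩
    exact ⟨fun hk => by rw [map_smul, h1 hk, smul_zero],
      fun l hl => by rw [map_smul]; exact Submodule.smul_mem _ _ (h2 l hl)⟩
  · rintro k u z hz ⟨h1, h2⟩
    refine ⟨fun hk => by omega, fun l hl => ?_⟩
    obtain rfl : k = l := by omega
    rw [contr_ι_mul]
    refine sub_mem (Submodule.smul_mem _ _ hz) ?_
    cases k with
    | zero => rw [h1 rfl, mul_zero]; exact zero_mem _
    | succ k => exact ι_mul_mem u (h2 k rfl)

/-- A symplectic basis `a_j, b_j` of `M` (`j < g`), together with the dual basis `α_j, β_j`. -/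
structure SymplecticData (M : Type*) [AddCommGroup M] [Module ℂ M] (g : ℕ) where
  (a b : ℕ → M)
  (α β : ℕ → M →ₗ[ℂ] ℂ)
  α_a : ∀ j < g, ∀ k < g, α j (a k) = if j = k then 1 else 0
  α_b : ∀ j < g, ∀ k < g, α j (b k) = 0
  β_a : ∀ j < g, ∀ k < g, β j (a k) = 0
  β_b : ∀ j < g, ∀ k < g, β j (b k) = if j = k then 1 else 0
  sum_eq : ∀ u, ∑ j ∈ Finset.range g, (α j u • a j + β j u • b j) = u

namespace SymplecticData

variable {g : ℕ} (S : SymplecticData M g)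

/-- The bivector `∑ a_j ∧ b_j`. -/
noncomputable def bivector : ExteriorAlgebra ℂ M :=
  ∑ j ∈ Finset.range g, ExteriorAlgebra.ι ℂ (S.a j) * ExteriorAlgebra.ι ℂ (S.b j)

/-- Contraction with the symplectic form. -/
noncomputable def contraction : ExteriorAlgebra ℂ M →ₗ[ℂ] ExteriorAlgebra ℂ M :=
  ∑ j ∈ Finset.range g, contr (S.β j) ∘ₗ contr (S.α j)

/-- The functional `⟨u, ·⟩`. -/
noncomputable def pairing (u : M) : M →ₗ[ℂ] ℂ :=
  ∑ j ∈ Finset.range g, (S.α j u • S.β j - S.β j u • S.α j)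

theorem contr_pairing (u : M) (z : ExteriorAlgebra ℂ M) : contr (S.pairing u) z =
    ∑ j ∈ Finset.range g, (S.α j u • contr (S.β j) z - S.β j u • contr (S.α j) z) := by
  simp only [contr, pairing, map_sum, map_sub, map_smul, LinearMap.sum_apply, LinearMap.sub_apply,
    LinearMap.smul_apply]

theorem contraction_ι_mul (u : M) (z : ExteriorAlgebra ℂ M) :
    S.contraction (ExteriorAlgebra.ι ℂ u * z) =
      ExteriorAlgebra.ι ℂ u * S.contraction z + contr (S.pairing u) z := by
  rw [contr_pairing]
  simp only [contraction, LinearMap.sum_apply, LinearMap.comp_apply, Finset.mul_sum,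
    ← Finset.sum_add_distrib]
  refine Finset.sum_congr rfl fun j _ => ?_
  rw [contr_ι_mul, map_sub, map_smul, contr_ι_mul]
  abel

theorem pairing_a (k : ℕ) (hk : k < g) : S.pairing (S.a k) = S.β k := by
  rw [pairing, Finset.sum_eq_single k]
  · rw [S.α_a k hk k hk, S.β_a k hk k hk]; simp
  · intro j hj hjk
    rw [Finset.mem_range] at hj
    rw [S.α_a j hj k hk, S.β_a j hj k hk, if_neg hjk]; simp
  · intro h; exact absurd (Finset.mem_range.2 hk) h

theorem pairing_b (k : ℕ) (hk : k < g) : S.pairing (S.b k) = -S.α k := by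
  rw [pairing, Finset.sum_eq_single k]
  · rw [S.α_b k hk k hk, S.β_b k hk k hk]; simp
  · intro j hj hjk
    rw [Finset.mem_range] at hj
    rw [S.α_b j hj k hk, S.β_b j hj k hk, if_neg hjk]; simp
  · intro h; exact absurd (Finset.mem_range.2 hk) h

/-- Euler's formula: the number operator acts on `Λ^k` as multiplication by `k`. -/
theorem number_eq (k : ℕ) (z : ExteriorAlgebra ℂ M) (hz : z ∈ ⋀[ℂ]^k M) :
    ∑ j ∈ Finset.range g, (ExteriorAlgebra.ι ℂ (S.a j) * contr (S.α j) z +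
      ExteriorAlgebra.ι ℂ (S.b j) * contr (S.β j) z) = (k : ℂ) • z := by
  refine exteriorPower_induction (C := fun k z => ∑ j ∈ Finset.range g,
    (ExteriorAlgebra.ι ℂ (S.a j) * contr (S.α j) z +
      ExteriorAlgebra.ι ℂ (S.b j) * contr (S.β j) z) = (k : ℂ) • z) ?_ ?_ ?_ ?_ k z hz
  · simp [contr_one]
  · intro k y z hy hz
    rw [smul_add, ← hy, ← hz, ← Finset.sum_add_distrib]
    refine Finset.sum_congr rfl fun j _ => ?_
    simp only [map_add, mul_add]; abel
  · intro k c z hz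
    rw [smul_comm, ← hz, Finset.smul_sum]
    refine Finset.sum_congr rfl fun j _ => ?_
    simp only [map_smul, mul_smul_comm, smul_add]
  · intro k u z _ hz
    have e : ∀ j, ExteriorAlgebra.ι ℂ (S.a j) * contr (S.α j) (ExteriorAlgebra.ι ℂ u * z) +
        ExteriorAlgebra.ι ℂ (S.b j) * contr (S.β j) (ExteriorAlgebra.ι ℂ u * z) =
        ExteriorAlgebra.ι ℂ (S.α j u • S.a j + S.β j u • S.b j) * z +
        ExteriorAlgebra.ι ℂ u * (ExteriorAlgebra.ι ℂ (S.a j) * contr (S.α j) z +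
          ExteriorAlgebra.ι ℂ (S.b j) * contr (S.β j) z) := by
      intro j
      rw [contr_ι_mul, contr_ι_mul, mul_sub, mul_sub, ← mul_assoc, ← mul_assoc,
        ι_mul_ι_comm (S.a j) u, ι_mul_ι_comm (S.b j) u]
      simp only [map_add, map_smul, add_mul, mul_add, smul_mul_assoc, mul_smul_comm, neg_mul,
        mul_assoc]
      abel
    simp only [e]
    rw [Finset.sum_add_distrib, ← Finset.sum_mul, ← Finset.mul_sum, ← map_sum, S.sum_eq, hz]
    push_cast
    rw [add_smul, one_smul, mul_smul_comm, add_comm]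

/-- The commutator of contraction and multiplication by the bivector. -/
theorem contraction_bivector_mul (k : ℕ) (z : ExteriorAlgebra ℂ M) (hz : z ∈ ⋀[ℂ]^k M) :
    S.contraction (S.bivector * z) = S.bivector * S.contraction z + ((g : ℂ) - k) • z := by
  have e : ∀ j ∈ Finset.range g,
      S.contraction (ExteriorAlgebra.ι ℂ (S.a j) * ExteriorAlgebra.ι ℂ (S.b j) * z) =
      ExteriorAlgebra.ι ℂ (S.a j) * ExteriorAlgebra.ι ℂ (S.b j) * S.contraction z + z -
        (ExteriorAlgebra.ι ℂ (S.a j) * contr (S.α j) z +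
          ExteriorAlgebra.ι ℂ (S.b j) * contr (S.β j) z) := by
    intro j hj
    rw [Finset.mem_range] at hj
    rw [mul_assoc, contraction_ι_mul, contraction_ι_mul, S.pairing_a j hj, S.pairing_b j hj,
      contr_ι_mul, S.β_b j hj j hj, if_pos rfl, one_smul, mul_add, mul_assoc]
    simp only [contr, map_neg, LinearMap.neg_apply]
    rw [mul_neg]
    abel
  rw [bivector, Finset.sum_mul, map_sum, Finset.sum_congr rfl e, Finset.sum_sub_distrib,
    Finset.sum_add_distrib, S.number_eq k z hz, Finset.sum_mul, Finset.sum_const,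
    Finset.card_range, sub_smul, ← Nat.cast_smul_eq_nsmul ℂ]
  abel

theorem contraction_mem (k : ℕ) {z : ExteriorAlgebra ℂ M} (hz : z ∈ ⋀[ℂ]^(k + 2) M) :
    S.contraction z ∈ ⋀[ℂ]^k M := by
  rw [contraction, LinearMap.sum_apply]
  exact sum_mem fun j _ => (contr_mem _ _ _ ((contr_mem _ _ _ hz).2 _ rfl)).2 _ rfl

theorem contraction_eq_zero {k : ℕ} (hk : k < 2) {z : ExteriorAlgebra ℂ M} (hz : z ∈ ⋀[ℂ]^k M) :
    S.contraction z = 0 := by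
  rw [contraction, LinearMap.sum_apply]
  refine Finset.sum_eq_zero fun j _ => ?_
  rw [LinearMap.comp_apply]
  interval_cases k
  · rw [(contr_mem _ _ _ hz).1 rfl, map_zero]
  · exact (contr_mem _ _ _ ((contr_mem _ _ _ hz).2 0 rfl)).1 rfl

/-- Below the middle degree, the operator `Λ L + t` with `t ≥ 0` is injective, where `L` is
multiplication by the bivector and `Λ` the contraction. -/
theorem eq_zero_of_contraction_bivector (k : ℕ) : ∀ (t : ℕ) (z : ExteriorAlgebra ℂ M), k < g →
    z ∈ ⋀[ℂ]^k M → S.contraction (S.bivector * z) + (t : ℂ) • z = 0 → z = 0 := by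
  induction k using Nat.strong_induction_on with
  | _ k ih =>
    intro t z hk hz h
    have hc : ((g - k + t : ℕ) : ℂ) = (g : ℂ) - k + t := by push_cast [hk.le]; ring
    have h1 : S.bivector * S.contraction z + ((g - k + t : ℕ) : ℂ) • z = 0 := by
      rw [← h, S.contraction_bivector_mul k z hz, hc]
      module
    have h2 : S.contraction z = 0 := by
      rcases lt_or_ge k 2 with hk2 | hk2
      · exact S.contraction_eq_zero hk2 hz
      · obtain ⟨l, rfl⟩ : ∃ l, k = l + 2 := ⟨k - 2, by omega⟩
        refine ih l (by omega) (g - (l + 2) + t) _ (by omega) (S.contraction_mem l hz) ?_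
        have := congrArg S.contraction h1
        rwa [map_add, map_smul, map_zero] at this
    rw [h2, mul_zero, zero_add] at h1
    refine (smul_eq_zero.1 h1).resolve_left ?_
    exact Nat.cast_ne_zero.2 (by omega)

theorem eq_zero_of_bivector_mul {k : ℕ} (hk : k < g) {z : ExteriorAlgebra ℂ M} (hz : z ∈ ⋀[ℂ]^k M)
    (h : S.contraction (S.bivector * z) = 0) : z = 0 :=
  S.eq_zero_of_contraction_bivector k 0 z hk hz (by rw [h]; simp)

/-- The contraction of a product of vectors of an isotropic subspace vanishes. -/
theorem contraction_prod_eq_zero (l : List M) (hl : ∀ u ∈ l, ∀ v ∈ l, S.pairing u v = 0) :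
    S.contraction (l.map (ExteriorAlgebra.ι ℂ)).prod = 0 := by
  have key : ∀ (φ : M →ₗ[ℂ] ℂ) (l : List M), (∀ u ∈ l, φ u = 0) →
      contr φ (l.map (ExteriorAlgebra.ι ℂ)).prod = 0 := by
    intro φ l hl
    induction l with
    | nil => simp [contr_one]
    | cons u l ih =>
      rw [List.map_cons, List.prod_cons, contr_ι_mul, hl u (by simp),
        ih fun v hv => hl v (by simp [hv])]
      simp
  induction l with
  | nil => exact S.contraction_eq_zero (k := 0) (by omega) (by simp)
  | cons u l ih =>
    rw [List.map_cons, List.prod_cons, contraction_ι_mul,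
      ih fun v hv w hw => hl v (by simp [hv]) w (by simp [hw]),
      key _ _ fun v hv => hl u (by simp) v (by simp [hv])]
    simp

end SymplecticData

end Contraction

/-! ### Wedges of arcs -/

section Wedges

/-- The ordered product `G a * G (a + 1) * ⋯ * G (b - 1)`. -/
def seg {R : Type*} [Monoid R] (G : ℕ → R) (a b : ℕ) : R := ((List.range' a (b - a)).map G).prod

section Seg

variable {R : Type*} [Monoid R] {G G' : ℕ → R}

theorem seg_mul {a b c : ℕ} (hab : a ≤ b) (hbc : b ≤ c) : seg G a b * seg G b c = seg G a c := by
  have := List.range'_append (s := a) (m := b - a) (n := c - b) (step := 1)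
  rw [one_mul, show a + (b - a) = b by omega, show b - a + (c - b) = c - a by omega] at this
  rw [seg, seg, seg, ← this, List.map_append, List.prod_append]

theorem seg_succ (a : ℕ) : seg G a (a + 1) = G a := by simp [seg]

theorem seg_self (a : ℕ) : seg G a a = 1 := by simp [seg]

theorem seg_congr {a b : ℕ} (h : ∀ x, a ≤ x → x < b → G x = G' x) : seg G a b = seg G' a b := by
  unfold seg
  congr 1
  refine List.map_congr_left fun x hx => ?_
  rw [List.mem_range'_1] at hx
  exact h x hx.1 (by omega)

theorem map_seg {R' : Type*} [Monoid R'] (f : R →* R') (a b : ℕ) :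
    f (seg G a b) = seg (fun x => f (G x)) a b := by
  rw [seg, seg, map_list_prod, List.map_map]; rfl

theorem seg_split {a b : ℕ} (c : ℕ) (hac : a ≤ c) (hcb : c < b) :
    seg G a b = seg G a c * (G c * seg G (c + 1) b) := by
  rw [← seg_succ (G := G) c, seg_mul (by omega) (by omega), seg_mul hac (by omega)]

end Seg

section Fermions

variable {R : Type*} [Ring R] [Algebra ℂ R] (κ : ℂ) (S₁ S₂ S₃ S₄ a b u d a' b' : R) (p q t s s' : ℂ)

/-- The identity behind `map_fullWedge` for two neighbouring points of which the first is
connected to the left and the second to the right. Here `a`, `b` are the arcs at the two points,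
`a'`, `b'` their images, `u` and `d` the two arcs replacing them, and the `Sⱼ` the products of the
factors between them. -/
theorem fermion_outer (hq : q = κ * t) (ha : a * S₂ = s • (S₂ * a)) (hu : u * S₂ = s • (S₂ * u))
    (hd : d * S₂ = s • (S₂ * d)) (ha' : a' = a - u) (hb' : b' = b + u) (hdef : d = a + b + u)
    (huu : u * u = 0) (hub : u * b = -(b * u)) :
    S₁ * (p • a' * (S₂ * (1 * (q • b' * S₃)))) = S₁ * (p • a * (S₂ * (1 * (q • b * S₃)))) +
      κ • (S₁ * (p • d * (S₂ * (t • u * (1 * S₃))))) := by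
  have e : a' * b' = a * b + d * u := by
    rw [ha', hb', hdef]
    simp only [sub_mul, mul_add, add_mul, huu, hub]; abel
  have h : a' * S₂ = s • (S₂ * a') := by rw [ha', sub_mul, ha, hu, ← smul_sub, ← mul_sub]
  have key : a' * S₂ * b' = a * S₂ * b + d * S₂ * u := by
    rw [h, ha, hd]
    simp only [smul_mul_assoc, mul_assoc]
    rw [e, mul_add, smul_add]
  calc _ = (p * q) • (S₁ * (a' * S₂ * b') * S₃) := by
        simp only [smul_mul_assoc, mul_smul_comm, one_mul, mul_assoc, smul_smul]
        module
    _ = _ := by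
        rw [key, hq]
        simp only [smul_mul_assoc, mul_smul_comm, one_mul, mul_assoc, smul_smul, mul_add, add_mul]
        module

/-- The analogue of `fermion_outer` for two neighbouring points that are both connected to the
right. -/
theorem fermion_right (hq : q = κ * p) (ht : t = -(p * s)) (hd : d * S₂ = s • (S₂ * d))
    (ha' : a' = a + u) (hb' : b' = b + u) (hdef : d = a - b - u)
    (huu : u * u = 0) (hua : a * u = -(u * a)) (hs : s * s = 1) :
    S₁ * (p • a' * (q • b' * (S₂ * (1 * S₃)))) = S₁ * (p • a * (q • b * (S₂ * (1 * S₃)))) +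
      κ • (S₁ * (p • u * (1 * (S₂ * (t • d * S₃))))) := by
  have e : a' * b' = a * b - u * d := by
    rw [ha', hb', hdef]
    simp only [mul_sub, mul_add, add_mul, huu, hua]; abel
  have hd' : S₂ * d = s • (d * S₂) := by rw [hd, smul_smul, hs, one_smul]
  calc _ = (p * q) • (S₁ * ((a' * b') * S₂) * S₃) := by
        simp only [smul_mul_assoc, mul_smul_comm, one_mul, mul_assoc, smul_smul]
        module
    _ = (p * q) • (S₁ * ((a * b) * S₂) * S₃) + (κ * p * t) • (S₁ * u * (S₂ * d) * S₃) := by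
        rw [e, hd', hq, ht]
        simp only [smul_mul_assoc, mul_smul_comm, mul_assoc, smul_smul, mul_sub, sub_mul]
        rw [show κ * (p * (-(p * s) * s)) = -(p * (κ * p)) by linear_combination -κ * p * p * hs]
        module
    _ = _ := by
        simp only [smul_mul_assoc, mul_smul_comm, one_mul, mul_assoc, smul_smul]
        module

/-- The analogue of `fermion_outer` for two neighbouring points that are both connected to the
left. -/
theorem fermion_left (ht : t * κ = -(q * s')) (ha : a * S₂ = s • (S₂ * a))
    (hu : u * S₂ = s • (S₂ * u)) (hd : d * S₂ = s • (S₂ * d)) (hu' : u * S₃ = s' • (S₃ * u))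
    (ha' : a' = a - u) (hb' : b' = b - u) (hdef : d = a - b - u)
    (huu : u * u = 0) (hub : u * b = -(b * u)) :
    S₁ * (p • a' * (S₂ * (q • b' * (S₃ * (1 * (1 * S₄)))))) =
      S₁ * (p • a * (S₂ * (q • b * (S₃ * (1 * (1 * S₄)))))) +
      κ • (S₁ * (p • d * (S₂ * (1 * (S₃ * (t • u * (1 * S₄))))))) := by
  have e : a' * b' = a * b - d * u := by
    rw [ha', hb', hdef]
    simp only [sub_mul, mul_sub, huu, hub]; abel
  have h : a' * S₂ = s • (S₂ * a') := by rw [ha', sub_mul, ha, hu, ← smul_sub, ← mul_sub]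
  have key : a' * S₂ * b' = a * S₂ * b - d * S₂ * u := by
    rw [h, ha, hd]
    simp only [smul_mul_assoc, mul_assoc]
    rw [e, mul_sub, smul_sub]
  calc _ = (p * q) • (S₁ * (a' * S₂ * b') * S₃ * S₄) := by
        simp only [smul_mul_assoc, mul_smul_comm, one_mul, mul_assoc, smul_smul]
        module
    _ = (p * q) • (S₁ * (a * S₂ * b) * S₃ * S₄) - (p * q) • (S₁ * d * S₂ * (u * S₃) * S₄) := by
        rw [key]
        simp only [mul_assoc, mul_sub, sub_mul, smul_sub]
    _ = (p * q) • (S₁ * (a * S₂ * b) * S₃ * S₄) +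
          (p * (t * κ)) • (S₁ * d * S₂ * (S₃ * u) * S₄) := by
        rw [hu', ht]
        simp only [smul_mul_assoc, mul_smul_comm]
        module
    _ = _ := by
        simp only [smul_mul_assoc, mul_smul_comm, one_mul, mul_assoc, smul_smul]
        module

end Fermions

variable {M : Type*} [AddCommGroup M] [Module ℂ M]

/-- A vector moves past a product of vectors and of ones with the sign given by the number of
vectors. -/
theorem ι_mul_seg {G : ℕ → ExteriorAlgebra ℂ M} {p : ℕ → Prop} [DecidablePred p]
    (h1 : ∀ x, p x → ∃ v, G x = ExteriorAlgebra.ι ℂ v) (h2 : ∀ x, ¬ p x → G x = 1) (v : M)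
    {a b : ℕ} (hab : a ≤ b) : ExteriorAlgebra.ι ℂ v * seg G a b =
      (-1 : ℂ) ^ ((Finset.Ico a b).filter p).card • (seg G a b * ExteriorAlgebra.ι ℂ v) := by
  induction b, hab using Nat.le_induction with
  | base => simp [seg_self]
  | succ b hab ih =>
    rw [← seg_mul hab (Nat.le_succ b), seg_succ, ← mul_assoc, ih,
      ← Finset.insert_Ico_right_eq_Ico_add_one hab, Finset.filter_insert]
    by_cases hp : p b
    · obtain ⟨w, hw⟩ := h1 b hp
      rw [if_pos hp, Finset.card_insert_of_notMem (by simp), hw, smul_mul_assoc, mul_assoc,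
        ι_mul_ι_comm v w, pow_succ]
      simp [mul_assoc]
    · rw [if_neg hp, h2 b hp, mul_one, mul_one]

/-- A product containing a vector is annihilated by this vector. -/
theorem ι_mul_seg_eq_zero {G : ℕ → ExteriorAlgebra ℂ M} {p : ℕ → Prop} [DecidablePred p]
    (h1 : ∀ x, p x → ∃ v, G x = ExteriorAlgebra.ι ℂ v) (h2 : ∀ x, ¬ p x → G x = 1) {v : M}
    {a b x : ℕ} (hax : a ≤ x) (hxb : x < b) (c : ℂ) (hx : G x = ExteriorAlgebra.ι ℂ (c • v)) :
    ExteriorAlgebra.ι ℂ v * seg G a b = 0 := by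
  rw [seg_split x hax hxb, ← mul_assoc, ι_mul_seg h1 h2 v hax, hx, map_smul, smul_mul_assoc,
    smul_mul_assoc, mul_smul_comm, mul_assoc, ← mul_assoc (ExteriorAlgebra.ι ℂ v),
    ExteriorAlgebra.ι_sq_zero]
  simp

variable {m : ℕ}

/-- The partner of a point, as a natural number. -/
def ArcDiagram.pt (D : ArcDiagram m) (x : ℕ) : ℕ := if h : x < m then D.partner ⟨x, h⟩ else 0

theorem ArcDiagram.pt_val (D : ArcDiagram m) (x : Fin m) : D.pt x = D.partner x := by
  simp [ArcDiagram.pt]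

theorem ArcDiagram.arcCount_eq (D : ArcDiagram m) {a b : ℕ} (hb : b ≤ m) :
    D.arcCount a b = ((Finset.Ico a b).filter fun x => x < D.pt x).card := by
  rw [ArcDiagram.arcCount, ← Finset.card_map Fin.valEmbedding]
  congr 1
  ext k
  simp only [Finset.mem_map, Finset.mem_filter, Finset.mem_univ, true_and, Finset.mem_Ico,
    Fin.valEmbedding_apply]
  constructor
  · rintro ⟨x, ⟨h1, h2⟩, rfl⟩
    exact ⟨h1, by rw [D.pt_val]; exact h2⟩
  · rintro ⟨h1, h2⟩
    refine ⟨⟨k, by omega⟩, ⟨h1, ?_⟩, rfl⟩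
    rw [Fin.lt_def, ← D.pt_val]; exact h2

variable (κ : ℂ) (θ : ℕ → M) (D : ArcDiagram m)

/-- The factor `κ^x (θ_x - θ_y)` of an arc from `x` to `y`, and `1` if no arc starts at `x`. -/
noncomputable def arcFactor (x : ℕ) : ExteriorAlgebra ℂ M :=
  if x < D.pt x then ExteriorAlgebra.ι ℂ (κ ^ x • (θ x - θ (D.pt x))) else 1

/-- The wedge of the differences `κ^x (θ_x - θ_y)` over all the arcs of a diagram. -/
noncomputable def fullWedge : ExteriorAlgebra ℂ M := seg (arcFactor κ θ D) 0 m

variable {κ θ D}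

theorem arcFactor_of_lt {x y : ℕ} (h : D.pt x = y) (hxy : x < y) :
    arcFactor κ θ D x = κ ^ x • ExteriorAlgebra.ι ℂ (θ x - θ y) := by
  rw [arcFactor, h, if_pos hxy, map_smul]

theorem arcFactor_of_le {x y : ℕ} (h : D.pt x = y) (hxy : y ≤ x) : arcFactor κ θ D x = 1 := by
  rw [arcFactor, h, if_neg (not_lt.2 hxy)]

theorem ι_mul_seg_arcFactor (v : M) {a b : ℕ} (hab : a ≤ b) (hb : b ≤ m) :
    ExteriorAlgebra.ι ℂ v * seg (arcFactor κ θ D) a b =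
      (-1 : ℂ) ^ D.arcCount a b • (seg (arcFactor κ θ D) a b * ExteriorAlgebra.ι ℂ v) := by
  rw [D.arcCount_eq hb]
  refine ι_mul_seg (fun x hx => ⟨κ ^ x • (θ x - θ (D.pt x)), ?_⟩) (fun x hx => ?_) v hab
  · rw [arcFactor, if_pos hx]
  · rw [arcFactor, if_neg hx]

/-- The arc diagrams span a representation of the braid group in the exterior algebra: the
transvection `τ = 1 + f(·) (θ_i - θ_{i+1})`, where `f(θ_i) = f(θ_{i+1}) = 1` and `f` vanishes on
the other `θ_x`, acts as `1 + κ E_i`. -/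
theorem map_fullWedge (hκ : κ ^ 2 = -1) (i : Fin (m - 1)) (τ : M →ₗ[ℂ] M)
    (hτ : ∀ x y, τ (θ x - θ y) = θ x - θ y + ((if x = i ∨ x = i + 1 then 1 else 0) -
      (if y = i ∨ y = i + 1 then 1 else 0) : ℂ) • (θ i - θ (i + 1))) :
    ExteriorAlgebra.map τ (fullWedge κ θ D) = fullWedge κ θ D +
      if D.partner (lo i) = hi i then 0 else κ • fullWedge κ θ (cap i D) := by
  obtain ⟨j, hj⟩ : ∃ j, D.partner (lo i) = j := ⟨_, rfl⟩
  obtain ⟨k, hk⟩ : ∃ k, D.partner (hi i) = k := ⟨_, rfl⟩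
  have hinv := D.invol
  have him := i.2
  -- factors of arcs not ending in `i` or `i + 1` are fixed
  have fix : ∀ y : Fin m, y ≠ lo i → y ≠ hi i → D.partner y ≠ lo i → D.partner y ≠ hi i →
      ExteriorAlgebra.map τ (arcFactor κ θ D y) = arcFactor κ θ D y := by
    intro y h1 h2 h3 h4
    rw [arcFactor, D.pt_val]
    split_ifs
    · rw [ExteriorAlgebra.map_apply_ι, map_smul, hτ]
      simp only [lo, hi, ne_eq, Fin.ext_iff] at h1 h2 h3 h4
      rw [if_neg (by omega), if_neg (by omega), sub_zero, zero_smul, add_zero]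
    · exact map_one _
  have segfix : ∀ a b : ℕ, b ≤ m → (∀ y : Fin m, a ≤ y → (y : ℕ) < b →
      ExteriorAlgebra.map τ (arcFactor κ θ D y) = arcFactor κ θ D y) →
      ExteriorAlgebra.map τ (seg (arcFactor κ θ D) a b) = seg (arcFactor κ θ D) a b := by
    intro a b hb h
    have := map_seg (G := arcFactor κ θ D) (ExteriorAlgebra.map τ).toRingHom.toMonoidHom a b
    refine this.trans (seg_congr fun y h1 h2 => h ⟨y, by omega⟩ h1 h2)
  have elo : (lo i : ℕ) = i := rfl
  have ehi : (hi i : ℕ) = i + 1 := rfl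
  by_cases hjoin : j = hi i
  · rw [hj, if_pos hjoin, add_zero]
    refine segfix 0 m le_rfl fun y _ _ => ?_
    by_cases h1 : y = lo i
    · rw [h1, arcFactor, D.pt_val, hj, hjoin, elo, ehi]
      split_ifs
      · rw [ExteriorAlgebra.map_apply_ι, map_smul, hτ]; simp
      · exact map_one _
    by_cases h2 : y = hi i
    · rw [arcFactor_of_le (D.pt_val y), map_one]
      rw [h2, ← hjoin, ← hj, hinv, hj, hjoin]
      exact (lo_lt_hi i).le
    · refine fix y h1 h2 (fun h => h2 ?_) (fun h => h1 ?_)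
      · rw [← hinv y, h, hj, hjoin]
      · rw [← hinv y, h, ← hjoin, ← hj, hinv]
  rw [hj, if_neg hjoin]
  set D' := cap i D with hD'
  have pj : D.partner j = lo i := by rw [← hj, hinv]
  have pk : D.partner k = hi i := by rw [← hk, hinv]
  have ne := four_ne hj hk hjoin
  have tlo : D.pt i = j := (D.pt_val (lo i)).trans (by rw [hj])
  have thi : D.pt (i + 1) = k := (D.pt_val (hi i)).trans (by rw [hk])
  have tj : D.pt j = i := by rw [D.pt_val, pj]; rfl
  have tk : D.pt k = i + 1 := by rw [D.pt_val, pk]; rfl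
  have tlo' : D'.pt i = i + 1 := (D'.pt_val (lo i)).trans (by rw [hD', cap_lo]; rfl)
  have thi' : D'.pt (i + 1) = i := (D'.pt_val (hi i)).trans (by rw [hD', cap_hi]; rfl)
  have tj' : D'.pt j = k := by rw [D'.pt_val, cap_partner_lo hj hk hjoin]
  have tk' : D'.pt k = j := by rw [D'.pt_val, cap_partner_hi hj hk hjoin]
  -- segments avoiding the four points, or meeting them in end points of arcs only
  have same : ∀ y : Fin m, y ≠ lo i → y ≠ hi i → (y = j → lo i < y ∧ k < j) →
      (y = k → hi i < y ∧ j < k) →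
      ExteriorAlgebra.map τ (arcFactor κ θ D y) = arcFactor κ θ D y ∧
      arcFactor κ θ D' y = arcFactor κ θ D y := by
    intro y h1 h2 h3 h4
    by_cases h5 : y = j
    · obtain ⟨h6, h7⟩ := h3 h5
      rw [h5, arcFactor_of_le tj (by rw [← h5]; exact (Fin.lt_def.1 h6).le),
        arcFactor_of_le tj' h7.le, map_one]
      exact ⟨rfl, rfl⟩
    by_cases h6 : y = k
    · obtain ⟨h7, h8⟩ := h4 h6
      rw [h6, arcFactor_of_le tk (by rw [← h6, ← ehi]; exact (Fin.lt_def.1 h7).le),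
        arcFactor_of_le tk' h8.le, map_one]
      exact ⟨rfl, rfl⟩
    obtain ⟨a1, a2, -, -⟩ := partner_ne_of_ne hj hk h1 h2 h5 h6
    refine ⟨fix y h1 h2 a1 a2, ?_⟩
    rw [arcFactor, arcFactor, D.pt_val, D'.pt_val, cap_partner_of_ne hj hk h1 h2 h5 h6]
  have segsame : ∀ a b : ℕ, b ≤ m → (∀ y : Fin m, a ≤ y → (y : ℕ) < b → y ≠ lo i ∧ y ≠ hi i ∧
      (y = j → lo i < y ∧ k < j) ∧ (y = k → hi i < y ∧ j < k)) →
      ExteriorAlgebra.map τ (seg (arcFactor κ θ D) a b) = seg (arcFactor κ θ D) a b ∧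
      seg (arcFactor κ θ D') a b = seg (arcFactor κ θ D) a b := by
    intro a b hb h
    refine ⟨segfix a b hb fun y h1 h2 => ?_, seg_congr fun y h1 h2 => ?_⟩
    · obtain ⟨b1, b2, b3, b4⟩ := h y h1 h2
      exact (same y b1 b2 b3 b4).1
    · obtain ⟨b1, b2, b3, b4⟩ := h ⟨y, by omega⟩ h1 h2
      exact (same ⟨y, by omega⟩ b1 b2 b3 b4).2
  simp only [lo, hi, ne_eq, Fin.ext_iff, Fin.lt_def] at ne segsame
  rcases cap_cases hj hk hjoin with ⟨c1, c2⟩ | ⟨c1, c2⟩ | ⟨c1, c2⟩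
  · -- `j < i` and `i + 1 < k`
    have split : ∀ F : ℕ → ExteriorAlgebra ℂ M, seg F 0 m =
        seg F 0 j * (F j * (seg F (j + 1) i * (F i * (F (i + 1) * seg F (i + 1 + 1) m)))) := by
      intro F
      rw [seg_split (j : ℕ) (by omega) j.2, seg_split (a := j + 1) (i : ℕ) (by omega) (by omega),
        seg_split (a := i + 1) (i + 1 : ℕ) le_rfl (by omega), seg_self, one_mul]
    obtain ⟨m1, s1⟩ := segsame 0 j (by omega) fun y _ _ => by omega
    obtain ⟨m2, s2⟩ := segsame (j + 1) i (by omega) fun y _ _ => by omega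
    obtain ⟨m3, s3⟩ := segsame (i + 1 + 1) m (by omega) fun y _ _ => by omega
    have mv := fun v => ι_mul_seg_arcFactor (κ := κ) (θ := θ) (D := D) v
      (show (j + 1 : ℕ) ≤ i by omega) (by omega)
    rw [fullWedge, fullWedge, split, split]
    simp only [map_mul]
    rw [m1, m2, m3, s1, s2, s3, arcFactor_of_lt tj (by omega), arcFactor_of_le tlo (by omega),
      arcFactor_of_lt thi (by omega), arcFactor_of_lt tj' (by omega),
      arcFactor_of_lt tlo' (by omega), arcFactor_of_le thi' (by omega)]
    simp only [map_one, map_smul, ExteriorAlgebra.map_apply_ι]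
    refine fermion_outer (s := (-1) ^ D.arcCount (j + 1) i) _ _ _ _ _ _ _ _ _ _ _ _ _ ?_ ?_ ?_ ?_
      ?_ ?_ ?_ ?_ ?_
    · rw [pow_succ']
    · exact mv _
    · exact mv _
    · exact mv _
    · rw [hτ, if_neg (by omega), if_pos (by omega), zero_sub, neg_one_smul, map_add, map_neg,
        ← sub_eq_add_neg]
    · rw [hτ, if_pos (by omega), if_neg (by omega), sub_zero, one_smul, map_add]
    · rw [← map_add, ← map_add]; congr 1; abel
    · exact ExteriorAlgebra.ι_sq_zero _
    · exact ι_mul_ι_comm _ _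
  · -- `i + 1 < k < j`
    have split : ∀ F : ℕ → ExteriorAlgebra ℂ M, seg F 0 m =
        seg F 0 i * (F i * (F (i + 1) * (seg F (i + 1 + 1) k * (F k * seg F (k + 1) m)))) := by
      intro F
      rw [seg_split (i : ℕ) (by omega) (by omega),
        seg_split (a := i + 1) (i + 1 : ℕ) le_rfl (by omega), seg_self, one_mul,
        seg_split (a := i + 1 + 1) (k : ℕ) (by omega) k.2]
    obtain ⟨m1, s1⟩ := segsame 0 i (by omega) fun y _ _ => by omega
    obtain ⟨m2, s2⟩ := segsame (i + 1 + 1) k (by omega) fun y _ _ => by omega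
    obtain ⟨m3, s3⟩ := segsame (k + 1) m (by omega) fun y _ _ => by omega
    have mv := fun v => ι_mul_seg_arcFactor (κ := κ) (θ := θ) (D := D) v
      (show (i + 1 + 1 : ℕ) ≤ k by omega) (by omega)
    have hr := D.arc_eq hk (by rw [Fin.lt_def]; omega)
    rw [ehi] at hr
    rw [fullWedge, fullWedge, split, split]
    simp only [map_mul]
    rw [m1, m2, m3, s1, s2, s3, arcFactor_of_lt tlo (by omega), arcFactor_of_lt thi (by omega),
      arcFactor_of_le tk (by omega), arcFactor_of_lt tlo' (by omega),
      arcFactor_of_le thi' (by omega), arcFactor_of_lt tk' (by omega)]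
    simp only [map_one, map_smul, ExteriorAlgebra.map_apply_ι]
    refine fermion_right (s := (-1) ^ D.arcCount (i + 1 + 1) k) _ _ _ _ _ _ _ _ _ _ _ _ _ ?_ ?_ ?_
      ?_ ?_ ?_ ?_ ?_ ?_
    · rw [pow_succ']
    · conv_lhs => rw [hr]
      rw [show (i + 1 + 1 + 2 * D.arcCount (i + 1 + 1) k : ℕ) =
        i + 2 + 2 * D.arcCount (i + 1 + 1) k by ring, pow_add, pow_mul, pow_add, hκ]
      ring
    · exact mv _
    · rw [hτ, if_pos (by omega), if_neg (by omega), sub_zero, one_smul, map_add]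
    · rw [hτ, if_pos (by omega), if_neg (by omega), sub_zero, one_smul, map_add]
    · rw [← map_sub, ← map_sub]; congr 1; abel
    · exact ExteriorAlgebra.ι_sq_zero _
    · exact ι_mul_ι_comm _ _
    · rw [← mul_pow]; norm_num
  · -- `k < j < i`
    have split : ∀ F : ℕ → ExteriorAlgebra ℂ M, seg F 0 m =
        seg F 0 k * (F k * (seg F (k + 1) j * (F j * (seg F (j + 1) i * (F i * (F (i + 1) *
          seg F (i + 1 + 1) m)))))) := by
      intro F
      rw [seg_split (k : ℕ) (by omega) k.2, seg_split (a := k + 1) (j : ℕ) (by omega) j.2,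
        seg_split (a := j + 1) (i : ℕ) (by omega) (by omega),
        seg_split (a := i + 1) (i + 1 : ℕ) le_rfl (by omega), seg_self, one_mul]
    obtain ⟨m1, s1⟩ := segsame 0 k (by omega) fun y _ _ => by omega
    obtain ⟨m2, s2⟩ := segsame (k + 1) j (by omega) fun y _ _ => by omega
    obtain ⟨m3, s3⟩ := segsame (j + 1) i (by omega) fun y _ _ => by omega
    obtain ⟨m4, s4⟩ := segsame (i + 1 + 1) m (by omega) fun y _ _ => by omega
    have mv := fun v => ι_mul_seg_arcFactor (κ := κ) (θ := θ) (D := D) v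
      (show (k + 1 : ℕ) ≤ j by omega) (by omega)
    have mv' := fun v => ι_mul_seg_arcFactor (κ := κ) (θ := θ) (D := D) v
      (show (j + 1 : ℕ) ≤ i by omega) (by omega)
    have hr := D.arc_eq pj (by rw [Fin.lt_def]; omega)
    rw [elo] at hr
    rw [fullWedge, fullWedge, split, split]
    simp only [map_mul]
    rw [m1, m2, m3, m4, s1, s2, s3, s4, arcFactor_of_lt tk (by omega),
      arcFactor_of_lt tj (by omega), arcFactor_of_le tlo (by omega),
      arcFactor_of_le thi (by omega), arcFactor_of_lt tk' (by omega),
      arcFactor_of_le tj' (by omega), arcFactor_of_lt tlo' (by omega),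
      arcFactor_of_le thi' (by omega)]
    simp only [map_one, map_smul, ExteriorAlgebra.map_apply_ι]
    refine fermion_left (s := (-1) ^ D.arcCount (k + 1) j) (s' := (-1) ^ D.arcCount (j + 1) i)
      _ _ _ _ _ _ _ _ _ _ _ _ _ _ ?_ ?_ ?_ ?_ ?_ ?_ ?_ ?_ ?_ ?_
    · conv_lhs => rw [hr]
      rw [pow_add, pow_mul, pow_add, hκ]
      linear_combination κ ^ (j : ℕ) * (-1) ^ D.arcCount (j + 1) i * hκ
    · exact mv _
    · exact mv _
    · exact mv _
    · exact mv' _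
    · rw [hτ, if_neg (by omega), if_pos (by omega), zero_sub, neg_one_smul, map_add, map_neg,
        ← sub_eq_add_neg]
    · rw [hτ, if_neg (by omega), if_pos (by omega), zero_sub, neg_one_smul, map_add, map_neg,
        ← sub_eq_add_neg]
    · rw [← map_sub, ← map_sub]; congr 1; abel
    · exact ExteriorAlgebra.ι_sq_zero _
    · exact ι_mul_ι_comm _ _

end Wedges

/-! ### The wedge of the lifted arcs -/

section OpenWedge

variable {n : ℕ} {M : Type*} [AddCommGroup M] [Module ℂ M]

/-- The factor of the arc starting at `x` (and `1` if there is none), leaving out the arc that ends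
in the last point. -/
noncomputable def openFactor (κ : ℂ) (θ : ℕ → M) (D : ArcDiagram (2 * n)) (x : ℕ) :
    ExteriorAlgebra ℂ M :=
  if x < D.pt x ∧ D.pt x + 1 ≠ 2 * n then ExteriorAlgebra.ι ℂ (κ ^ x • (θ x - θ (D.pt x))) else 1

/-- The wedge of the differences `κ^x (θ_x - θ_y)` over all the arcs except the one ending in the
last point. -/
noncomputable def openWedge (κ : ℂ) (θ : ℕ → M) (D : ArcDiagram (2 * n)) : ExteriorAlgebra ℂ M :=
  seg (openFactor κ θ D) 0 (2 * n)

/-- The alternating sum `∑ (-1)^x θ_x`. -/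
def altSum (n : ℕ) (θ : ℕ → M) : M := ∑ x : Fin (2 * n), (-1 : ℂ) ^ (x : ℕ) • θ x

theorem altSum_eq_sum_range (θ : ℕ → M) :
    altSum n θ = ∑ k ∈ Finset.range n, (θ (2 * k) - θ (2 * k + 1)) := by
  rw [altSum, ← Finset.sum_range (fun x => (-1 : ℂ) ^ x • θ x)]
  induction n with
  | zero => simp
  | succ n ih =>
    rw [Finset.sum_range_succ, ← ih, show 2 * (n + 1) = 2 * n + 1 + 1 by ring,
      Finset.sum_range_succ, Finset.sum_range_succ, pow_succ, pow_mul]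
    simp [sub_eq_add_neg, add_assoc]

/-- The points before the arc ending in the last point are connected to each other. -/
theorem ArcDiagram.closed_left (D : ArcDiagram (2 * n)) {p l : Fin (2 * n)}
    (hl : (l : ℕ) + 1 = 2 * n) (hp : D.partner p = l) : D.Closed 0 p := by
  rintro z ⟨-, hz⟩
  refine ⟨Nat.zero_le _, ?_⟩
  have hpl : p < l := by
    have h1 : p ≠ l := fun e => D.ne p (by rw [hp, e])
    rw [Fin.lt_def]; rw [ne_eq, Fin.ext_iff] at h1; omega
  by_contra h
  have h1 : D.partner z ≠ p := fun e => by
    have h2 : z = l := by rw [← D.invol z, e, hp]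
    rw [h2] at hz; rw [Fin.lt_def] at hpl; omega
  have h2 : D.partner z ≠ l := fun e => by
    have h3 : z = p := by rw [← D.invol z, e, ← hp, D.invol]
    rw [h3] at hz; omega
  rw [ne_eq, Fin.ext_iff] at h1 h2
  have h3 := D.closed_arc hp hpl (D.partner z) ⟨by omega, by omega⟩
  rw [D.invol] at h3
  omega

/-- The alternating sum is the alternating sum of the arcs of any diagram. -/
theorem altSum_eq_sum_arcs (θ : ℕ → M) (D : ArcDiagram (2 * n)) : altSum n θ =
    ∑ x ∈ Finset.univ.filter (fun x : Fin (2 * n) => x < D.partner x),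
      (-1 : ℂ) ^ (x : ℕ) • (θ x - θ (D.partner x)) := by
  have := sum_eq_sum_arcs D (fun _ => True) (fun _ _ => trivial) fun x => (-1 : ℂ) ^ (x : ℕ) • θ x
  simp only [Finset.filter_true, true_and] at this
  rw [altSum, this]
  refine Finset.sum_congr rfl fun x hx => ?_
  have h := D.arc_eq rfl (Finset.mem_filter.1 hx).2
  have e : (-1 : ℂ) ^ (D.partner x : ℕ) = -(-1) ^ (x : ℕ) := by
    rw [h, pow_add, pow_succ, pow_mul]; simp
  rw [e]
  module

/-- Multiplication by the alternating sum puts the arc ending in the last point back. -/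
theorem ι_altSum_mul_openWedge (hn : 1 ≤ n) {κ : ℂ} (hκ : κ ^ 2 = -1) (θ : ℕ → M)
    (D : ArcDiagram (2 * n)) :
    ExteriorAlgebra.ι ℂ (altSum n θ) * openWedge κ θ D = fullWedge κ θ D := by
  obtain ⟨l, hl⟩ : ∃ l : Fin (2 * n), (l : ℕ) + 1 = 2 * n := ⟨⟨2 * n - 1, by omega⟩, by simp; omega⟩
  obtain ⟨p, hp⟩ : ∃ p, D.partner l = p := ⟨_, rfl⟩
  have hpl : D.partner p = l := by rw [← hp, D.invol]
  have hlt : (p : ℕ) < l := by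
    have h1 : p ≠ l := fun e => D.ne p (by rw [hpl, e])
    rw [ne_eq, Fin.ext_iff] at h1; omega
  have hev : (p : ℕ) = 2 * D.arcCount 0 p := by
    have := (D.closed_left hl hpl).sub_eq (by omega); omega
  have h1 : ∀ x, (x < D.pt x ∧ D.pt x + 1 ≠ 2 * n) →
      ∃ v, openFactor κ θ D x = ExteriorAlgebra.ι ℂ v := fun x hx =>
    ⟨κ ^ x • (θ x - θ (D.pt x)), by rw [openFactor, if_pos hx]⟩
  have h2 : ∀ x, ¬ (x < D.pt x ∧ D.pt x + 1 ≠ 2 * n) → openFactor κ θ D x = 1 := fun x hx => by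
    rw [openFactor, if_neg hx]
  rw [altSum_eq_sum_arcs θ D, map_sum, Finset.sum_mul, Finset.sum_eq_single p]
  · have hG : ∀ x, x < 2 * n → x ≠ p → openFactor κ θ D x = arcFactor κ θ D x := by
      intro x hx hxp
      rw [openFactor, arcFactor]
      congr 1
      rw [eq_iff_iff, and_iff_left_iff_imp]
      intro _ h3
      refine hxp (congrArg Fin.val (?_ : (⟨x, hx⟩ : Fin (2 * n)) = p))
      have h4 : D.partner ⟨x, hx⟩ = l := Fin.ext (by
        have := D.pt_val ⟨x, hx⟩; simp only at this; omega)
      rw [← D.invol ⟨x, hx⟩, h4, hp]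
    have hGp : openFactor κ θ D p = 1 := h2 _ (by rw [D.pt_val, hpl]; omega)
    have e1 : seg (openFactor κ θ D) 0 p = seg (arcFactor κ θ D) 0 p :=
      seg_congr fun x _ hx => hG x (by omega) (by omega)
    have e2 : seg (openFactor κ θ D) (p + 1) (2 * n) = seg (arcFactor κ θ D) (p + 1) (2 * n) :=
      seg_congr fun x hx hx' => hG x hx' (by omega)
    rw [openWedge, fullWedge, seg_split (p : ℕ) (Nat.zero_le _) p.2, hGp, one_mul, e1, e2,
      seg_split (G := arcFactor κ θ D) (p : ℕ) (Nat.zero_le _) p.2,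
      arcFactor_of_lt (D.pt_val p) (by rw [hpl]; exact hlt), ← mul_assoc,
      ι_mul_seg_arcFactor _ (Nat.zero_le _) p.2.le]
    have e3 : (-1 : ℂ) ^ (p : ℕ) = 1 := by rw [hev, pow_mul]; simp
    have e4 : κ ^ (p : ℕ) = (-1 : ℂ) ^ D.arcCount 0 p := by
      conv_lhs => rw [hev]
      rw [pow_mul, hκ]
    rw [e3, e4, one_smul]
    simp only [smul_mul_assoc, mul_smul_comm, mul_assoc]
  · intro x hx hxp
    have hx' := (Finset.mem_filter.1 hx).2
    rw [map_smul, smul_mul_assoc, openWedge,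
      ι_mul_seg_eq_zero h1 h2 (Nat.zero_le _) x.2 (κ ^ (x : ℕ)), smul_zero]
    have h3 : D.partner x ≠ l := fun e => hxp (by rw [← hp, ← e, D.invol])
    rw [ne_eq, Fin.ext_iff] at h3
    rw [openFactor, D.pt_val, if_pos ⟨hx', by omega⟩]
  · intro h
    exact absurd (Finset.mem_filter.2 ⟨Finset.mem_univ _, by rw [hpl]; exact hlt⟩) h

theorem map_openWedge {M' : Type*} [AddCommGroup M'] [Module ℂ M'] (f : M →ₗ[ℂ] M') (κ : ℂ)
    (θ : ℕ → M) (D : ArcDiagram (2 * n)) :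
    ExteriorAlgebra.map f (openWedge κ θ D) = openWedge κ (fun x => f (θ x)) D := by
  have := map_seg (G := openFactor κ θ D) (ExteriorAlgebra.map f).toRingHom.toMonoidHom 0 (2 * n)
  refine this.trans (seg_congr fun x _ _ => ?_)
  change ExteriorAlgebra.map f (openFactor κ θ D x) = _
  rw [openFactor, openFactor]
  split_ifs
  · rw [ExteriorAlgebra.map_apply_ι, map_smul, map_sub]
  · exact map_one _

/-- The class `-(c_1 + ⋯ + c_x)`; the differences of these classes are the classes of arcs. -/
noncomputable def potential (n x : ℕ) : H1 n := -∑ y ∈ Finset.range x, chainClass n y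

theorem potential_sub {x y : ℕ} (h : x ≤ y) :
    potential n x - potential n y = ∑ j ∈ Finset.Ico x y, chainClass n j := by
  rw [potential, potential, Finset.sum_Ico_eq_sub _ h]
  abel

theorem potential_sub_succ (x : ℕ) : potential n x - potential n (x + 1) = chainClass n x := by
  rw [potential_sub (Nat.le_succ x)]; simp

theorem altSum_potential : altSum n (potential n) = 0 := by
  rw [altSum_eq_sum_range, ← aCycle_top n, aCycle]
  exact Finset.sum_congr rfl fun k _ => potential_sub_succ _

/-- The linear map from the free space on points to the homology that sends a difference of
neighbouring points to the curve of the chain between them. -/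
noncomputable def potentialMap (n : ℕ) : (ℕ →₀ ℂ) →ₗ[ℂ] H1 n :=
  Finsupp.linearCombination ℂ (potential n)

theorem potentialMap_single (y : ℕ) : potentialMap n (Finsupp.single y 1) = potential n y := by
  rw [potentialMap, Finsupp.linearCombination_single, one_smul]

/-- The transvection of the free space on points lifting the Dehn twist `t_{c_i}`. -/
noncomputable def pointTransvection (i : ℕ) : (ℕ →₀ ℂ) →ₗ[ℂ] (ℕ →₀ ℂ) :=
  LinearMap.id + (Finsupp.lapply i + Finsupp.lapply (i + 1)).smulRight
    (Finsupp.single i 1 - Finsupp.single (i + 1) 1)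

theorem pointTransvection_single (i y : ℕ) : pointTransvection i (Finsupp.single y 1) =
    Finsupp.single y 1 + (if y = i ∨ y = i + 1 then 1 else 0 : ℂ) •
      (Finsupp.single i 1 - Finsupp.single (i + 1) 1) := by
  simp only [pointTransvection, LinearMap.add_apply, LinearMap.id_apply, LinearMap.smulRight_apply,
    Finsupp.lapply_apply, Finsupp.single_apply]
  congr 2
  split_ifs <;> first | omega | simp

theorem pointTransvection_sub (i y z : ℕ) :
    pointTransvection i (Finsupp.single y 1 - Finsupp.single z 1) =
    Finsupp.single y 1 - Finsupp.single z 1 + ((if y = i ∨ y = i + 1 then 1 else 0) -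
      (if z = i ∨ z = i + 1 then 1 else 0) : ℂ) •
      (Finsupp.single i 1 - Finsupp.single (i + 1) 1) := by
  rw [map_sub, pointTransvection_single, pointTransvection_single]
  module

theorem pushforward_potentialMap (i : Fin (2 * n - 1)) {y z : ℕ} (hy : y < 2 * n) (hz : z < 2 * n) :
    pushforward (surfaceAut n (Braid.σ i))
      (potentialMap n (Finsupp.single y 1 - Finsupp.single z 1)) =
    potentialMap n (pointTransvection i (Finsupp.single y 1 - Finsupp.single z 1)) := by
  set g := pushforward (surfaceAut n (Braid.σ i)) ∘ₗ potentialMap n -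
    potentialMap n ∘ₗ pointTransvection i with hg
  have hstep : ∀ y, y + 1 < 2 * n → g (Finsupp.single y 1 - Finsupp.single (y + 1) 1) = 0 := by
    intro y hy
    rw [hg, LinearMap.sub_apply, LinearMap.comp_apply, LinearMap.comp_apply,
      pointTransvection_sub, map_add, map_smul, map_sub, map_sub (potentialMap n)]
    simp only [potentialMap_single, potential_sub_succ]
    rw [pushforward_σ_c i y (by omega)]
    rcases lt_trichotomy y i with h | h | h
    · rw [if_neg (by omega), if_neg (c := y = i ∨ _) (by omega)]
      by_cases h' : y + 1 = i
      · rw [if_pos h', if_pos (Or.inl h')]; module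
      · rw [if_neg h', if_neg (by omega)]; module
    · rw [if_neg (by omega), if_neg (by omega), if_pos (by omega), if_pos (by omega)]; module
    · rw [if_neg (c := y + 1 = i) (by omega), if_neg (c := y + 1 = i ∨ _) (by omega)]
      by_cases h' : y = i + 1
      · rw [if_pos h', if_pos (Or.inr h')]; module
      · rw [if_neg h', if_neg (by omega)]; module
  have hall : ∀ y < 2 * n, g (Finsupp.single y 1) = g (Finsupp.single 0 1) := by
    intro y
    induction y with
    | zero => intro _; rfl
    | succ y ih =>
      intro hy
      have := hstep y hy
      rw [map_sub, sub_eq_zero] at this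
      rw [← this, ih (by omega)]
  have h0 : g (Finsupp.single y 1 - Finsupp.single z 1) = 0 := by
    rw [map_sub, hall y hy, hall z hz, sub_self]
  rwa [hg, LinearMap.sub_apply, sub_eq_zero] at h0

theorem ArcDiagram.pt_lt (hn : 1 ≤ n) (D : ArcDiagram (2 * n)) (y : ℕ) : D.pt y < 2 * n := by
  rw [ArcDiagram.pt]
  split_ifs
  · exact Fin.is_lt _
  · omega

/-- The images of the wedges of arcs under the Dehn twists. Since the alternating sum of the curves
is a boundary, this follows from the analogous formula for the wedge of all the arcs in the free
space on the points. -/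
theorem map_pushforward_openWedge (hn : 1 ≤ n) {κ : ℂ} (hκ : κ ^ 2 = -1) (i : Fin (2 * n - 1))
    (D : ArcDiagram (2 * n)) :
    ExteriorAlgebra.map (pushforward (surfaceAut n (Braid.σ i))) (openWedge κ (potential n) D) =
      openWedge κ (potential n) D +
        if D.partner (lo i) = hi i then 0 else κ • openWedge κ (potential n) (cap i D) := by
  set θ : ℕ → ℕ →₀ ℂ := fun y => Finsupp.single y 1 with hθ
  set r := altSum n θ with hr
  have hτ := fun y z => pointTransvection_sub i y z
  -- the identity holds in the free space after multiplication by `r`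
  have hfull := map_fullWedge (D := D) hκ i (pointTransvection i) (θ := θ) hτ
  have hτr : pointTransvection i r = r := by
    rw [hr, altSum_eq_sum_arcs θ (cap i D), map_sum]
    refine Finset.sum_congr rfl fun y _ => ?_
    rw [map_smul, hτ]
    by_cases h1 : y = lo i
    · rw [h1, cap_lo]; simp [lo, hi, hθ]
    by_cases h2 : y = hi i
    · rw [h2, cap_hi]; simp [lo, hi, hθ]
    have h3 : (cap i D).partner y ≠ lo i := fun e => h2 (by rw [← (cap i D).invol y, e, cap_lo])
    have h4 : (cap i D).partner y ≠ hi i := fun e => h1 (by rw [← (cap i D).invol y, e, cap_hi])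
    simp only [lo, hi, ne_eq, Fin.ext_iff] at h1 h2 h3 h4
    rw [if_neg (by omega), if_neg (by omega), sub_zero, zero_smul, add_zero]
  have hw : ∀ D, ExteriorAlgebra.ι ℂ r * openWedge κ θ D = fullWedge κ θ D :=
    ι_altSum_mul_openWedge hn hκ θ
  set y := ExteriorAlgebra.map (pointTransvection i) (openWedge κ θ D) - (openWedge κ θ D +
    if D.partner (lo i) = hi i then 0 else κ • openWedge κ θ (cap i D)) with hy
  have hry : ExteriorAlgebra.ι ℂ r * y = 0 := by
    have h1 : ExteriorAlgebra.ι ℂ r * ExteriorAlgebra.map (pointTransvection i) (openWedge κ θ D) =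
        ExteriorAlgebra.map (pointTransvection i) (fullWedge κ θ D) := by
      rw [← hw, map_mul, ExteriorAlgebra.map_apply_ι, hτr]
    rw [hy, mul_sub, h1, hfull, mul_add, hw]
    split_ifs
    · simp
    · rw [mul_smul_comm, hw, sub_self]
  -- hence it holds modulo `r`
  have hφ : Finsupp.lapply (R := ℂ) 0 r = (1 : ℂ) := by
    rw [hr, altSum, map_sum, Finset.sum_eq_single ⟨0, by omega⟩]
    · simp [hθ]
    · intro b _ hb
      rw [ne_eq, Fin.ext_iff] at hb
      simp [hθ, Finsupp.single_apply]
      intro h; exact absurd h hb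
    · simp
  have hπ : ExteriorAlgebra.map (potentialMap n) y = 0 := by
    have h1 := contr_ι_mul (Finsupp.lapply (R := ℂ) 0) r y
    rw [hry, map_zero, hφ, one_smul, eq_comm, sub_eq_zero] at h1
    rw [h1, map_mul, ExteriorAlgebra.map_apply_ι]
    have h2 : potentialMap n r = 0 := by
      rw [← altSum_potential (n := n), hr, altSum, altSum, map_sum]
      refine Finset.sum_congr rfl fun y _ => ?_
      rw [map_smul, hθ, potentialMap_single]
    rw [h2, map_zero, zero_mul]
  have hmap : ∀ D : ArcDiagram (2 * n), ExteriorAlgebra.map (potentialMap n) (openWedge κ θ D) =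
      openWedge κ (potential n) D := fun D => by
    rw [map_openWedge (potentialMap n) κ θ D]; simp only [hθ, potentialMap_single]
  have hcomm : ExteriorAlgebra.map (pushforward (surfaceAut n (Braid.σ i)))
        (ExteriorAlgebra.map (potentialMap n) (openWedge κ θ D)) =
      ExteriorAlgebra.map (potentialMap n)
        (ExteriorAlgebra.map (pointTransvection i) (openWedge κ θ D)) := by
    simp only [← AlgHom.comp_apply, ExteriorAlgebra.map_comp_map]
    have e1 := map_seg (G := openFactor κ θ D) (ExteriorAlgebra.map (pushforward
      (surfaceAut n (Braid.σ i)) ∘ₗ potentialMap n)).toRingHom.toMonoidHom 0 (2 * n)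
    have e2 := map_seg (G := openFactor κ θ D) (ExteriorAlgebra.map (potentialMap n ∘ₗ
      pointTransvection i)).toRingHom.toMonoidHom 0 (2 * n)
    refine e1.trans ((seg_congr fun y _ hy => ?_).trans e2.symm)
    change ExteriorAlgebra.map _ (openFactor κ θ D y) = ExteriorAlgebra.map _ (openFactor κ θ D y)
    rw [openFactor]
    split_ifs
    · rw [ExteriorAlgebra.map_apply_ι, ExteriorAlgebra.map_apply_ι]
      simp only [LinearMap.comp_apply, map_smul]
      rw [pushforward_potentialMap i hy (D.pt_lt hn y)]
    · rw [map_one, map_one]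
  rw [hy, map_sub, sub_eq_zero, ← hcomm, hmap, map_add, hmap] at hπ
  rw [hπ]
  split_ifs
  · rw [map_zero]
  · rw [map_smul, hmap]

end OpenWedge

/-! ### The symplectic structure of the homology -/

section Symplectic

variable {n : ℕ}

/-- The intersection number `⟨c_i, c_j⟩` of two curves of the chain. -/
def chainPairing (i j : ℕ) : ℂ := (if j = i + 1 then 1 else 0) - if j + 1 = i then 1 else 0

theorem sum_chainPairing (i j : ℕ) : ∑ k ∈ Finset.range j, chainPairing i (2 * k) =
    if i % 2 = 0 then 0 else
      (if i < 2 * j - 1 then 1 else 0) - if i < 2 * j then 1 else 0 := by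
  induction j with
  | zero => simp
  | succ j ih =>
    rw [Finset.sum_range_succ, ih, chainPairing]
    rcases lt_trichotomy (i + 1) (2 * j) with h | h | h <;> split_ifs <;> first | omega | norm_num

theorem exists_intersection (n i : ℕ) (hi : i < 2 * n - 1) :
    ∃ φ : H1 n →ₗ[ℂ] ℂ, ∀ k < 2 * n - 1, φ (chainClass n k) = chainPairing i k := by
  refine exists_functional n (chainPairing i) ?_
  rw [sum_chainPairing]
  split_ifs <;> first | omega | simp

/-- The functional `⟨c_i, ·⟩` given by the intersection pairing. -/
noncomputable def intersection (n i : ℕ) : H1 n →ₗ[ℂ] ℂ :=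
  if h : i < 2 * n - 1 then (exists_intersection n i h).choose else 0

theorem intersection_chainClass {i j : ℕ} (hi : i < 2 * n - 1) (hj : j < 2 * n - 1) :
    intersection n i (chainClass n j) = chainPairing i j := by
  rw [intersection, dif_pos hi]
  exact (exists_intersection n i hi).choose_spec j hj

theorem sum_intersection_chainClass {i j : ℕ} (hi : i ≤ n) (hj : j < 2 * n - 1) :
    ∑ k ∈ Finset.range i, intersection n (2 * k) (chainClass n j) =
      ∑ k ∈ Finset.range i, chainPairing (2 * k) j := by
  refine Finset.sum_congr rfl fun k hk => ?_
  rw [Finset.mem_range] at hk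
  exact intersection_chainClass (by omega) hj

theorem chainPairing_comm (i j : ℕ) : chainPairing i j = -chainPairing j i := by
  simp only [chainPairing, eq_comm (a := j) (b := i + 1), eq_comm (a := j + 1) (b := i)]
  ring

theorem intersection_aCycle {i j : ℕ} (hi : i < 2 * n - 1) (hj : j ≤ n) :
    intersection n i (aCycle n j) = ∑ k ∈ Finset.range j, chainPairing i (2 * k) := by
  rw [aCycle, map_sum]
  refine Finset.sum_congr rfl fun k hk => ?_
  rw [Finset.mem_range] at hk
  exact intersection_chainClass hi (by omega)

theorem chainClass_two_mul (k : ℕ) : chainClass n (2 * k) = aCycle n (k + 1) - aCycle n k := by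
  rw [aCycle, aCycle, Finset.sum_range_succ]; abel

/-- The values of the coordinates with respect to the symplectic basis. -/
theorem coordinates_aCycle {j k : ℕ} (hj : j < n - 1) (hk : k ≤ n) :
    (-intersection n (2 * j + 1)) (aCycle n k) = (if k = j + 1 then 1 else 0) ∧
    (∑ k ∈ Finset.range (j + 1), intersection n (2 * k)) (aCycle n k) = 0 := by
  constructor
  · rw [LinearMap.neg_apply, intersection_aCycle (by omega) (by omega), sum_chainPairing]
    split_ifs <;> first | omega | norm_num
  · rw [LinearMap.sum_apply]
    refine Finset.sum_eq_zero fun l hl => ?_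
    rw [Finset.mem_range] at hl
    rw [intersection_aCycle (by omega) (by omega), sum_chainPairing, if_pos (by omega)]

theorem coordinates_bCycle {j k : ℕ} (hj : j < n - 1) (hk : k < n - 1) :
    (-intersection n (2 * j + 1)) (bCycle n k) = 0 ∧
    (∑ k ∈ Finset.range (j + 1), intersection n (2 * k)) (bCycle n k) =
      if j = k then 1 else 0 := by
  constructor
  · rw [LinearMap.neg_apply, bCycle, intersection_chainClass (by omega) (by omega), chainPairing]
    split_ifs <;> first | omega | norm_num
  · rw [LinearMap.sum_apply, bCycle, sum_intersection_chainClass (by omega) (by omega),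
      Finset.sum_congr rfl fun l _ => chainPairing_comm (2 * l) (2 * k + 1),
      Finset.sum_neg_distrib, sum_chainPairing]
    split_ifs <;> first | omega | norm_num

/-- The resolution of the identity for the symplectic basis. -/
theorem sum_coordinates (hn : 1 ≤ n) :
    ∑ j ∈ Finset.range (n - 1), ((-intersection n (2 * j + 1)).smulRight (aCycle n (j + 1)) +
      (∑ k ∈ Finset.range (j + 1), intersection n (2 * k)).smulRight (bCycle n j)) =
      LinearMap.id := by
  have ha : ∀ k ≤ n, (∑ j ∈ Finset.range (n - 1), ((-intersection n (2 * j + 1)).smulRight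
      (aCycle n (j + 1)) + (∑ k ∈ Finset.range (j + 1), intersection n (2 * k)).smulRight
        (bCycle n j))) (aCycle n k) = aCycle n k := by
    intro k hk
    rw [LinearMap.sum_apply]
    have e : ∀ j ∈ Finset.range (n - 1), ((-intersection n (2 * j + 1)).smulRight
        (aCycle n (j + 1)) + (∑ k ∈ Finset.range (j + 1), intersection n (2 * k)).smulRight
        (bCycle n j)) (aCycle n k) = if k = j + 1 then aCycle n k else 0 := by
      intro j hj
      rw [Finset.mem_range] at hj
      rw [LinearMap.add_apply, LinearMap.smulRight_apply, LinearMap.smulRight_apply,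
        (coordinates_aCycle hj hk).1, (coordinates_aCycle hj hk).2]
      split_ifs with h
      · rw [h]; simp
      · simp
    rw [Finset.sum_congr rfl e]
    by_cases h0 : k = 0
    · rw [h0]; simp [aCycle]
    by_cases h1 : k = n
    · rw [h1, aCycle_top]; simp
    rw [Finset.sum_eq_single (k - 1), if_pos (by omega)]
    · intro j _ hj; rw [if_neg (by omega)]
    · intro h; exact absurd (Finset.mem_range.2 (by omega)) h
  refine linearMap_ext_chainClass hn fun k hk => ?_
  rw [LinearMap.id_apply]
  rcases Nat.even_or_odd' k with ⟨l, rfl | rfl⟩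
  · rw [chainClass_two_mul, map_sub, ha _ (by omega), ha _ (by omega)]
  · change _ = bCycle n l
    rw [LinearMap.sum_apply, Finset.sum_eq_single l]
    · rw [LinearMap.add_apply, LinearMap.smulRight_apply, LinearMap.smulRight_apply,
        show chainClass n (2 * l + 1) = bCycle n l from rfl,
        (coordinates_bCycle (by omega) (by omega)).1,
        (coordinates_bCycle (by omega) (by omega)).2, if_pos rfl, zero_smul, zero_add, one_smul]
    · intro j hj hjl
      rw [Finset.mem_range] at hj
      rw [LinearMap.add_apply, LinearMap.smulRight_apply, LinearMap.smulRight_apply,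
        show chainClass n (2 * l + 1) = bCycle n l from rfl,
        (coordinates_bCycle hj (by omega)).1, (coordinates_bCycle hj (by omega)).2, if_neg hjl]
      simp
    · intro h; exact absurd (Finset.mem_range.2 (by omega)) h

/-- The symplectic basis `a_1, b_1, …, a_g, b_g` of the homology. -/
noncomputable def symplecticBasis (hn : 1 ≤ n) : SymplecticData (H1 n) (n - 1) where
  a j := aCycle n (j + 1)
  b j := bCycle n j
  α j := -intersection n (2 * j + 1)
  β j := ∑ k ∈ Finset.range (j + 1), intersection n (2 * k)
  α_a j hj k hk := by
    rw [(coordinates_aCycle hj (by omega)).1]; simp only [Nat.add_right_cancel_iff, eq_comm]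
  α_b j hj k hk := (coordinates_bCycle hj hk).1
  β_a j hj k hk := (coordinates_aCycle hj (by omega)).2
  β_b j hj k hk := (coordinates_bCycle hj hk).2
  sum_eq u := by
    have := LinearMap.congr_fun (sum_coordinates hn) u
    rw [LinearMap.sum_apply] at this
    exact this

theorem bivector_symplecticBasis (hn : 1 ≤ n) : (symplecticBasis hn).bivector = omega n := rfl

theorem pairing_sub {M : Type*} [AddCommGroup M] [Module ℂ M] {g : ℕ} (S : SymplecticData M g)
    (u v : M) : S.pairing (u - v) = S.pairing u - S.pairing v := by
  simp only [SymplecticData.pairing, ← Finset.sum_sub_distrib, map_sub]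
  exact Finset.sum_congr rfl fun j _ => by module

theorem pairing_sum {M : Type*} [AddCommGroup M] [Module ℂ M] {g : ℕ} (S : SymplecticData M g)
    {ι : Type*} (s : Finset ι) (u : ι → M) :
    S.pairing (∑ k ∈ s, u k) = ∑ k ∈ s, S.pairing (u k) := by
  simp only [SymplecticData.pairing, map_sum, Finset.sum_smul, ← Finset.sum_sub_distrib]
  rw [Finset.sum_comm]

theorem pairing_aCycle (hn : 1 ≤ n) {k : ℕ} (hk : k ≤ n) :
    (symplecticBasis hn).pairing (aCycle n k) = ∑ l ∈ Finset.range k, intersection n (2 * l) := by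
  by_cases h0 : k = 0
  · rw [h0]; simp [aCycle, SymplecticData.pairing]
  by_cases h1 : k = n
  · rw [h1, aCycle_top]
    refine linearMap_ext_chainClass hn fun j hj => ?_
    rw [LinearMap.sum_apply, sum_intersection_chainClass le_rfl hj,
      Finset.sum_congr rfl fun l _ => chainPairing_comm (2 * l) j, Finset.sum_neg_distrib,
      sum_chainPairing]
    simp only [SymplecticData.pairing, map_zero, zero_smul, sub_zero, Finset.sum_const_zero,
      LinearMap.zero_apply]
    split_ifs <;> first | omega | norm_num
  · obtain ⟨l, rfl⟩ : ∃ l, k = l + 1 := ⟨k - 1, by omega⟩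
    exact (symplecticBasis hn).pairing_a l (by omega)

/-- The pairing of curves of the chain is given by their intersection numbers. -/
theorem pairing_chainClass (hn : 1 ≤ n) {k : ℕ} (hk : k < 2 * n - 1) :
    (symplecticBasis hn).pairing (chainClass n k) = intersection n k := by
  rcases Nat.even_or_odd' k with ⟨l, rfl | rfl⟩
  · rw [chainClass_two_mul, pairing_sub, pairing_aCycle hn (by omega), pairing_aCycle hn (by omega),
      Finset.sum_range_succ]
    abel
  · exact ((symplecticBasis hn).pairing_b l (by omega)).trans (neg_neg _)

/-- The intersection number of the classes of the intervals `[a, b]` and `[c, d]`. It vanishes if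
the intervals are disjoint or one lies in the interior of the other. -/
theorem pairing_Ico (hn : 1 ≤ n) {a b c d : ℕ} (hb : b < 2 * n) (hcd : c ≤ d) (hd : d < 2 * n) :
    (symplecticBasis hn).pairing (∑ j ∈ Finset.Ico a b, chainClass n j)
      (∑ j ∈ Finset.Ico c d, chainClass n j) =
    (if a < c ∧ c ≤ b then 1 else 0) + (if a ≤ c ∧ c < b then 1 else 0) -
      (if a < d ∧ d ≤ b then 1 else 0) - if a ≤ d ∧ d < b then 1 else 0 := by
  have h : ∀ j < 2 * n - 1, (symplecticBasis hn).pairing (∑ j ∈ Finset.Ico a b, chainClass n j)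
      (chainClass n j) =
        (if a < j ∧ j ≤ b then 1 else 0) - if a ≤ j + 1 ∧ j + 1 < b then 1 else 0 := by
    intro j hj
    rw [pairing_sum, LinearMap.sum_apply]
    have e : ∀ k ∈ Finset.Ico a b, (symplecticBasis hn).pairing (chainClass n k) (chainClass n j) =
        (if j = k + 1 then 1 else 0) - if k = j + 1 then 1 else 0 := by
      intro k hk
      rw [Finset.mem_Ico] at hk
      rw [pairing_chainClass hn (by omega), intersection_chainClass (by omega) hj, chainPairing]
      simp only [eq_comm]
    rw [Finset.sum_congr rfl e, Finset.sum_sub_distrib]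
    congr 1
    · cases j with
      | zero => simp
      | succ j =>
        simp only [Nat.add_right_cancel_iff, Finset.sum_ite_eq, Finset.mem_Ico]
        congr 1
        rw [eq_iff_iff]; omega
    · simp only [Finset.sum_ite_eq', Finset.mem_Ico]
  induction d, hcd using Nat.le_induction with
  | base => rw [Finset.Ico_self, Finset.sum_empty, map_zero]; ring
  | succ d hcd ih =>
    rw [Finset.sum_Ico_succ_top hcd, map_add, ih (by omega), h d (by omega)]
    simp only [Nat.lt_succ_iff, Nat.succ_le_iff]
    ring

end Symplectic

/-! ### Normalisation of the wedges -/

section Normalisation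

variable {n : ℕ}

theorem prod_map_filter {ι R : Type*} [Monoid R] (l : List ι) (p : ι → Prop) [DecidablePred p]
    (f : ι → R) : ((l.filter fun k => p k).map f).prod =
      (l.map fun k => if p k then f k else 1).prod := by
  induction l with
  | nil => rfl
  | cons a l ih =>
    rw [List.filter_cons, List.map_cons, List.prod_cons, ← ih]
    by_cases h : p a <;> simp [h]

/-- The arc from `y` to its partner belongs to the diagram obtained from `D` by removing the last
point. -/
def ArcDiagram.IsArc (D : ArcDiagram (2 * n)) (y : Fin (2 * n)) : Prop :=
  y < D.partner y ∧ (D.partner y : ℕ) + 1 ≠ 2 * n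

instance (D : ArcDiagram (2 * n)) : DecidablePred D.IsArc := fun _ => instDecidableAnd

theorem prod_arcs {R : Type*} [Monoid R] (D : ArcDiagram (2 * n)) (f : Fin (2 * n) → R) :
    ((arcs D).map f).prod =
      ((List.finRange (2 * n)).map fun k => if D.IsArc k then f k else 1).prod :=
  prod_map_filter _ D.IsArc f

theorem sum_arcs {R : Type*} [AddCommMonoid R] (D : ArcDiagram (2 * n)) (f : Fin (2 * n) → R) :
    ((arcs D).map f).sum = ∑ k ∈ Finset.univ.filter D.IsArc, f k := by
  rw [Finset.sum_filter, Fin.sum_univ_def]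
  exact prod_arcs (R := Multiplicative R) D f

/-- For the classes `potential`, the wedge is the ordered product of the arc classes of `D`,
scaled by the powers of `κ` given by their starting points. -/
theorem openWedge_potential (κ : ℂ) (D : ArcDiagram (2 * n)) :
    openWedge κ (potential n) D =
      ((arcs D).map fun k : Fin (2 * n) =>
        ExteriorAlgebra.ι ℂ (κ ^ (k : ℕ) • arcClass D k)).prod := by
  rw [prod_arcs, openWedge, seg, Nat.sub_zero, ← List.range_eq_range',
    ← List.map_coe_finRange_eq_range, List.map_map]
  congr 1
  refine List.map_congr_left fun k _ => ?_
  rw [Function.comp_apply, openFactor, D.pt_val]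
  by_cases h : D.IsArc k
  · rw [if_pos h]
    refine (if_pos h).trans ?_
    rw [potential_sub (Fin.lt_def.1 h.1).le]; rfl
  · rw [if_neg h]; exact if_neg h

theorem prod_map_smul {ι R : Type*} [Ring R] [Algebra ℂ R] (l : List ι) (c : ι → ℂ) (f : ι → R) :
    (l.map fun k => c k • f k).prod = (l.map c).prod • (l.map f).prod := by
  induction l with
  | nil => simp
  | cons a l ih => simp only [List.map_cons, List.prod_cons, ih, smul_mul_smul_comm]

theorem openWedge_I (D : ArcDiagram (2 * n)) :
    openWedge Complex.I (potential n) D =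
      Complex.I ^ ((arcs D).map fun k : Fin (2 * n) => (k : ℕ)).sum •
        ((arcs D).map fun k => ExteriorAlgebra.ι ℂ (arcClass D k)).prod := by
  rw [openWedge_potential]
  simp only [map_smul]
  rw [prod_map_smul]
  congr 1
  induction arcs D with
  | nil => simp
  | cons a l ih => simp only [List.map_cons, List.prod_cons, List.sum_cons, pow_add, ih]

theorem arcW_eq (D : ArcDiagram (2 * n)) {k : Fin (2 * n)} (hk : k < D.partner k) :
    (D.partner k : ℕ) = k + 1 + 2 * arcW D k := by
  rw [D.arc_eq rfl hk, arcW, ArcDiagram.arcCount]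
  congr 3
  ext l
  simp only [Finset.mem_filter, Finset.mem_univ, true_and]
  constructor
  · rintro ⟨⟨h1, h2⟩, h3⟩
    refine ⟨by rw [Fin.lt_def]; omega, h3, (D.closed_arc rfl hk l ⟨h1, h2⟩).2⟩
  · rintro ⟨h1, h2, h3⟩
    exact ⟨⟨h1, lt_trans h2 h3⟩, h2⟩

variable {p l : Fin (2 * n)}

theorem arcV_eq (D : ArcDiagram (2 * n)) (hl : (l : ℕ) + 1 = 2 * n) (hp : D.partner l = p)
    (k : Fin (2 * n)) : arcV D k = if D.partner k < p then 1 else 0 := by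
  have e : ∀ y : Fin (2 * n), (D.partner y : ℕ) + 1 = 2 * n ↔ y = p := fun y =>
    ⟨fun h => by rw [← hp, ← D.invol y, Fin.ext (show (D.partner y : ℕ) = l by omega)],
      fun h => by rw [h, ← hp, D.invol, hl]⟩
  simp only [arcV, e]
  split_ifs with h
  · rw [Finset.card_eq_one]
    refine ⟨p, ?_⟩
    ext y
    simp only [Finset.mem_filter, Finset.mem_univ, true_and, Finset.mem_singleton]
    exact ⟨fun hy => hy.2, fun hy => ⟨by rw [hy]; exact h, hy⟩⟩
  · rw [Finset.card_eq_zero, Finset.filter_eq_empty_iff]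
    rintro y - ⟨h1, h2⟩
    rw [h2] at h1
    exact h h1

theorem lt_last (D : ArcDiagram (2 * n)) (hl : (l : ℕ) + 1 = 2 * n) (hp : D.partner l = p) :
    p < l := by
  have h1 : p ≠ l := hp ▸ D.ne l
  rw [ne_eq, Fin.ext_iff] at h1
  rw [Fin.lt_def]
  omega

/-- All the arcs of a diagram: the one ending in the last point, and the others. -/
theorem filter_lt_partner (D : ArcDiagram (2 * n)) (hl : (l : ℕ) + 1 = 2 * n)
    (hp : D.partner l = p) : Finset.univ.filter (fun k : Fin (2 * n) => k < D.partner k) =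
      insert p (Finset.univ.filter D.IsArc) := by
  have hpl : D.partner p = l := by rw [← hp, D.invol]
  ext k
  simp only [Finset.mem_filter, Finset.mem_univ, true_and, Finset.mem_insert, ArcDiagram.IsArc]
  constructor
  · intro h
    by_cases h1 : (D.partner k : ℕ) + 1 = 2 * n
    · left
      rw [← hp, ← D.invol k, Fin.ext (show (D.partner k : ℕ) = l by omega)]
    · exact Or.inr ⟨h, h1⟩
  · rintro (rfl | h)
    · rw [hpl]; exact lt_last D hl hp
    · exact h.1

theorem notMem_filter_isArc (D : ArcDiagram (2 * n)) (hl : (l : ℕ) + 1 = 2 * n)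
    (hp : D.partner l = p) : p ∉ Finset.univ.filter D.IsArc := by
  have hpl : D.partner p = l := by rw [← hp, D.invol]
  rw [Finset.mem_filter, ArcDiagram.IsArc, hpl]
  exact fun h => h.2.2 hl

theorem card_isArc (hn : 1 ≤ n) (D : ArcDiagram (2 * n)) :
    (Finset.univ.filter D.IsArc).card = n - 1 := by
  have h1 := D.closed_univ.sub_eq le_rfl
  have h2 : D.arcCount 0 (2 * n) =
      (Finset.univ.filter (fun k : Fin (2 * n) => k < D.partner k)).card := by
    rw [ArcDiagram.arcCount]
    congr 1
    ext k
    simp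
  rw [h2, filter_lt_partner D (l := ⟨2 * n - 1, by omega⟩) (by simp; omega) rfl,
    Finset.card_insert_of_notMem (notMem_filter_isArc D (by simp; omega) rfl)] at h1
  omega

/-- The sum of the numbers `w(e) + v(e)` and of the starting points of the arcs does not depend on
the diagram. -/
theorem sum_exponent (hn : 1 ≤ n) (D : ArcDiagram (2 * n)) :
    ((arcs D).map fun k => arcW D k + arcV D k).sum +
      ((arcs D).map fun k : Fin (2 * n) => (k : ℕ)).sum = (n - 1) ^ 2 := by
  obtain ⟨l, hl⟩ : ∃ l : Fin (2 * n), (l : ℕ) + 1 = 2 * n := ⟨⟨2 * n - 1, by omega⟩, by simp; omega⟩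
  obtain ⟨p, hp⟩ : ∃ p, D.partner l = p := ⟨_, rfl⟩
  have hpl : D.partner p = l := by rw [← hp, D.invol]
  rw [sum_arcs, sum_arcs, Finset.sum_add_distrib]
  have h1 := sum_eq_sum_arcs D (fun _ => True) (fun _ _ => trivial) fun k => (k : ℕ)
  simp only [Finset.filter_true, true_and] at h1
  rw [filter_lt_partner D hl hp, Finset.sum_insert (notMem_filter_isArc D hl hp), hpl,
    Fin.sum_univ_eq_sum_range (fun k => k)] at h1
  have h2 := Finset.sum_range_id_mul_two (2 * n)
  have h3 : ∑ k ∈ Finset.univ.filter D.IsArc, ((k : ℕ) + (D.partner k : ℕ)) =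
      ∑ k ∈ Finset.univ.filter D.IsArc, (2 * (k : ℕ) + 2 * arcW D k + 1) := by
    refine Finset.sum_congr rfl fun k hk => ?_
    rw [arcW_eq D (Finset.mem_filter.1 hk).2.1]
    ring
  rw [Finset.sum_add_distrib, Finset.sum_add_distrib (f := fun k : Fin (2 * n) => 2 * (k : ℕ)
    + 2 * arcW D k), Finset.sum_add_distrib (f := fun k : Fin (2 * n) => 2 * (k : ℕ)),
    ← Finset.mul_sum, ← Finset.mul_sum, ← Finset.card_eq_sum_ones, card_isArc hn] at h3
  rw [Finset.sum_add_distrib] at h1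
  have hcl := D.closed_left hl hpl
  have h4 : ∑ k ∈ Finset.univ.filter D.IsArc, arcV D k = D.arcCount 0 p := by
    simp only [arcV_eq D hl hp]
    rw [← Finset.card_filter, Finset.filter_filter, ArcDiagram.arcCount]
    refine congrArg Finset.card (Finset.ext fun k => ?_)
    rw [Finset.mem_filter, Finset.mem_filter, ArcDiagram.IsArc]
    simp only [Finset.mem_univ, true_and, Nat.zero_le]
    constructor
    · rintro ⟨⟨h5, h6⟩, h7⟩
      exact ⟨Fin.lt_def.1 (lt_trans h5 h7), h5⟩
    · rintro ⟨h5, h6⟩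
      have h7 := (hcl k ⟨Nat.zero_le _, h5⟩).2
      exact ⟨⟨h6, by omega⟩, h7⟩
  have h5 := hcl.sub_eq p.2.le
  obtain ⟨m, rfl⟩ : ∃ m, n = m + 1 := ⟨n - 1, by omega⟩
  rw [show 2 * (m + 1) - 1 = 2 * m + 1 by omega] at h2
  rw [Nat.add_sub_cancel] at h3 ⊢
  rw [show 2 * (m + 1) * (2 * m + 1) = 4 * m ^ 2 + 6 * m + 2 by ring] at h2
  generalize m ^ 2 = q at *
  omega

/-- The factor is the same for all diagrams, because of `sum_exponent`. -/
theorem scaledWedge_eq (hn : 1 ≤ n) (D : ArcDiagram (2 * n)) :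
    scaledWedge D = (-Complex.I) ^ ((n - 1) ^ 2) • openWedge Complex.I (potential n) D := by
  rw [openWedge_I, scaledWedge, smul_smul, ← sum_exponent hn D, pow_add, mul_assoc, ← mul_pow]
  simp

end Normalisation

/-! ### Linear independence of the wedges -/

section Independence

variable {n : ℕ}

/-- The arc ending in the last point is determined by the starting points of the other arcs. -/
theorem not_lt_of_isArc_iff {D D' : ArcDiagram (2 * n)} (h : ∀ y, D.IsArc y ↔ D'.IsArc y)
    {l p p' : Fin (2 * n)} (hl : (l : ℕ) + 1 = 2 * n) (hp : D.partner l = p)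
    (hp' : D'.partner l = p') : ¬ p < p' := by
  intro hlt
  have hpl : D.partner p = l := by rw [← hp, D.invol]
  have hA : ∀ (D : ArcDiagram (2 * n)) (q : Fin (2 * n)), D.partner l = q → ∀ y < q,
      (D.word y = false ↔ D.IsArc y) := by
    intro D q hq y hy
    have h1 := congrArg (fun s => y ∈ s) (filter_lt_partner D hl hq)
    simp only [Finset.mem_filter, Finset.mem_univ, true_and, Finset.mem_insert, hy.ne,
      false_or] at h1
    rw [ArcDiagram.word_eq_false, h1]
  have h0 : height D.word p = 0 := by
    rw [(D.closed_left hl hpl).height_eq (Nat.zero_le _) p.2.le D.compatible_word, height_zero]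
  have h1 : height D'.word p = height D.word p := by
    rw [height_eq_add_sum _ 0 p (Nat.zero_le _) p.2.le,
      height_eq_add_sum D.word 0 p (Nat.zero_le _) p.2.le, height_zero, height_zero]
    congr 1
    refine Finset.sum_congr rfl fun y hy => ?_
    have hy' : y < p := (Finset.mem_filter.1 hy).2.2
    have e : D'.word y = D.word y := by
      have h2 := hA D p hp y hy'
      have h3 := hA D' p' hp' y (hy'.trans hlt)
      rw [← h y, ← h2] at h3
      cases e1 : D.word y <;> cases e2 : D'.word y <;> simp_all
    rw [e]
  have h2 : D'.word p = true := by
    rw [← Bool.not_eq_false, hA D' p' hp' p hlt, ← h p, ArcDiagram.IsArc, hpl]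
    exact fun h => h.2 hl
  have h3 := height_succ D'.word p
  have h4 := ((isStandard_iff D'.word).1 D'.isStandard_word).1 (p + 1) p.2
  rw [h1, h0, h2, if_pos rfl] at h3
  omega

theorem ext_of_isArc (hn : 1 ≤ n) {D D' : ArcDiagram (2 * n)} (h : ∀ y, D.IsArc y ↔ D'.IsArc y) :
    D = D' := by
  obtain ⟨l, hl⟩ : ∃ l : Fin (2 * n), (l : ℕ) + 1 = 2 * n := ⟨⟨2 * n - 1, by omega⟩, by simp; omega⟩
  have hp : D'.partner l = D.partner l := le_antisymm
    (not_lt.1 (not_lt_of_isArc_iff h hl rfl rfl))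
    (not_lt.1 (not_lt_of_isArc_iff (fun y => (h y).symm) hl rfl rfl))
  refine ArcDiagram.ext_of_openers fun y => ?_
  have h1 := congrArg (fun s => y ∈ s) (filter_lt_partner D hl rfl)
  have h2 := congrArg (fun s => y ∈ s) (filter_lt_partner D' hl hp)
  simp only [Finset.mem_filter, Finset.mem_univ, true_and, Finset.mem_insert] at h1 h2
  rw [h1, h2, h y]

theorem mem_arcs (D : ArcDiagram (2 * n)) (y : Fin (2 * n)) : y ∈ arcs D ↔ D.IsArc y := by
  simp [arcs, ArcDiagram.IsArc]

theorem length_arcs (hn : 1 ≤ n) (D : ArcDiagram (2 * n)) : (arcs D).length = n - 1 := by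
  have := sum_arcs D fun _ => 1
  rw [← Finset.card_eq_sum_ones, card_isArc hn] at this
  simpa using this

/-- The starting points of the arcs, in increasing order. -/
def arcStart (hn : 1 ≤ n) (D : ArcDiagram (2 * n)) (k : Fin (n - 1)) : Fin (2 * n) :=
  (arcs D).get (k.cast (length_arcs hn D).symm)

theorem arcStart_strictMono (hn : 1 ≤ n) (D : ArcDiagram (2 * n)) : StrictMono (arcStart hn D) := by
  have h : (arcs D).SortedLT := ((List.sortedLT_finRange _).pairwise.filter _).sortedLT
  exact h.strictMono_get.comp (Fin.cast_strictMono _)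

theorem isArc_iff (hn : 1 ≤ n) (D : ArcDiagram (2 * n)) (y : Fin (2 * n)) :
    D.IsArc y ↔ ∃ k, arcStart hn D k = y := by
  rw [← mem_arcs, List.mem_iff_get]
  exact ⟨fun ⟨k, hk⟩ => ⟨k.cast (length_arcs hn D), hk⟩, fun ⟨k, hk⟩ => ⟨_, hk⟩⟩

theorem ofFn_arcStart {R : Type*} (hn : 1 ≤ n) (D : ArcDiagram (2 * n)) (f : Fin (2 * n) → R) :
    (List.ofFn fun k => f (arcStart hn D k)) = (arcs D).map f := by
  have : ∀ (N : ℕ) (l : List (Fin (2 * n))) (h : N = l.length),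
      (List.ofFn fun k : Fin N => f (l.get (k.cast h))) = l.map f := by
    rintro N l rfl
    simp
  exact this _ _ _

/-- The wedge of the arcs, as an element of the exterior power. -/
noncomputable def arcElement (hn : 1 ≤ n) (κ : ℂ) (D : ArcDiagram (2 * n)) : ⋀[ℂ]^(n - 1) (H1 n) :=
  exteriorPower.ιMulti ℂ (n - 1) fun k =>
    κ ^ (arcStart hn D k : ℕ) • arcClass D (arcStart hn D k)

theorem coe_arcElement (hn : 1 ≤ n) (κ : ℂ) (D : ArcDiagram (2 * n)) :
    (arcElement hn κ D : ExteriorAlgebra ℂ (H1 n)) = openWedge κ (potential n) D := by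
  rw [openWedge_potential, ← ofFn_arcStart hn]
  rfl

/-- The functionals dual to the first `2g` curves of the chain. -/
noncomputable def dualChain (n k : ℕ) : H1 n →ₗ[ℂ] ℂ :=
  if h : k < 2 * n - 2 then (exists_dualChain n k h).choose else 0

theorem dualChain_arcClass {D : ArcDiagram (2 * n)} {k : ℕ} {y : Fin (2 * n)}
    (hk : k < 2 * n - 2) (hy : D.IsArc y) :
    dualChain n k (arcClass D y) = if (y : ℕ) ≤ k ∧ k < D.partner y then 1 else 0 := by
  have h2 := (D.partner y).2
  have h3 := hy.2
  rw [dualChain, dif_pos hk, arcClass, map_sum]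
  have e : ∀ j ∈ Finset.Ico (y : ℕ) (D.partner y), (exists_dualChain n k hk).choose
      (chainClass n j) = if k = j then 1 else 0 := fun j hj => by
    rw [Finset.mem_Ico] at hj
    exact (exists_dualChain n k hk).choose_spec j (by omega)
  rw [Finset.sum_congr rfl e, Finset.sum_ite_eq]
  simp only [Finset.mem_Ico]

theorem arcStart_lt (hn : 1 ≤ n) (D : ArcDiagram (2 * n)) (k : Fin (n - 1)) :
    (arcStart hn D k : ℕ) < 2 * n - 2 := by
  have h := (isArc_iff hn D _).2 ⟨k, rfl⟩
  have h1 := Fin.lt_def.1 h.1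
  have h2 := h.2
  have h3 := (D.partner (arcStart hn D k)).2
  omega

/-- The wedges of different diagrams are linearly independent: the determinants of the coordinates
at the starting points of the arcs form a triangular matrix with respect to the sum of the starting
points. -/
theorem linearIndependent_arcElement (hn : 1 ≤ n) {κ : ℂ} (hκ : κ ≠ 0) :
    LinearIndependent ℂ (arcElement hn κ) := by
  refine linearIndependent_of_triangular _
    (fun D => exteriorPower.pairingDual ℂ (H1 n) (n - 1)
      (exteriorPower.ιMulti ℂ (n - 1) fun k => dualChain n (arcStart hn D k)))
    (fun D => ∑ k, (arcStart hn D k : ℕ)) (fun D => ?_) fun D D' h => ?_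
  · rw [arcElement, exteriorPower.pairingDual_ιMulti_ιMulti, Matrix.det_of_isUpperTriangular]
    · refine Finset.prod_ne_zero_iff.2 fun k _ => ?_
      have hk := (isArc_iff hn D _).2 ⟨k, rfl⟩
      rw [Matrix.of_apply, map_smul, dualChain_arcClass (arcStart_lt hn D k) hk,
        if_pos ⟨le_rfl, Fin.lt_def.1 hk.1⟩, smul_eq_mul, mul_one]
      exact pow_ne_zero _ hκ
    · intro i j hij
      rw [Matrix.of_apply, map_smul, dualChain_arcClass (arcStart_lt hn D _)
        ((isArc_iff hn D _).2 ⟨i, rfl⟩), if_neg, smul_zero]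
      exact fun h => absurd (arcStart_strictMono hn D hij) (not_lt.2 h.1)
  · rw [arcElement, exteriorPower.pairingDual_ιMulti_ιMulti, Matrix.det_apply] at h
    obtain ⟨s, -, hs⟩ := Finset.exists_ne_zero_of_sum_ne_zero h
    have hs' : ∀ i, (arcStart hn D' (s i) : ℕ) ≤ arcStart hn D i := by
      intro i
      by_contra hlt
      refine hs ?_
      rw [Finset.prod_eq_zero (Finset.mem_univ i), smul_zero]
      rw [Matrix.of_apply, map_smul, dualChain_arcClass (arcStart_lt hn D _)
        ((isArc_iff hn D' _).2 ⟨s i, rfl⟩), if_neg (fun h => hlt h.1), smul_zero]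
    have hsum : ∑ k, (arcStart hn D' (s k) : ℕ) = ∑ k, (arcStart hn D' k : ℕ) :=
      Equiv.sum_comp s fun k => (arcStart hn D' k : ℕ)
    rcases (Finset.sum_le_sum fun i _ => hs' i).lt_or_eq with h1 | h1
    · right
      rwa [hsum] at h1
    · left
      rw [Finset.sum_eq_sum_iff_of_le fun i _ => hs' i] at h1
      refine ext_of_isArc hn fun y => ?_
      rw [isArc_iff hn, isArc_iff hn]
      constructor
      · rintro ⟨k, rfl⟩
        exact ⟨s k, Fin.ext (h1 k (Finset.mem_univ k))⟩
      · rintro ⟨k, rfl⟩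
        refine ⟨s.symm k, Fin.ext ?_⟩
        rw [← h1 _ (Finset.mem_univ _), Equiv.apply_symm_apply]

/-- The arcs of a diagram span an isotropic subspace. -/
theorem pairing_arcClass (hn : 1 ≤ n) (D : ArcDiagram (2 * n)) {y z : Fin (2 * n)}
    (hy : D.IsArc y) (hz : D.IsArc z) :
    (symplecticBasis hn).pairing (arcClass D y) (arcClass D z) = 0 := by
  rw [arcClass, arcClass, pairing_Ico hn (D.partner y).2 (Fin.lt_def.1 hz.1).le (D.partner z).2]
  have h1 := Fin.lt_def.1 hy.1
  have h2 := Fin.lt_def.1 hz.1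
  have h3 := D.noncrossing y z
  have h4 := D.noncrossing z y
  by_cases hyz : y = z
  · subst hyz
    rw [if_neg (by omega), if_pos (by omega), if_pos (by omega), if_neg (by omega)]; norm_num
  have h5 : D.partner y ≠ z := fun e => by
    rw [← e, D.invol] at h2; omega
  have h6 : D.partner z ≠ y := fun e => by
    rw [← e, D.invol] at h1; omega
  have h7 : D.partner y ≠ D.partner z := fun e => hyz (by rw [← D.invol y, e, D.invol])
  simp only [ne_eq, Fin.ext_iff, Fin.lt_def] at h3 h4 h5 h6 h7 hyz
  have h8 : ((y : ℕ) < z ∧ (z : ℕ) ≤ D.partner y ↔ (y : ℕ) < D.partner z ∧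
      (D.partner z : ℕ) ≤ D.partner y) := by omega
  have h9 : ((y : ℕ) ≤ z ∧ (z : ℕ) < D.partner y ↔ (y : ℕ) ≤ D.partner z ∧
      (D.partner z : ℕ) < D.partner y) := by omega
  simp only [h8, h9]
  ring

/-- The wedges are primitive, since their arcs span isotropic subspaces. -/
theorem contraction_openWedge (hn : 1 ≤ n) (κ : ℂ) (D : ArcDiagram (2 * n)) :
    (symplecticBasis hn).contraction (openWedge κ (potential n) D) = 0 := by
  have := (symplecticBasis hn).contraction_prod_eq_zero
    ((arcs D).map fun k : Fin (2 * n) => κ ^ (k : ℕ) • arcClass D k) (by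
      intro u hu v hv
      obtain ⟨y, hy, rfl⟩ := List.mem_map.1 hu
      obtain ⟨z, hz, rfl⟩ := List.mem_map.1 hv
      have e : ∀ (c : ℂ) (u : H1 n), (symplecticBasis hn).pairing (c • u) =
          c • (symplecticBasis hn).pairing u := fun c u => by
        simp only [SymplecticData.pairing, Finset.smul_sum, map_smul]
        exact Finset.sum_congr rfl fun j _ => by module
      rw [e, LinearMap.smul_apply, map_smul,
        pairing_arcClass hn D ((mem_arcs D y).1 hy) ((mem_arcs D z).1 hz)]
      simp)
  rw [openWedge_potential]
  rwa [List.map_map] at this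

end Independence

/-! ### The equivalence with the homological representation -/

section Equivalence

variable {n : ℕ}

/-- The class of the wedge of the arcs. -/
noncomputable def wedgeClass (hn : 1 ≤ n) (κ : ℂ) (D : ArcDiagram (2 * n)) : HomSpace n (n - 1) :=
  (omegaWedge n (n - 1)).mkQ (arcElement hn κ D)

/-- A combination of the wedges is annihilated by the contraction, and so is a multiple of `ω` only
if it vanishes. -/
theorem linearIndependent_wedgeClass (hn : 1 ≤ n) {κ : ℂ} (hκ : κ ≠ 0) :
    LinearIndependent ℂ (wedgeClass hn κ) := by
  refine (linearIndependent_arcElement hn hκ).map ?_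
  rw [Submodule.ker_mkQ, Submodule.disjoint_def]
  intro y hy hω
  have hc : (symplecticBasis hn).contraction (y : ExteriorAlgebra ℂ (H1 n)) = 0 := by
    clear hω
    induction hy using Submodule.span_induction with
    | mem y hy =>
      obtain ⟨D, rfl⟩ := hy
      rw [coe_arcElement, contraction_openWedge]
    | zero => simp
    | add y z _ _ hy hz => rw [Submodule.coe_add, map_add, hy, hz, add_zero]
    | smul c y _ hy => rw [Submodule.coe_smul, map_smul, hy, smul_zero]
  unfold omegaWedge at hω
  split_ifs at hω with h2
  · obtain ⟨z, hz, hzy⟩ := hω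
    change omega n * z = y at hzy
    rw [← hzy, ← bivector_symplecticBasis hn] at hc
    have hz0 := (symplecticBasis hn).eq_zero_of_bivector_mul (by omega) hz hc
    rw [hz0, mul_zero] at hzy
    exact Subtype.ext hzy.symm
  · exact hω

theorem omega_mem : omega n ∈ ⋀[ℂ]^2 (H1 n) := by
  refine sum_mem fun j _ => ?_
  rw [ExteriorAlgebra.exteriorPower, pow_two]
  exact Submodule.mul_mem_mul (LinearMap.mem_range_self _ _) (LinearMap.mem_range_self _ _)

/-- Multiplication by `ω` is injective below the middle degree. -/
theorem choose_le_finrank_omegaWedge (hn : 3 ≤ n) :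
    (2 * n - 2).choose (n - 3) ≤ Module.finrank ℂ (omegaWedge n (n - 1)) := by
  have := finite_H1 (n := n) (by omega)
  have hmem : ∀ z : ⋀[ℂ]^(n - 3) (H1 n), omega n * z ∈ ⋀[ℂ]^(n - 1) (H1 n) := by
    rintro ⟨z, hz⟩
    have h := Submodule.mul_mem_mul omega_mem hz
    rw [ExteriorAlgebra.exteriorPower, ExteriorAlgebra.exteriorPower, ← pow_add,
      show 2 + (n - 3) = n - 1 by omega] at h
    exact h
  let f : ⋀[ℂ]^(n - 3) (H1 n) →ₗ[ℂ] omegaWedge n (n - 1) :=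
    LinearMap.codRestrict _ (LinearMap.codRestrict _
      (LinearMap.mulLeft ℂ (omega n) ∘ₗ (⋀[ℂ]^(n - 3) (H1 n)).subtype) hmem) (by
        intro z
        unfold omegaWedge
        rw [if_pos (by omega)]
        exact ⟨z, z.2, rfl⟩)
  have hf : Function.Injective f := by
    rw [injective_iff_map_eq_zero]
    intro z hz
    have h1 : omega n * (z : ExteriorAlgebra ℂ (H1 n)) = 0 :=
      congrArg (fun y : omegaWedge n (n - 1) => ((y : ⋀[ℂ]^(n - 1) (H1 n)) :
        ExteriorAlgebra ℂ (H1 n))) hz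
    refine Subtype.ext ((symplecticBasis (n := n) (by omega)).eq_zero_of_bivector_mul
      (by omega) z.2 ?_)
    rw [bivector_symplecticBasis, h1, map_zero]
  have h := LinearMap.finrank_le_finrank_of_injective hf
  rwa [exteriorPower.finrank_eq, finrank_H1 (by omega)] at h

/-- The dimension is at most a Catalan number, which is at most the number of diagrams. -/
theorem finrank_homSpace_le (hn : 1 ≤ n) :
    Module.finrank ℂ (HomSpace n (n - 1)) ≤ Nat.card (ArcDiagram (2 * n)) := by
  have := finite_H1 hn
  refine le_trans ?_ (catalan_le_card_arcDiagram n)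
  have h1 : Module.finrank ℂ (HomSpace n (n - 1)) + Module.finrank ℂ (omegaWedge n (n - 1)) = _ :=
    Submodule.finrank_quotient_add_finrank (omegaWedge n (n - 1))
  rw [exteriorPower.finrank_eq, finrank_H1 hn] at h1
  rcases lt_or_ge n 3 with h3 | h3
  · interval_cases n
    · rw [catalan_one]; norm_num at h1 ⊢; omega
    · rw [catalan_two]; norm_num at h1 ⊢; omega
  · have h2 := choose_le_finrank_omegaWedge h3
    have h4 := catalan_add_choose (n - 1) (by omega)
    rw [show n - 1 + 1 = n by omega, show 2 * (n - 1) = 2 * n - 2 by omega,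
      show n - 1 - 2 = n - 3 by omega] at h4
    omega

/-- The linear map sending each diagram to the class of the wedge of its arcs. -/
noncomputable def wedgeMap (hn : 1 ≤ n) (κ : ℂ) :
    (ArcDiagram (2 * n) →₀ ℂ) →ₗ[ℂ] HomSpace n (n - 1) :=
  Finsupp.linearCombination ℂ (wedgeClass hn κ)

theorem wedgeMap_single (hn : 1 ≤ n) (κ : ℂ) (D : ArcDiagram (2 * n)) :
    wedgeMap hn κ (Finsupp.single D 1) = wedgeClass hn κ D := by
  rw [wedgeMap, Finsupp.linearCombination_single, one_smul]

theorem wedgeMap_bijective (hn : 1 ≤ n) {κ : ℂ} (hκ : κ ≠ 0) :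
    Function.Bijective (wedgeMap hn κ) := by
  have := finite_H1 hn
  have hinj : Function.Injective (wedgeMap hn κ) := linearIndependent_wedgeClass hn hκ
  have := Fintype.ofFinite (ArcDiagram (2 * n))
  refine ⟨hinj, ?_⟩
  refine (LinearMap.injective_iff_surjective_of_finrank_eq_finrank
    (le_antisymm (LinearMap.finrank_le_finrank_of_injective hinj) ?_)).1 hinj
  rw [Module.finrank_finsupp_self, ← Nat.card_eq_fintype_card]
  exact finrank_homSpace_le hn

theorem map_pushforward_arcElement (hn : 1 ≤ n) {κ : ℂ} (hκ : κ ^ 2 = -1) (i : Fin (2 * n - 1))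
    (D : ArcDiagram (2 * n)) :
    exteriorPower.map (n - 1) (pushforward (surfaceAut n (Braid.σ i))) (arcElement hn κ D) =
      arcElement hn κ D +
        if D.partner (lo i) = hi i then 0 else κ • arcElement hn κ (cap i D) := by
  refine Subtype.ext ?_
  rw [coe_exteriorPower_map, coe_arcElement, map_pushforward_openWedge hn hκ]
  split_ifs
  · rw [add_zero, add_zero, coe_arcElement]
  · rw [Submodule.coe_add, Submodule.coe_smul, coe_arcElement, coe_arcElement]

theorem rhoHom_wedgeClass (hn : 1 ≤ n) {κ : ℂ} (hκ : κ ^ 2 = -1) (i : Fin (2 * n - 1))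
    (D : ArcDiagram (2 * n)) : rhoHom n (n - 1) (Braid.σ i) (wedgeClass hn κ D) =
      wedgeClass hn κ D +
        if D.partner (lo i) = hi i then 0 else κ • wedgeClass hn κ (cap i D) := by
  refine (rhoHom_σ_mkQ _ _).trans ?_
  rw [map_pushforward_arcElement hn hκ, map_add]
  refine congrArg (wedgeClass hn κ D + ·) ?_
  split_ifs
  · exact map_zero _
  · exact map_smul _ _ _

theorem loopValue_eq_zero {A : ℂˣ} (hA : (A : ℂ) ^ 4 = -1) : loopValue A = 0 := by
  have hA0 := A.ne_zero
  have : (A : ℂ) ^ 2 * loopValue A = -((A : ℂ) ^ 4 + 1) := by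
    simp only [loopValue, Units.val_inv_eq_inv_val]
    field_simp
    ring
  rw [hA] at this
  simpa [hA0] using this

theorem wedgeMap_jonesExt (hn : 1 ≤ n) {A : ℂˣ} (hA : (A : ℂ) ^ 4 = -1) (i : Fin (2 * n - 1))
    (D : ArcDiagram (2 * n)) :
    wedgeMap hn ((A : ℂ)⁻¹ ^ 2) (jonesExt (2 * n) A (Braid.σ i) (Finsupp.single D 1)) =
      wedgeClass hn ((A : ℂ)⁻¹ ^ 2) D + if D.partner (lo i) = hi i then 0 else
        (A : ℂ)⁻¹ ^ 2 • wedgeClass hn ((A : ℂ)⁻¹ ^ 2) (cap i D) := by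
  rw [jonesExt_σ, LinearMap.add_apply, Module.End.one_apply, LinearMap.smul_apply, diagramE_single,
    loopValue_eq_zero hA, map_add, wedgeMap_single, map_smul]
  congr 1
  split_ifs
  · rw [mul_zero, Finsupp.single_zero, map_zero, smul_zero]
  · rw [mul_one, wedgeMap_single]

/-- Here `κ = A⁻²`, and `σ_i` acts on both sides as `1 + κ E_i`. -/
theorem wedgeMap_intertwines (hn : 1 ≤ n) {A : ℂˣ} (hA : (A : ℂ) ^ 4 = -1) (i : Fin (2 * n - 1)) :
    wedgeMap hn ((A : ℂ)⁻¹ ^ 2) ∘ₗ jonesExt (2 * n) A (Braid.σ i) =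
      rhoHom n (n - 1) (Braid.σ i) ∘ₗ wedgeMap hn ((A : ℂ)⁻¹ ^ 2) := by
  have hκ : ((A : ℂ)⁻¹ ^ 2) ^ 2 = -1 := by
    rw [← pow_mul, inv_pow, hA]; norm_num
  refine Finsupp.lhom_ext' fun D => LinearMap.ext_ring ?_
  exact (wedgeMap_jonesExt hn hA i D).trans ((rhoHom_wedgeClass hn hκ i D).symm.trans
    (congrArg (rhoHom n (n - 1) (Braid.σ i)) (wedgeMap_single hn _ D).symm))

/-- The equivalence, for `A⁴ = -1`, of the extended Jones representation with the homological
representation, scaled by a constant. -/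
noncomputable def homEquiv (hn : 1 ≤ n) {A : ℂˣ} (hA : (A : ℂ) ^ 4 = -1) (c : ℂˣ) :
    (jonesExt (2 * n) A).Equiv (rhoHom n (n - 1)) :=
  Representation.Equiv.mk
    ((LinearEquiv.ofBijective (wedgeMap hn ((A : ℂ)⁻¹ ^ 2))
      (wedgeMap_bijective hn (pow_ne_zero _ (inv_ne_zero A.ne_zero)))).trans
      (LinearEquiv.smulOfUnit c))
    (equiv_of_gen (c • wedgeMap hn ((A : ℂ)⁻¹ ^ 2)) fun i => by
      rw [LinearMap.smul_comp, wedgeMap_intertwines hn hA, LinearMap.comp_smul])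

theorem homEquiv_single (hn : 1 ≤ n) {A : ℂˣ} (hA : (A : ℂ) ^ 4 = -1) (c : ℂˣ)
    (D : ArcDiagram (2 * n)) : homEquiv hn hA c (Finsupp.single D 1) =
      (omegaWedge n (n - 1)).mkQ ((c : ℂ) • arcElement hn ((A : ℂ)⁻¹ ^ 2) D) := by
  rw [map_smul]
  exact congrArg (fun y => (c : ℂ) • y) (wedgeMap_single hn _ D)

end Equivalence

end JonesHomology

theorem theorem1p1 (n : ℕ) (hn : 1 ≤ n) :
    (∀ (b : Braid (2 * n)) (D D' : ArcDiagram (2 * n)), ∃ p : ℤ →₀ ℤ, ∀ A : ℂˣ,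
      jonesExt (2 * n) A b (Finsupp.single D 1) D' =
        p.sum fun k z => (z : ℂ) * ((A ^ k : ℂˣ) : ℂ)) ∧
    (∀ (A : ℂˣ) (hq : BraidRegular (2 * n) ((A : ℂ) ^ 4)),
      Nonempty ((jonesExt (2 * n) A).Equiv (jonesRep (2 * n) 0 ((A : ℂ) ^ 4) hq))) ∧
    (∀ A : ℂˣ, (A : ℂ) ^ 4 = -1 →
      Nonempty ((jonesExt (2 * n) A).Equiv (rhoHom n (n - 1)))) ∧
    (∀ A : ℂˣ, (A : ℂ) = Complex.exp (-(Real.pi * Complex.I) / 4) →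
      ∃ Φ : (jonesExt (2 * n) A).Equiv (rhoHom n (n - 1)),
        ∀ D : ArcDiagram (2 * n), ∃ y : ⋀[ℂ]^(n - 1) (H1 n),
          (y : ExteriorAlgebra ℂ (H1 n)) = scaledWedge D ∧
          Φ (Finsupp.single D 1) = (omegaWedge n (n - 1)).mkQ y) := by
  refine ⟨fun b D D' => exists_of_mem_laurentFun ((jonesExt_mem_laurentFun b).1 D D'),
    fun A hq => ⟨jonesExtEquiv hq⟩, fun A hA => ⟨homEquiv hn hA 1⟩, fun A hA => ?_⟩
  have h4 : (A : ℂ) ^ 4 = -1 := by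
    rw [hA, ← Complex.exp_nat_mul, show ((4 : ℕ) : ℂ) * (-(Real.pi * Complex.I) / 4) =
      -(Real.pi * Complex.I) by push_cast; ring, Complex.exp_neg, Complex.exp_pi_mul_I]
    norm_num
  have h2 : (A : ℂ)⁻¹ ^ 2 = Complex.I := by
    rw [hA, ← Complex.exp_neg, ← Complex.exp_nat_mul, show ((2 : ℕ) : ℂ) *
      (-(-(Real.pi * Complex.I) / 4)) = Real.pi / 2 * Complex.I by push_cast; ring,
      Complex.exp_pi_div_two_mul_I]
  set c : ℂˣ := Units.mk0 ((-Complex.I) ^ (n - 1) ^ 2)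
    (pow_ne_zero _ (neg_ne_zero.2 Complex.I_ne_zero)) with hc
  refine ⟨homEquiv hn h4 c, fun D => ⟨(c : ℂ) • arcElement hn ((A : ℂ)⁻¹ ^ 2) D, ?_,
    homEquiv_single hn h4 c D⟩⟩
  rw [h2, scaledWedge_eq hn, Submodule.coe_smul, coe_arcElement, hc, Units.val_mk0]
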